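/- **Setting.** Types are $A,B::=\mathsf R\mid A\times B\mid A\to B\mid \mathsf R^{\perp_d}$ ($d\ge 1$), where $\mathsf R^d=\mathsf R\times(\cdots\times\mathsf R)$ and $\mathsf R^{\perp_d}$ is the type of linear maps $\mathsf R\multimap\mathsf R^d$. Variables are annotated: exponential ($x^{!A}$) or linear ($x^{\mathsf R}$). Terms of the linear substitution calculus are $$t,u::=x\mid \underline r\ (r\in\mathbb R)\mid\lambda x.t\mid tu\mid\langle t,u\rangle\mid t[x:=u]\mid t[\langle x,y\rangle:=u]\mid t+u\mid f(t_1,\dots,t_k),$$ up to $\alpha$-equivalence; values are $v::=x\mid\underline r\mid\lambda x.t\mid\langle v_1,v_2\rangle$; $\alpha,\beta$ range over stacks of explicit substitutions. Typing is that of the simply typed $\lambda$-calculus, with $\lambda z.t:\mathsf R^{\perp_d}$ when $t:\mathsf R^d$ uses the linear variable $z$ linearly. The size $|t|$ is the number of symbols of $t$. The symbols $f$ come from a set $\mathcal F'$ with interpretations $[\![f]\!]:\mathbb R^k\to\mathbb R$. There is a finite subset $\mathcal F\subseteq\mathcal F'$, containing multiplication, all of whose members are interpreted by differentiable maps, and for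 each $k$-ary $f\in\mathcal F$ and $i\le k$ there is a $k$-ary $\partial_if\in\mathcal F'$ with $[\![\partial_if]\!]=\partial_i[\![f]\!]$. A *source term* is a typed term without linear variables and linear negation, with symbols in $\mathcal F$, and with sums only at type $\mathsf R$; $[\![t]\!]$ is its set-theoretic denotation. *Ground terms* are $F,G::=x^{!\mathsf R}\mid\underline r\mid F[x^{!\mathsf R}:=G]\mid f(G_1,\dots,G_k)\ (f\in\mathcal F)\mid F+G$. *Reduction.* All rules are closed under arbitrary contexts. The $\beta$-rules are $(\lambda x.t)\alpha\,u\to t[x:=u]\alpha$; $s[\langle x,y\rangle:=\langle t,u\rangle\alpha]\to s[x:=t][y:=u]\alpha$; $\mathsf C\{x\}[x^{!A}:=v\alpha]\to\mathsf C\{v\}[x^{!A}:=v]\alpha$; $t[x^{!A}:=v\alpha]\to t\alpha$ if $x\notin\mathrm{fv}(t)$; $t[x^{\mathsf R}:=v\alpha]\to t\{v/x\}\alpha$; $\underline r\alpha+\underline q\beta\to\underline{r+q}\,\alpha\beta$; $\langle t_1,t_2\rangle\alpha+\langle u_1,u_2\rangle\beta\to\langle t_1+u_1,t_2+u_2\rangle\alpha\beta$;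 $f(\underline{r_1}\alpha_1,\dots,\underline{r_k}\alpha_k)\to\underline{[\![f]\!](r_1,\dots,r_k)}\,\alpha_1\cdots\alpha_k$. The full reduction $\to$ has also the $\eta$-rules $t\to\lambda y.ty$ ($t$ of type $A\to B$ or $\mathsf R^{\perp_d}$) and $t[x:=\langle u,u'\rangle]\to t[x:=\langle y,y'\rangle][\langle y,y'\rangle:=\langle u,u'\rangle]$, and linear factoring $(x\alpha\,t)\beta+(x\alpha'\,t')\beta'\to x(t+t')\alpha\beta\alpha'\beta'$ for $x$ of type $\mathsf R^{\perp_d}$ not bound by $\alpha,\beta,\alpha',\beta'$. *Equivalence.* $\equiv$ is the congruence generated by (for patterns $p,q$, each a variable or a pair of variables, and without capture) $t[p:=u][q:=w]\equiv t[q:=w][p:=u]$; $t[p:=u][q:=w]\equiv t[p:=u[q:=w]]$ if $t$ does not use $q$; $t[x^{!A}:=u]\equiv t_{\{y/x\}}[x:=u][y:=u]$, where some occurrences of $x$ are renamed to $y$; $(s\,\square\,t)[p:=u]\equiv s[p:=u]\,\square\,t$ if $t$ does not use $p$, and symmetrically, where $\square$ is application, sum, product or pairing; and by associativity and commutativity of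 $+$ and neutrality of the zero tuple $\underline{\mathbf 0}:\mathsf R^d$ for $+$ at type $\mathsf R^d$. *The transformation.* For $d\ge1$, $\mathbf D$ maps $\mathsf R$ to $\mathsf R\times\mathsf R^{\perp_d}$ and commutes with $\to$ and $\times$; on terms it commutes with variables (changing their types), abstraction, application, pairing and explicit substitutions, and $\mathbf D(\underline r)=\langle\underline r,\lambda a.\underline{\mathbf 0}\rangle$, $\mathbf D(t+u)=\langle x+y,\lambda a.(x^*a+y^*a)\rangle[\langle x,x^*\rangle:=\mathbf D(t)][\langle y,y^*\rangle:=\mathbf D(u)]$, $\mathbf D(f(t_1,\dots,t_k))=\langle f(\mathbf x),\lambda a.\sum_{i=1}^kx_i^*(\partial_if(\mathbf x)\cdot a)\rangle[\langle x_1,x_1^*\rangle:=\mathbf D(t_1)]\cdots[\langle x_k,x_k^*\rangle:=\mathbf D(t_k)]$. An empty sum is $\underline{\mathbf 0}$. **Statement.** There is a constant $C$, depending only on the function symbols and their interpretations, such that the following holds for all $d\ge 1$ and $n\ge 0$. Let $t$ be a source term with $x_1^{!\mathsf R},\dots,x_n^{!\mathsf R}\vdash t:\mathsf R$, and suppose that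 $t$ reduces to a ground term $G$ in $m$ $\beta$-steps. Let $\mathbf r\in\mathbb R^n$. Then $[\![t]\!]:\mathbb R^n\to\mathbb R$ is differentiable at $\mathbf r$ and, with $(g_1,\dots,g_n)=\nabla[\![t]\!](\mathbf r)$, there is $J\subseteq\{1,\dots,n\}$ with $g_i=0$ for all $i\notin J$ such that the term $$(z^*\underline1)\big[\langle z,z^*\rangle:=\mathbf D(t)[x_1:=\langle x_1,\lambda a.x_1^*a\rangle]\cdots[x_n:=\langle x_n,\lambda a.x_n^*a\rangle]\big][x_1:=\underline{r_1}]\cdots[x_n:=\underline{r_n}]$$ reduces to $\sum_{j\in J}x_j^*\,\underline{g_j}$ by a sequence of $\to$-steps, interleaved with uses of $\equiv$, that contains at most $C\,(m+|G|)$ $\to$-steps. -/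

import Mathlib

noncomputable section

namespace LSC

/-! # Types, signatures, terms -/

/-- Simple types. `dual d` is the linear negation of `R` relative to the Euclidean type of
dimension `d + 1`; indexing by `d + 1` means that exactly the positive dimensions occur. -/
inductive Ty : Type
  | R : Ty
  | prod (A B : Ty) : Ty
  | arr (A B : Ty) : Ty
  | dual (d : ℕ) : Ty

/-- The Euclidean type `R × (R × ⋯ × R)` with `d + 1` factors. -/
def Ty.pow : ℕ → Ty
  | 0 => .R
  | d + 1 => .prod .R (Ty.pow d)

/-- Types that do not use linear negation. -/
def Ty.Simple : Ty → Prop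
  | .R => True
  | .prod A B => A.Simple ∧ B.Simple
  | .arr A B => A.Simple ∧ B.Simple
  | .dual _ => False

/-- Function symbols with their interpretation. `Sym` is the big set of symbols, `F` is the
finite subset of those that may occur in source programs; it contains multiplication, its
members are interpreted by differentiable maps, and for `f ∈ F` the symbol `pd f i` denotes the
`i`-th partial derivative of `f`. -/
structure Sig where
  Sym : Type
  ar : Sym → ℕ
  sem : (f : Sym) → (Fin (ar f) → ℝ) → ℝ
  mul : Sym
  ar_mul : ar mul = 2
  sem_mul : ∀ r : Fin (ar mul) → ℝ, sem mul r = ∏ i, r i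
  F : Set Sym
  finite_F : F.Finite
  mul_mem : mul ∈ F
  differentiable : ∀ f ∈ F, Differentiable ℝ (sem f)
  pd : (f : Sym) → Fin (ar f) → Sym
  ar_pd : ∀ f ∈ F, ∀ i, ar (pd f i) = ar f
  sem_pd : ∀ (f : Sym) (hf : f ∈ F) (i : Fin (ar f)) (r : Fin (ar f) → ℝ),
    sem (pd f i) (fun j => r (Fin.cast (ar_pd f hf i) j)) = fderiv ℝ (sem f) r (Pi.single i 1)

/-- Annotation of a variable: exponential of some type, or linear (then of type `R`). -/
inductive Ann : Type
  | exp (A : Ty) : Ann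
  | lin : Ann

/-- What an explicit substitution binds: one annotated variable, or a pair of exponential
variables. -/
inductive Pat : Type
  | one (a : Ann) : Pat
  | two (A B : Ty) : Pat

/-- Number of variables bound by a pattern. -/
def Pat.ar : Pat → ℕ
  | .one _ => 1
  | .two _ _ => 2

/-- Church-style raw terms in de Bruijn notation, so that alpha-equivalence is equality.
Every occurrence of a variable carries its annotation. `esub p t u` is the explicit substitution
`t[p := u]`; it binds `p.ar` variables in `t`. For `p = two A B`, that is `t[⟨x, y⟩ := u]`, the
index of `x` is `0` and the index of `y` is `1`. -/
inductive Tm (S : Sig) : Type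
  | var (a : Ann) (i : ℕ) : Tm S
  | num (r : ℝ) : Tm S
  | lam (a : Ann) (t : Tm S) : Tm S
  | app (t u : Tm S) : Tm S
  | pair (t u : Tm S) : Tm S
  | esub (p : Pat) (t u : Tm S) : Tm S
  | add (t u : Tm S) : Tm S
  | fn (f : S.Sym) (ts : Fin (S.ar f) → Tm S) : Tm S

variable {S : Sig}

/-- The product `t · u`: the distinguished binary symbol applied to `t` and `u`. -/
def Tm.mul (t u : Tm S) : Tm S := .fn S.mul (fun i => if i.val = 0 then t else u)

/-- The tuple of `d + 1` numerals `0`. -/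
def Tm.zero : ℕ → Tm S
  | 0 => .num 0
  | d + 1 => .pair (.num 0) (Tm.zero d)

/-- A finite sum of terms of type `Ty.pow d`: the empty sum is the tuple of zeros, and the sum of
one term is that term. -/
def Tm.sum (d : ℕ) : List (Tm S) → Tm S
  | [] => Tm.zero d
  | [t] => t
  | t :: u :: l => .add t (Tm.sum d (u :: l))

/-- The size of a term. -/
def Tm.size : Tm S → ℕ
  | .var _ _ => 1
  | .num _ => 1
  | .lam _ t => t.size + 1
  | .app t u => t.size + u.size + 1
  | .pair t u => t.size + u.size + 1
  | .esub _ t u => t.size + u.size + 1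
  | .add t u => t.size + u.size + 1
  | .fn _ ts => (∑ i, (ts i).size) + 1

/-! # Renaming and substitution -/

/-- Extend a renaming below `k` binders. -/
def up (k : ℕ) (f : ℕ → ℕ) (i : ℕ) : ℕ := if i < k then i else f (i - k) + k

def Tm.rename : Tm S → (ℕ → ℕ) → Tm S
  | .var a i, f => .var a (f i)
  | .num r, _ => .num r
  | .lam a t, f => .lam a (t.rename (up 1 f))
  | .app t u, f => .app (t.rename f) (u.rename f)
  | .pair t u, f => .pair (t.rename f) (u.rename f)
  | .esub p t u, f => .esub p (t.rename (up p.ar f)) (u.rename f)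
  | .add t u, f => .add (t.rename f) (u.rename f)
  | .fn g ts, f => .fn g (fun i => (ts i).rename f)

/-- Weakening: insert `k` fresh variables at index `c`. -/
def Tm.wk (c k : ℕ) (t : Tm S) : Tm S := t.rename (fun i => if i < c then i else i + k)

/-- Extend a substitution below `k` binders. -/
def upS (k : ℕ) (σ : Ann → ℕ → Tm S) (a : Ann) (i : ℕ) : Tm S :=
  if i < k then .var a i else (σ a (i - k)).wk 0 k

/-- Capture-avoiding parallel substitution. -/
def Tm.subst : Tm S → (Ann → ℕ → Tm S) → Tm S
  | .var a i, σ => σ a i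
  | .num r, _ => .num r
  | .lam a t, σ => .lam a (t.subst (upS 1 σ))
  | .app t u, σ => .app (t.subst σ) (u.subst σ)
  | .pair t u, σ => .pair (t.subst σ) (u.subst σ)
  | .esub p t u, σ => .esub p (t.subst (upS p.ar σ)) (u.subst σ)
  | .add t u, σ => .add (t.subst σ) (u.subst σ)
  | .fn g ts, σ => .fn g (fun i => (ts i).subst σ)

/-- Substitute `v` for all occurrences of the variable of index `0`, which disappears. -/
def Tm.inst (t v : Tm S) : Tm S :=
  t.subst (fun a i => if i = 0 then v else .var a (i - 1))

/-- `Replace A k v t t'`: `t'` is `t` with exactly one occurrence of the exponential variable of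
type `A` and index `k` replaced by `v`, without capture of the variables of `v`. -/
inductive Replace (A : Ty) : ℕ → Tm S → Tm S → Tm S → Prop
  | here (k v) : Replace A k v (.var (.exp A) k) v
  | lam {k v t t'} (a) : Replace A (k + 1) (v.wk 0 1) t t' → Replace A k v (.lam a t) (.lam a t')
  | appL {k v t t'} (u) : Replace A k v t t' → Replace A k v (.app t u) (.app t' u)
  | appR {k v u u'} (t) : Replace A k v u u' → Replace A k v (.app t u) (.app t u')
  | pairL {k v t t'} (u) : Replace A k v t t' → Replace A k v (.pair t u) (.pair t' u)
  | pairR {k v u u'} (t) : Replace A k v u u' → Replace A k v (.pair t u) (.pair t u')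
  | esubL {k v t t'} (p : Pat) (u) : Replace A (k + p.ar) (v.wk 0 p.ar) t t' →
      Replace A k v (.esub p t u) (.esub p t' u)
  | esubR {k v u u'} (p t) : Replace A k v u u' → Replace A k v (.esub p t u) (.esub p t u')
  | addL {k v t t'} (u) : Replace A k v t t' → Replace A k v (.add t u) (.add t' u)
  | addR {k v u u'} (t) : Replace A k v u u' → Replace A k v (.add t u) (.add t u')
  | fn {k v t'} (f) (ts : Fin (S.ar f) → Tm S) (i) : Replace A k v (ts i) t' →
      Replace A k v (.fn f ts) (.fn f (Function.update ts i t'))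

/-! # Substitution contexts -/

/-- A substitution context `{·}[p₁ := t₁] ⋯ [pₙ := tₙ]`, listed from `p₁` to `pₙ`. The terms to
the left lie in the scope of the patterns to their right. -/
abbrev SCtx (S : Sig) := List (Pat × Tm S)

/-- Number of variables bound at the hole. -/
def SCtx.bnd : SCtx S → ℕ
  | [] => 0
  | (p, _) :: α => p.ar + SCtx.bnd α

/-- Fill the hole; the variables bound by the context may be captured. -/
def SCtx.plug : SCtx S → Tm S → Tm S
  | [], t => t
  | (p, u) :: α, t => SCtx.plug α (.esub p t u)

/-- Insert `k` fresh variables at index `0` of the ambient context. -/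
def SCtx.wk (k : ℕ) : SCtx S → SCtx S
  | [] => []
  | (p, u) :: α => (p, u.wk (SCtx.bnd α) k) :: SCtx.wk k α

/-- The concatenation `{·}αβ` of two substitution contexts of the same ambient context. -/
def SCtx.cat (α β : SCtx S) : SCtx S := SCtx.wk (SCtx.bnd β) α ++ β

/-- The concatenation `{·}α₁⋯αₖ`. -/
def SCtx.catAll : List (SCtx S) → SCtx S
  | [] => []
  | α :: l => SCtx.cat α (SCtx.catAll l)

/-! # Typing -/

/-- The typing rules. `HasTy Γ none t A` is `Γ ⊢ t : A`, and `HasTy Γ (some i) t A` is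
`Γ ⊢_z t : A` where `z` is the linear variable of index `i`. The list `Γ` gives the annotations
of all variables in scope; linear variables other than the one of index `i` are not usable. -/
inductive HasTy : List Ann → Option ℕ → Tm S → Ty → Prop
  | lvar {Γ i} : Γ[i]? = some .lin → HasTy Γ (some i) (.var .lin i) .R
  | var {Γ i A} : Γ[i]? = some (.exp A) → HasTy Γ none (.var (.exp A) i) A
  | pair {Γ z t u A B} : (z ≠ none → A = .R) → HasTy Γ z t A → HasTy Γ z u B →
      HasTy Γ z (.pair t u) (.prod A B)
  | esub2 {Γ z t u A B C} : HasTy Γ none u (.prod A B) →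
      HasTy (.exp A :: .exp B :: Γ) (z.map (· + 2)) t C → HasTy Γ z (.esub (.two A B) t u) C
  | lam {Γ t A B} : HasTy (.exp A :: Γ) none t B → HasTy Γ none (.lam (.exp A) t) (.arr A B)
  | app {Γ t u A B} : HasTy Γ none t (.arr A B) → HasTy Γ none u A → HasTy Γ none (.app t u) B
  | llam {Γ t d} : HasTy (.lin :: Γ) (some 0) t (.pow d) → HasTy Γ none (.lam .lin t) (.dual d)
  | lapp {Γ z t u d} : HasTy Γ none t (.dual d) → HasTy Γ z u .R → HasTy Γ z (.app t u) (.pow d)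
  | esub {Γ z t u A C} : HasTy Γ none u A → HasTy (.exp A :: Γ) (z.map (· + 1)) t C →
      HasTy Γ z (.esub (.one (.exp A)) t u) C
  | lesub {Γ z t u d} : HasTy Γ z u .R → HasTy (.lin :: Γ) (some 0) t (.pow d) →
      HasTy Γ z (.esub (.one .lin) t u) (.pow d)
  | fn {Γ} {f : S.Sym} {ts : Fin (S.ar f) → Tm S} : (∀ i, HasTy Γ none (ts i) .R) →
      HasTy Γ none (.fn f ts) .R
  | num {Γ r} : HasTy Γ none (.num r) .R
  | mulL {Γ z t u} : HasTy Γ z t .R → HasTy Γ none u .R → HasTy Γ z (Tm.mul t u) .R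
  | mulR {Γ z t u} : HasTy Γ none t .R → HasTy Γ z u .R → HasTy Γ z (Tm.mul t u) .R
  | zero {Γ i d} : Γ[i]? = some .lin → HasTy Γ (some i) (.zero d) (.pow d)
  | add {Γ z t u d} : HasTy Γ z t (.pow d) → HasTy Γ z u (.pow d) → HasTy Γ z (.add t u) (.pow d)

/-! # Reduction -/

/-- Values. -/
inductive Value : Tm S → Prop
  | var (a i) : Value (.var a i)
  | num (r) : Value (.num r)
  | lam (a t) : Value (.lam a t)
  | pair {t u} : Value t → Value u → Value (.pair t u)

open SCtx in
/-- The evaluation rules, applied at the root. The rule `fn` evaluates every function symbol on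
numerals; the rule for the product is the case of the symbol `S.mul`. -/
inductive BetaRule : Tm S → Tm S → Prop
  /-- `(λx.t)α u → t[x := u]α` -/
  | lam (a) (t u : Tm S) (α : SCtx S) : BetaRule
      (.app (plug α (.lam a t)) u)
      (plug α (.esub (.one a) t (u.wk 0 (bnd α))))
  /-- `s[⟨x, y⟩ := ⟨t, u⟩α] → s[x := t][y := u]α` -/
  | pair (A B) (s t u : Tm S) (α : SCtx S) : BetaRule
      (.esub (.two A B) s (plug α (.pair t u)))
      (plug α (.esub (.one (.exp B)) (.esub (.one (.exp A)) (s.wk 2 (bnd α)) (t.wk 0 1)) u))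
  /-- `C{x}[x := vα] → C{v}[x := v]α` -/
  | subst (A) (t t' v : Tm S) (α : SCtx S) : Value v → Replace A 0 (v.wk 0 1) (t.wk 1 (bnd α)) t' → BetaRule
      (.esub (.one (.exp A)) t (plug α v))
      (plug α (.esub (.one (.exp A)) t' v))
  /-- `t[x := vα] → tα` if `x` is not free in `t` -/
  | gc (A) (t v : Tm S) (α : SCtx S) : Value v → BetaRule
      (.esub (.one (.exp A)) (t.wk 0 1) (plug α v))
      (plug α (t.wk 0 (bnd α)))
  /-- `t[x := vα] → t{v/x}α` for `x` linear -/
  | lin (t v : Tm S) (α : SCtx S) : Value v → BetaRule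
      (.esub (.one .lin) t (plug α v))
      (plug α ((t.wk 1 (bnd α)).inst v))
  /-- The sum of the numerals `r` and `q`. -/
  | add (r q) (α β : SCtx S) : BetaRule
      (.add (plug α (.num r)) (plug β (.num q)))
      (plug (cat α β) (.num (r + q)))
  /-- `⟨t₁, t₂⟩α + ⟨u₁, u₂⟩β → ⟨t₁ + u₁, t₂ + u₂⟩αβ` -/
  | addPair (t₁ t₂ u₁ u₂ : Tm S) (α β : SCtx S) : BetaRule
      (.add (plug α (.pair t₁ t₂)) (plug β (.pair u₁ u₂)))
      (plug (cat α β)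
        (.pair (.add (t₁.wk (bnd α) (bnd β)) (u₁.wk 0 (bnd α)))
          (.add (t₂.wk (bnd α) (bnd β)) (u₂.wk 0 (bnd α)))))
  /-- `f(r₁α₁, …, rₖαₖ) → ⟦f⟧(r₁, …, rₖ)α₁⋯αₖ` -/
  | fn (f) (r : Fin (S.ar f) → ℝ) (α : Fin (S.ar f) → SCtx S) : BetaRule
      (.fn f (fun i => plug (α i) (.num (r i))))
      (plug (catAll (List.ofFn α)) (.num (S.sem f r)))

/-- The extensional rules. -/
inductive EtaRule : Tm S → Tm S → Prop
  /-- `t → λy.ty` for `t` of arrow type -/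
  | arr (Γ) (t : Tm S) (A B) : HasTy Γ none t (.arr A B) →
      EtaRule t (.lam (.exp A) (.app (t.wk 0 1) (.var (.exp A) 0)))
  /-- `t → λy.ty` for `t` of type a linear negation -/
  | dual (Γ) (t : Tm S) (d) : HasTy Γ none t (.dual d) →
      EtaRule t (.lam .lin (.app (t.wk 0 1) (.var .lin 0)))
  /-- `t[x := ⟨u, u'⟩] → t[x := ⟨y, y'⟩][⟨y, y'⟩ := ⟨u, u'⟩]` -/
  | pair (A B) (t u u' : Tm S) : EtaRule
      (.esub (.one (.exp (.prod A B))) t (.pair u u'))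
      (.esub (.two A B)
        (.esub (.one (.exp (.prod A B))) (t.wk 1 2) (.pair (.var (.exp A) 0) (.var (.exp B) 1)))
        (.pair u u'))

open SCtx in
/-- Linear factoring `(xα t)β + (xα' t')β' → x(t + t')αβα'β'`, where `x` is a variable whose type
is a linear negation and which is bound by none of `α, β, α', β'`. -/
inductive LinRule : Tm S → Tm S → Prop
  | mk (d i : ℕ) (t t' : Tm S) (α β α' β' : SCtx S) : LinRule
      (.add
        (plug β (.app (plug α (.var (.exp (.dual d)) (i + bnd α + bnd β))) t))
        (plug β' (.app (plug α' (.var (.exp (.dual d)) (i + bnd α' + bnd β'))) t')))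
      (plug (cat (α ++ β) (α' ++ β'))
        (.app (.var (.exp (.dual d)) (i + (bnd α + bnd β) + (bnd α' + bnd β')))
          (.add
            ((t.wk (bnd β) (bnd α' + bnd β')).wk 0 (bnd α))
            (t'.wk 0 (bnd α + bnd β + bnd α')))))

/-- Closure of a relation under all one-hole contexts. -/
inductive Cl (Q : Tm S → Tm S → Prop) : Tm S → Tm S → Prop
  | root {t u} : Q t u → Cl Q t u
  | lam (a) {t t'} : Cl Q t t' → Cl Q (.lam a t) (.lam a t')
  | appL {t t'} (u) : Cl Q t t' → Cl Q (.app t u) (.app t' u)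
  | appR (t) {u u'} : Cl Q u u' → Cl Q (.app t u) (.app t u')
  | pairL {t t'} (u) : Cl Q t t' → Cl Q (.pair t u) (.pair t' u)
  | pairR (t) {u u'} : Cl Q u u' → Cl Q (.pair t u) (.pair t u')
  | esubL (p) {t t'} (u) : Cl Q t t' → Cl Q (.esub p t u) (.esub p t' u)
  | esubR (p) (t) {u u'} : Cl Q u u' → Cl Q (.esub p t u) (.esub p t u')
  | addL {t t'} (u) : Cl Q t t' → Cl Q (.add t u) (.add t' u)
  | addR (t) {u u'} : Cl Q u u' → Cl Q (.add t u) (.add t u')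
  | fn (f) (ts : Fin (S.ar f) → Tm S) (i) {t'} : Cl Q (ts i) t' →
      Cl Q (.fn f ts) (.fn f (Function.update ts i t'))

/-- One step of evaluation. -/
def Beta : Tm S → Tm S → Prop := Cl BetaRule

/-- One step of reduction with all the rules. -/
def Red : Tm S → Tm S → Prop := Cl (fun t u => BetaRule t u ∨ EtaRule t u ∨ LinRule t u)

/-! # Structural equivalence -/

/-- The binary constructions through which explicit substitutions commute. -/
inductive BinOp : (Tm S → Tm S → Tm S) → Prop
  | app : BinOp Tm.app
  | add : BinOp Tm.add
  | mul : BinOp Tm.mul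
  | pair : BinOp Tm.pair

/-- The rules of structural equivalence. -/
inductive StructRule : Tm S → Tm S → Prop
  /-- `t[p := u][q := w] ≡ t[q := w][p := u]` if `w` does not use `p` and `u` does not use `q` -/
  | comm (p q : Pat) (t u w : Tm S) : StructRule
      (.esub q (.esub p t (u.wk 0 q.ar)) w)
      (.esub p (.esub q
        (t.rename (fun i => if i < p.ar then i + q.ar else if i < p.ar + q.ar then i - p.ar else i))
        (w.wk 0 p.ar)) u)
  /-- `t[p := u][q := w] ≡ t[p := u[q := w]]` if `t` does not use `q` -/
  | esub (p q : Pat) (t u w : Tm S) : StructRule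
      (.esub q (.esub p (t.wk p.ar q.ar) u) w)
      (.esub p t (.esub q u w))
  /-- `s{x/y}[x := u] ≡ s[x := u][y := u]`, for `x` and `y` exponential -/
  | dup (A) (s u : Tm S) : StructRule
      (.esub (.one (.exp A)) (s.rename (fun i => i - 1)) u)
      (.esub (.one (.exp A)) (.esub (.one (.exp A)) s (u.wk 0 1)) u)
  /-- `(s □ t)[p := u] ≡ s[p := u] □ t` if `t` does not use `p` -/
  | opL (op : Tm S → Tm S → Tm S) (p : Pat) (s t u : Tm S) : BinOp op → StructRule
      (.esub p (op s (t.wk 0 p.ar)) u)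
      (op (.esub p s u) t)
  /-- `(s □ t)[p := u] ≡ s □ t[p := u]` if `s` does not use `p` -/
  | opR (op : Tm S → Tm S → Tm S) (p : Pat) (s t u : Tm S) : BinOp op → StructRule
      (.esub p (op (s.wk 0 p.ar) t) u)
      (op s (.esub p t u))

/-- Associativity and commutativity of the sum, and neutrality of zero. -/
inductive SumRule : Tm S → Tm S → Prop
  | assoc (t u w : Tm S) : SumRule (.add (.add t u) w) (.add t (.add u w))
  | comm (t u : Tm S) : SumRule (.add t u) (.add u t)
  | zero (Γ z d) (t : Tm S) : HasTy Γ z t (.pow d) → SumRule (.add t (.zero d)) t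

/-- Structural equivalence together with the commutative monoid laws of the sum. -/
def Equiv : Tm S → Tm S → Prop :=
  Relation.EqvGen (Cl (fun t u => StructRule t u ∨ SumRule t u))

/-- `Steps Q k t u`: a sequence of exactly `k` steps of `Q` from `t` to `u`. -/
inductive Steps (Q : Tm S → Tm S → Prop) : ℕ → Tm S → Tm S → Prop
  | refl (t) : Steps Q 0 t t
  | step {k t u w} : Steps Q k t u → Q u w → Steps Q (k + 1) t w

/-- `StepsMod Q E k t u`: a sequence from `t` to `u` of steps of `Q` and of `E` in which exactly
`k` steps are steps of `Q`. -/
inductive StepsMod (Q E : Tm S → Tm S → Prop) : ℕ → Tm S → Tm S → Prop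
  | refl (t) : StepsMod Q E 0 t t
  | step {k t u w} : StepsMod Q E k t u → Q u w → StepsMod Q E (k + 1) t w
  | eqv {k t u w} : StepsMod Q E k t u → E u w → StepsMod Q E k t w

/-! # The source language and its semantics -/

/-- `Mem Γ A`: a variable of type `A` in the context `Γ`. -/
inductive Mem : List Ty → Ty → Type
  | head {Γ A} : Mem (A :: Γ) A
  | tail {Γ A B} : Mem Γ A → Mem (B :: Γ) A

/-- The de Bruijn index of a variable. -/
def Mem.idx : {Γ : List Ty} → {A : Ty} → Mem Γ A → ℕ
  | _, _, .head => 0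
  | _, _, .tail x => x.idx + 1

/-- Typing derivations of the source language, that is, of the raw terms without linear negation,
without linear variables and with function symbols in `S.F`. Sums are at the ground type. -/
inductive Deriv : List Ty → Tm S → Ty → Type
  | var {Γ A} (x : Mem Γ A) : Deriv Γ (.var (.exp A) x.idx) A
  | num {Γ} (r) : Deriv Γ (.num r) .R
  | lam {Γ A B t} : A.Simple → Deriv (A :: Γ) t B → Deriv Γ (.lam (.exp A) t) (.arr A B)
  | app {Γ A B t u} : Deriv Γ t (.arr A B) → Deriv Γ u A → Deriv Γ (.app t u) B
  | pair {Γ A B t u} : Deriv Γ t A → Deriv Γ u B → Deriv Γ (.pair t u) (.prod A B)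
  | esub {Γ A C t u} : Deriv (A :: Γ) t C → Deriv Γ u A → Deriv Γ (.esub (.one (.exp A)) t u) C
  | esub2 {Γ A B C t u} : Deriv (A :: B :: Γ) t C → Deriv Γ u (.prod A B) →
      Deriv Γ (.esub (.two A B) t u) C
  | add {Γ t u} : Deriv Γ t .R → Deriv Γ u .R → Deriv Γ (.add t u) .R
  | fn {Γ} {f : S.Sym} {ts : Fin (S.ar f) → Tm S} : f ∈ S.F → (∀ i, Deriv Γ (ts i) .R) →
      Deriv Γ (.fn f ts) .R

/-- The set denoted by a type. -/
def Ty.den : Ty → Type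
  | .R => ℝ
  | .prod A B => A.den × B.den
  | .arr A B => A.den → B.den
  | .dual d => ℝ →ₗ[ℝ] (Fin (d + 1) → ℝ)

/-- The product of the denotations of the types of a context. -/
def Env : List Ty → Type
  | [] => Unit
  | A :: Γ => A.den × Env Γ

def Mem.den : {Γ : List Ty} → {A : Ty} → Mem Γ A → Env Γ → A.den
  | _, _, .head, g => g.1
  | _, _, .tail x, g => x.den g.2

/-- The set-theoretic denotation of a typing derivation. -/
def Deriv.den : {Γ : List Ty} → {t : Tm S} → {A : Ty} → Deriv Γ t A → Env Γ → A.den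
  | _, _, _, .var x, g => x.den g
  | _, _, _, .num r, _ => r
  | _, _, _, .lam _ D, g => fun a => D.den (a, g)
  | _, _, _, .app D E, g => (D.den g) (E.den g)
  | _, _, _, .pair D E, g => (D.den g, E.den g)
  | _, _, _, .esub D E, g => D.den (E.den g, g)
  | _, _, _, .esub2 D E, g => D.den ((E.den g).1, (E.den g).2, g)
  | _, _, _, .add D E, g => let x : ℝ := D.den g; let y : ℝ := E.den g; (x + y : ℝ)
  | _, _, _, .fn (f := f) _ D, g => S.sem f (fun i => (D i).den g)

/-- The context `x₁ : R, …, xₙ : R`; the index of `xᵢ₊₁` is `i`. -/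
abbrev realCtx (n : ℕ) : List Ty := List.replicate n .R

/-- The environment that assigns to `n` variables the coordinates of a point. -/
def realEnv : (n : ℕ) → (Fin n → ℝ) → Env (realCtx n)
  | 0, _ => ()
  | n + 1, r => (r 0, realEnv n (fun i => r i.succ))

/-- The real function of `n` variables denoted by a source term. -/
def Deriv.realFun {n : ℕ} {t : Tm S} (D : Deriv (realCtx n) t .R) (r : Fin n → ℝ) : ℝ :=
  D.den (realEnv n r)

/-- The `i`-th partial derivative of a differentiable function. -/
def partialDeriv {n : ℕ} (h : (Fin n → ℝ) → ℝ) (i : Fin n) (r : Fin n → ℝ) : ℝ :=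
  fderiv ℝ h r (Pi.single i 1)

/-- Ground terms, that is, computational graphs. -/
inductive Ground : Tm S → Prop
  | var (i) : Ground (.var (.exp .R) i)
  | num (r) : Ground (.num r)
  | esub {F G} : Ground F → Ground G → Ground (.esub (.one (.exp .R)) F G)
  | fn {f : S.Sym} {Gs : Fin (S.ar f) → Tm S} : f ∈ S.F → (∀ i, Ground (Gs i)) →
      Ground (.fn f Gs)
  | add {F G} : Ground F → Ground G → Ground (.add F G)

/-! # The reverse gradient -/

/-- The transformation of types, relative to dimension `d + 1`. On types with linear negation,
where it is not meant to be used, it is the identity. -/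
def Ty.rev (d : ℕ) : Ty → Ty
  | .R => .prod .R (.dual d)
  | .prod A B => .prod (A.rev d) (B.rev d)
  | .arr A B => .arr (A.rev d) (B.rev d)
  | .dual e => .dual e

def Ann.rev (d : ℕ) : Ann → Ann
  | .exp A => .exp (A.rev d)
  | .lin => .lin

def Pat.rev (d : ℕ) : Pat → Pat
  | .one a => .one (a.rev d)
  | .two A B => .two (A.rev d) (B.rev d)

/-- `letMany p [u₁, …, uₖ] t` is `t[p₁ := u₁] ⋯ [pₖ := uₖ]`, where the `pⱼ` are distinct instances
of the pattern `p` and the `uⱼ` are terms of the ambient context, which do not use the variables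
bound by the patterns. In `t`, the first variable of `pⱼ` has index `(j - 1) * p.ar`. -/
def letMany (p : Pat) : List (Tm S) → Tm S → Tm S
  | [], t => t
  | u :: us, t => letMany p us (.esub p t (u.wk 0 (p.ar * us.length)))

/-- The reverse gradient of a term, relative to dimension `d + 1`. In the clauses for `add` and
`fn`, the variables `xⱼ` and `xⱼ*` that are bound by the `j`-th pattern have, counting from
`j = 0`, the indices `2 j` and `2 j + 1`, plus one below the abstraction of `a`. -/
def Tm.rev (d : ℕ) : Tm S → Tm S
  | .var a i => .var (a.rev d) i
  | .num r => .pair (.num r) (.lam .lin (.zero d))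
  | .lam a t => .lam (a.rev d) (t.rev d)
  | .app t u => .app (t.rev d) (u.rev d)
  | .pair t u => .pair (t.rev d) (u.rev d)
  | .esub p t u => .esub (p.rev d) (t.rev d) (u.rev d)
  | .add t u => letMany (.two .R (.dual d)) [t.rev d, u.rev d]
      (.pair
        (.add (.var (.exp .R) 0) (.var (.exp .R) 2))
        (.lam .lin (.add
          (.app (.var (.exp (.dual d)) 2) (.var .lin 0))
          (.app (.var (.exp (.dual d)) 4) (.var .lin 0)))))
  | .fn f ts => letMany (.two .R (.dual d)) (List.ofFn (fun i => (ts i).rev d))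
      (.pair
        (.fn f (fun j => .var (.exp .R) (2 * j.val)))
        (.lam .lin (Tm.sum d (List.ofFn (fun i : Fin (S.ar f) =>
          .app (.var (.exp (.dual d)) (2 * i.val + 2))
            (Tm.mul (.fn (S.pd f i) (fun j => .var (.exp .R) (2 * j.val + 1))) (.var .lin 0)))))))

/-- The term `(z* 1)[⟨z, z*⟩ := D(t)[x₁ := ⟨x₁, λa.x₁* a⟩] ⋯ [xₙ := ⟨xₙ, λa.xₙ* a⟩]][x₁ := r₁] ⋯
[xₙ := rₙ]`, where `D` is the reverse gradient. Its free variables are `x₁*, …, xₙ*`, and the index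
of `xᵢ₊₁*` is `i`. -/
def gradTerm (d n : ℕ) (t : Tm S) (r : Fin n → ℝ) : Tm S :=
  letMany (.one (.exp .R)) (List.ofFn (fun i => .num (r i)))
    (.esub (.two .R (.dual d))
      (.app (.var (.exp (.dual d)) 1) (.num 1))
      (letMany (.one (.exp (Ty.rev d .R)))
        (List.ofFn (fun i : Fin n =>
          .pair (.var (.exp .R) i.val)
            (.lam .lin (.app (.var (.exp (.dual d)) (n + i.val + 1)) (.var .lin 0)))))
        (t.rev d)))

/-- The sum of the terms `xⱼ* gⱼ` for `j ∈ J`. -/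
def taggedSum (d : ℕ) {n : ℕ} (J : Finset (Fin n)) (g : Fin n → ℝ) : Tm S :=
  Tm.sum d (((List.finRange n).filter (fun j => decide (j ∈ J))).map
    (fun j => .app (.var (.exp (.dual d)) j.val) (.num (g j))))

end LSC

end

/-! The gradient term follows the evaluation of `t`, and its cost stays linear because no
backpropagator is ever called twice where one call suffices.

Forward simulation. Each β-step of `t` is matched by boundedly many steps of its transform
(`Rv.sim`, `Rv.sim_steps`). The literal transform of the reduct is not reached: a numeral produced
by an operation is paired with a backpropagator that combines those of the operands, where the
transform has the constant zero. So the relation `Rv` takes the backpropagators of numerals from a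
list `L`, which starts with the constant zero one and gains at most one element per step. By
`Leaves` this list is an acyclic graph of out-degree at most `B`, a bound on the arities of the
source symbols. Its members are closed and eta-expanded, hence values that no renaming affects. In
place of subject reduction, β preserves the relation `Ev` between raw terms, environments and
set-theoretic values. It excludes the linear rule and sums of pairs, and it identifies the
denotation of `t` with the value `gval` of `G`.

Backpropagation. By `Ground.backprop` the transform of `G` at a point evaluates to its value paired
with a backpropagator, which sends `c` to `c` times a fixed linear combination of tangent variables
and members of `L`. For `F[x := G]` the backpropagator of `G` stays shared: the eta-rules turn `x`
into `⟨y, λa. y* a⟩`, so only `y*` is copied, and linear factoring collects all calls of `y*` into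
one before `G` is called. A merge takes two steps and shortens the combination by one, so twice the
length of the combination serves as a potential. The chain rule follows the same recursion, with the
members of `L` counting as zero because they belong to constants.

Elimination. The members of `L` are expanded in list order, the calls of each one being merged
before its expansion, so that each is called at most once (`Leaves.eliminate`). There are at most `m
+ 1` of them. A last normalization leaves each `xⱼ*` at most once, and its coefficient is the
partial derivative.

Independence of `n`. Only the occurrences of the arguments in the transform of `G` are looked up, at
two steps each. The substitutions, by then unused, are moved by equivalence into the argument of a
single one, which is erased by one step (`Runs.garbage`). -/

noncomputable section

namespace LSC

variable {S : Sig}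

/-! # Renaming and substitution -/

theorem up_comp (k : ℕ) (f g : ℕ → ℕ) (i : ℕ) : up k g (up k f i) = up k (fun j => g (f j)) i := by
  unfold up; split_ifs <;> first | rfl | omega | simp

theorem up_id (k : ℕ) : up k (fun i => i) = fun i => i := by
  funext i; unfold up; split_ifs <;> simp; omega

theorem up_zero (f : ℕ → ℕ) : up 0 f = f := by
  funext i; simp [up]

theorem up_up (k m : ℕ) (f : ℕ → ℕ) : up k (up m f) = up (k + m) f := by
  funext i; unfold up; split_ifs <;> first | rfl | omega | (simp only [Nat.sub_sub]; omega)

theorem rename_rename (t : Tm S) (f g : ℕ → ℕ) :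
    (t.rename f).rename g = t.rename (fun i => g (f i)) := by
  induction t generalizing f g with
  | var a i => rfl
  | num r => rfl
  | lam a t ih => simp only [Tm.rename, ih, up_comp]
  | app t u ih1 ih2 => simp only [Tm.rename, ih1, ih2]
  | pair t u ih1 ih2 => simp only [Tm.rename, ih1, ih2]
  | esub p t u ih1 ih2 => simp only [Tm.rename, ih1, ih2, up_comp]
  | add t u ih1 ih2 => simp only [Tm.rename, ih1, ih2]
  | fn f ts ih => simp only [Tm.rename, ih]

theorem rename_id (t : Tm S) : t.rename (fun i => i) = t := by
  induction t with
  | var a i => rfl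
  | num r => rfl
  | lam a t ih => simp only [Tm.rename, up_id, ih]
  | app t u ih1 ih2 => simp only [Tm.rename, ih1, ih2]
  | pair t u ih1 ih2 => simp only [Tm.rename, ih1, ih2]
  | esub p t u ih1 ih2 => simp only [Tm.rename, up_id, ih1, ih2]
  | add t u ih1 ih2 => simp only [Tm.rename, ih1, ih2]
  | fn f ts ih => simp only [Tm.rename, ih]

theorem rename_ext (t : Tm S) {f g : ℕ → ℕ} (h : ∀ i, f i = g i) : t.rename f = t.rename g := by
  rw [funext h]

theorem upS_rename (k : ℕ) (f : ℕ → ℕ) (σ : Ann → ℕ → Tm S) (a : Ann) (i : ℕ) :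
    upS k σ a (up k f i) = upS k (fun a j => σ a (f j)) a i := by
  unfold upS up
  split_ifs <;> first | rfl | omega | simp

theorem rename_subst (t : Tm S) (f : ℕ → ℕ) (σ : Ann → ℕ → Tm S) :
    (t.rename f).subst σ = t.subst (fun a i => σ a (f i)) := by
  induction t generalizing f σ with
  | var a i => rfl
  | num r => rfl
  | lam a t ih => simp only [Tm.rename, Tm.subst, ih, upS_rename]
  | app t u ih1 ih2 => simp only [Tm.rename, Tm.subst, ih1, ih2]
  | pair t u ih1 ih2 => simp only [Tm.rename, Tm.subst, ih1, ih2]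
  | esub p t u ih1 ih2 => simp only [Tm.rename, Tm.subst, ih1, ih2, upS_rename]
  | add t u ih1 ih2 => simp only [Tm.rename, Tm.subst, ih1, ih2]
  | fn f ts ih => simp only [Tm.rename, Tm.subst, ih]

theorem wk_up (t : Tm S) (k : ℕ) (f : ℕ → ℕ) :
    (t.wk 0 k).rename (up k f) = (t.rename f).wk 0 k := by
  simp only [Tm.wk, rename_rename]
  exact rename_ext _ fun i => by simp [up]

theorem rename_upS (k : ℕ) (f : ℕ → ℕ) (σ : Ann → ℕ → Tm S) (a : Ann) (i : ℕ) :
    (upS k σ a i).rename (up k f) = upS k (fun a j => (σ a j).rename f) a i := by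
  unfold upS
  split_ifs with h
  · simp [Tm.rename, up, h]
  · exact wk_up _ _ _

theorem subst_rename (t : Tm S) (f : ℕ → ℕ) (σ : Ann → ℕ → Tm S) :
    (t.subst σ).rename f = t.subst (fun a i => (σ a i).rename f) := by
  induction t generalizing f σ with
  | var a i => rfl
  | num r => rfl
  | lam a t ih => simp only [Tm.rename, Tm.subst, ih, rename_upS]
  | app t u ih1 ih2 => simp only [Tm.rename, Tm.subst, ih1, ih2]
  | pair t u ih1 ih2 => simp only [Tm.rename, Tm.subst, ih1, ih2]
  | esub p t u ih1 ih2 => simp only [Tm.rename, Tm.subst, ih1, ih2, rename_upS]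
  | add t u ih1 ih2 => simp only [Tm.rename, Tm.subst, ih1, ih2]
  | fn f ts ih => simp only [Tm.rename, Tm.subst, ih]

theorem subst_upS (k : ℕ) (σ τ : Ann → ℕ → Tm S) (a : Ann) (i : ℕ) :
    (upS k σ a i).subst (upS k τ) = upS k (fun a j => (σ a j).subst τ) a i := by
  unfold upS
  split_ifs with h
  · simp [Tm.subst, h]
  · simp only [Tm.wk, rename_subst, subst_rename]
    congr 1; funext a j; simp

theorem subst_subst (t : Tm S) (σ τ : Ann → ℕ → Tm S) :
    (t.subst σ).subst τ = t.subst (fun a i => (σ a i).subst τ) := by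
  induction t generalizing σ τ with
  | var a i => rfl
  | num r => rfl
  | lam a t ih => simp only [Tm.subst, ih, subst_upS]
  | app t u ih1 ih2 => simp only [Tm.subst, ih1, ih2]
  | pair t u ih1 ih2 => simp only [Tm.subst, ih1, ih2]
  | esub p t u ih1 ih2 => simp only [Tm.subst, ih1, ih2, subst_upS]
  | add t u ih1 ih2 => simp only [Tm.subst, ih1, ih2]
  | fn f ts ih => simp only [Tm.subst, ih]

theorem upS_var (k : ℕ) (f : ℕ → ℕ) :
    upS k (fun a i => (.var a (f i) : Tm S)) = fun a i => .var a (up k f i) := by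
  funext a i; unfold upS up; split_ifs <;> simp [Tm.wk, Tm.rename]

theorem rename_eq_subst (t : Tm S) (f : ℕ → ℕ) : t.rename f = t.subst (fun a i => .var a (f i)) := by
  induction t generalizing f with
  | var a i => rfl
  | num r => rfl
  | lam a t ih => simp only [Tm.rename, Tm.subst, ih, upS_var]
  | app t u ih1 ih2 => simp only [Tm.rename, Tm.subst, ih1, ih2]
  | pair t u ih1 ih2 => simp only [Tm.rename, Tm.subst, ih1, ih2]
  | esub p t u ih1 ih2 => simp only [Tm.rename, Tm.subst, ih1, ih2, upS_var]
  | add t u ih1 ih2 => simp only [Tm.rename, Tm.subst, ih1, ih2]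
  | fn f ts ih => simp only [Tm.rename, Tm.subst, ih]

theorem subst_var (t : Tm S) : t.subst (fun a i => .var a i) = t := by
  rw [← rename_eq_subst t (fun i => i), rename_id]

theorem wk_zero (t : Tm S) (c : ℕ) : t.wk c 0 = t := by
  simp [Tm.wk, rename_id]

theorem wk_inst (t v : Tm S) : (t.wk 0 1).inst v = t := by
  simp only [Tm.wk, Tm.inst, rename_subst]
  simp [subst_var]

theorem inst_rename (t v : Tm S) (f : ℕ → ℕ) :
    (t.inst v).rename f = (t.rename (up 1 f)).inst (v.rename f) := by
  simp only [Tm.inst, rename_subst, subst_rename]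
  congr 1; funext a i
  rcases i with _ | i <;> simp [up, Tm.rename]

theorem wk_wk_zero (t : Tm S) (k m : ℕ) : (t.wk 0 k).wk 0 m = t.wk 0 (k + m) := by
  simp only [Tm.wk, rename_rename]
  exact rename_ext _ fun i => by simp; omega

/-! # Weighted numbers of free occurrences -/

/-- The sum of the weights of the free occurrences of variables. -/
def Tm.occ : Tm S → (Ann → ℕ → ℕ) → ℕ
  | .var a i, w => w a i
  | .num _, _ => 0
  | .lam _ t, w => t.occ (fun a i => if i < 1 then 0 else w a (i - 1))
  | .app t u, w => t.occ w + u.occ w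
  | .pair t u, w => t.occ w + u.occ w
  | .esub p t u, w => t.occ (fun a i => if i < p.ar then 0 else w a (i - p.ar)) + u.occ w
  | .add t u, w => t.occ w + u.occ w
  | .fn _ ts, w => ∑ i, (ts i).occ w

theorem occ_rename (t : Tm S) (f : ℕ → ℕ) (w : Ann → ℕ → ℕ) :
    (t.rename f).occ w = t.occ (fun a i => w a (f i)) := by
  induction t generalizing f w with
  | var a i => rfl
  | num r => rfl
  | lam a t ih =>
    simp only [Tm.rename, Tm.occ, ih]; congr 1; funext a i; unfold up; split_ifs <;> first | rfl | omega
  | app t u ih1 ih2 => simp only [Tm.rename, Tm.occ, ih1, ih2]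
  | pair t u ih1 ih2 => simp only [Tm.rename, Tm.occ, ih1, ih2]
  | esub p t u ih1 ih2 =>
    simp only [Tm.rename, Tm.occ, ih1, ih2]; congr 2; funext a i; unfold up; split_ifs <;> first | omega | simp
  | add t u ih1 ih2 => simp only [Tm.rename, Tm.occ, ih1, ih2]
  | fn f ts ih => simp only [Tm.rename, Tm.occ, ih]

theorem occ_zero (t : Tm S) : t.occ (fun _ _ => 0) = 0 := by
  induction t with
  | var a i => rfl
  | num r => rfl
  | lam a t ih => simpa [Tm.occ] using ih
  | app t u ih1 ih2 => simp [Tm.occ, ih1, ih2]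
  | pair t u ih1 ih2 => simp [Tm.occ, ih1, ih2]
  | esub p t u ih1 ih2 => simp [Tm.occ, ih1, ih2]
  | add t u ih1 ih2 => simp [Tm.occ, ih1, ih2]
  | fn f ts ih => simp [Tm.occ, ih]

theorem occ_add (t : Tm S) (w w' : Ann → ℕ → ℕ) :
    t.occ (fun a i => w a i + w' a i) = t.occ w + t.occ w' := by
  induction t generalizing w w' with
  | var a i => rfl
  | num r => rfl
  | lam a t ih => simp only [Tm.occ, ← ih]; congr 1; funext a i; split_ifs <;> simp
  | app t u ih1 ih2 => simp only [Tm.occ, ih1, ih2]; omega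
  | pair t u ih1 ih2 => simp only [Tm.occ, ih1, ih2]; omega
  | esub p t u ih1 ih2 =>
    have : (fun a i => if i < p.ar then 0 else w a (i - p.ar) + w' a (i - p.ar)) =
      fun a i => (if i < p.ar then 0 else w a (i - p.ar)) + (if i < p.ar then 0 else w' a (i - p.ar)) := by
      funext a i; split_ifs <;> simp
    simp only [Tm.occ, ih2, this, ih1]; omega
  | add t u ih1 ih2 => simp only [Tm.occ, ih1, ih2]; omega
  | fn f ts ih => simp only [Tm.occ, ih, Finset.sum_add_distrib]

theorem occ_mono (t : Tm S) {w w' : Ann → ℕ → ℕ} (h : ∀ a i, w a i ≤ w' a i) : t.occ w ≤ t.occ w' := by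
  have : w' = fun a i => w a i + (w' a i - w a i) := by funext a i; have := h a i; omega
  rw [this, occ_add]; omega

/-- A vanishing weighted count says that every free occurrence has weight zero, whatever the size of
the other weights. This form serves for scoping, for annotations and for closedness alike. -/
theorem occ_eq_zero_mono {t : Tm S} {w w' : Ann → ℕ → ℕ} (h : t.occ w = 0)
    (hw : ∀ a i, w a i = 0 → w' a i = 0) : t.occ w' = 0 := by
  induction t generalizing w w' with
  | var a i => exact hw _ _ h
  | num r => rfl
  | lam a t ih => exact ih h fun a i => by split_ifs; exacts [id, hw _ _]
  | app t u ih1 ih2 =>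
    simp only [Tm.occ, Nat.add_eq_zero_iff] at h ⊢; exact ⟨ih1 h.1 hw, ih2 h.2 hw⟩
  | pair t u ih1 ih2 =>
    simp only [Tm.occ, Nat.add_eq_zero_iff] at h ⊢; exact ⟨ih1 h.1 hw, ih2 h.2 hw⟩
  | esub p t u ih1 ih2 =>
    simp only [Tm.occ, Nat.add_eq_zero_iff] at h ⊢
    exact ⟨ih1 h.1 fun a i => by split_ifs; exacts [id, hw _ _], ih2 h.2 hw⟩
  | add t u ih1 ih2 =>
    simp only [Tm.occ, Nat.add_eq_zero_iff] at h ⊢; exact ⟨ih1 h.1 hw, ih2 h.2 hw⟩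
  | fn f ts ih =>
    simp only [Tm.occ, Finset.sum_eq_zero_iff, Finset.mem_univ, true_implies] at h ⊢
    exact fun i => ih i (h i) hw

/-- Only the values of a substitution at free occurrences matter; the weight `w` marks the places
where the two may differ. -/
theorem subst_congr {t : Tm S} {σ τ : Ann → ℕ → Tm S} {w : Ann → ℕ → ℕ} (h : t.occ w = 0)
    (hw : ∀ a i, w a i = 0 → σ a i = τ a i) : t.subst σ = t.subst τ := by
  induction t generalizing w σ τ with
  | var a i => exact hw _ _ h
  | num r => rfl
  | lam a t ih =>
    simp only [Tm.subst]; congr 1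
    exact ih h fun a i => by unfold upS; split_ifs; exacts [fun _ => rfl, fun h => by rw [hw _ _ h]]
  | app t u ih1 ih2 =>
    simp only [Tm.occ, Nat.add_eq_zero_iff] at h; simp only [Tm.subst]; rw [ih1 h.1 hw, ih2 h.2 hw]
  | pair t u ih1 ih2 =>
    simp only [Tm.occ, Nat.add_eq_zero_iff] at h; simp only [Tm.subst]; rw [ih1 h.1 hw, ih2 h.2 hw]
  | esub p t u ih1 ih2 =>
    simp only [Tm.occ, Nat.add_eq_zero_iff] at h; simp only [Tm.subst]; rw [ih2 h.2 hw]; congr 1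
    exact ih1 h.1 fun a i => by unfold upS; split_ifs; exacts [fun _ => rfl, fun h => by rw [hw _ _ h]]
  | add t u ih1 ih2 =>
    simp only [Tm.occ, Nat.add_eq_zero_iff] at h; simp only [Tm.subst]; rw [ih1 h.1 hw, ih2 h.2 hw]
  | fn f ts ih =>
    simp only [Tm.occ, Finset.sum_eq_zero_iff, Finset.mem_univ, true_implies] at h
    simp only [Tm.subst]; congr 1; funext i; exact ih i (h i) hw

theorem occ_subst (t : Tm S) (σ : Ann → ℕ → Tm S) (w : Ann → ℕ → ℕ) :
    (t.subst σ).occ w = t.occ (fun a i => (σ a i).occ w) := by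
  have key : ∀ (k : ℕ) (σ : Ann → ℕ → Tm S) (w : Ann → ℕ → ℕ),
      (fun a i => (upS k σ a i).occ (fun a i => if i < k then 0 else w a (i - k))) =
      fun a i => if i < k then 0 else (σ a (i - k)).occ w := by
    intro k σ w; funext a i; unfold upS
    split_ifs with h
    · simp [Tm.occ, h]
    · simp [Tm.wk, occ_rename]
  induction t generalizing σ w with
  | var a i => rfl
  | num r => rfl
  | lam a t ih => simp only [Tm.subst, Tm.occ, ih, key]
  | app t u ih1 ih2 => simp only [Tm.subst, Tm.occ, ih1, ih2]
  | pair t u ih1 ih2 => simp only [Tm.subst, Tm.occ, ih1, ih2]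
  | esub p t u ih1 ih2 => simp only [Tm.subst, Tm.occ, ih1, ih2, key]
  | add t u ih1 ih2 => simp only [Tm.subst, Tm.occ, ih1, ih2]
  | fn f ts ih => simp only [Tm.subst, Tm.occ, ih]

end LSC
end

/-! ### Counting steps modulo structural equivalence, stably under renaming. -/

noncomputable section

namespace LSC

variable {S : Sig}

/-! # Runs with a bounded number of steps -/

theorem StepsMod.trans {Q E : Tm S → Tm S → Prop} {k l : ℕ} {t u w : Tm S}
    (h : StepsMod Q E k t u) (h' : StepsMod Q E l u w) : StepsMod Q E (k + l) t w := by
  induction h' with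
  | refl => exact h
  | step _ q ih => exact .step (ih h) q
  | eqv _ q ih => exact .eqv (ih h) q

/-- A term constructor that is a one-hole context. -/
def IsCtx (c : Tm S → Tm S) : Prop :=
  ∀ (Q : Tm S → Tm S → Prop) (t u), Cl Q t u → Cl Q (c t) (c u)

theorem Equiv.ctx {c : Tm S → Tm S} (hc : IsCtx c) {t u : Tm S} (h : Equiv t u) : Equiv (c t) (c u) := by
  induction h with
  | rel _ _ q => exact .rel _ _ (hc _ _ _ q)
  | refl => exact .refl _
  | symm _ _ _ ih => exact .symm _ _ ih
  | trans _ _ _ _ _ ih ih' => exact .trans _ _ _ ih ih'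

theorem StepsMod.ctx {c : Tm S → Tm S} (hc : IsCtx c) {k : ℕ} {t u : Tm S}
    (h : StepsMod Red Equiv k t u) : StepsMod Red Equiv k (c t) (c u) := by
  induction h with
  | refl => exact .refl _
  | step _ q ih => exact .step ih (hc _ _ _ q)
  | eqv _ q ih => exact .eqv ih (q.ctx hc)

/-- Reduction modulo equivalence in at most `n` steps. -/
def Runs (n : ℕ) (t u : Tm S) : Prop := ∃ k ≤ n, StepsMod Red Equiv k t u

theorem Runs.refl (t : Tm S) : Runs 0 t t := ⟨0, le_rfl, .refl t⟩

theorem Runs.trans {n m : ℕ} {t u w : Tm S} (h : Runs n t u) (h' : Runs m u w) :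
    Runs (n + m) t w := by
  obtain ⟨k, hk, h⟩ := h
  obtain ⟨l, hl, h'⟩ := h'
  exact ⟨k + l, by omega, h.trans h'⟩

theorem Runs.mono {n m : ℕ} {t u : Tm S} (h : Runs n t u) (hm : n ≤ m) : Runs m t u := by
  obtain ⟨k, hk, h⟩ := h
  exact ⟨k, hk.trans hm, h⟩

theorem Runs.of_red {t u : Tm S} (h : Red t u) : Runs 1 t u := ⟨1, le_rfl, .step (.refl t) h⟩

theorem Runs.of_equiv {t u : Tm S} (h : Equiv t u) : Runs 0 t u := ⟨0, le_rfl, .eqv (.refl t) h⟩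

theorem Runs.ctx {c : Tm S → Tm S} (hc : IsCtx c) {n : ℕ} {t u : Tm S} (h : Runs n t u) :
    Runs n (c t) (c u) := by
  obtain ⟨k, hk, h⟩ := h
  exact ⟨k, hk, h.ctx hc⟩

/-- Reduction modulo equivalence in at most `n` steps, uniformly for all renamings. -/
def Run (n : ℕ) (t u : Tm S) : Prop := ∀ f, Runs n (t.rename f) (u.rename f)

theorem Run.refl (t : Tm S) : Run 0 t t := fun _ => .refl _

theorem Run.trans {n m : ℕ} {t u w : Tm S} (h : Run n t u) (h' : Run m u w) : Run (n + m) t w :=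
  fun f => (h f).trans (h' f)

theorem Run.mono {n m : ℕ} {t u : Tm S} (h : Run n t u) (hm : n ≤ m) : Run m t u :=
  fun f => (h f).mono hm

theorem Run.rename {n : ℕ} {t u : Tm S} (h : Run n t u) (f : ℕ → ℕ) :
    Run n (t.rename f) (u.rename f) := fun g => by
  rw [rename_rename, rename_rename]; exact h _

theorem Run.wk {n : ℕ} {t u : Tm S} (h : Run n t u) (c k : ℕ) : Run n (t.wk c k) (u.wk c k) :=
  h.rename _

theorem Run.runs {n : ℕ} {t u : Tm S} (h : Run n t u) : Runs n t u := by
  simpa only [rename_id] using h (fun i => i)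

theorem isCtx_lam (a : Ann) : IsCtx (Tm.lam a : Tm S → Tm S) := fun _ _ _ => .lam a
theorem isCtx_appL (u : Tm S) : IsCtx (fun t => .app t u) := fun _ _ _ => .appL u
theorem isCtx_appR (t : Tm S) : IsCtx (fun u => .app t u) := fun _ _ _ => .appR t
theorem isCtx_pairL (u : Tm S) : IsCtx (fun t => .pair t u) := fun _ _ _ => .pairL u
theorem isCtx_pairR (t : Tm S) : IsCtx (fun u => .pair t u) := fun _ _ _ => .pairR t
theorem isCtx_addL (u : Tm S) : IsCtx (fun t => .add t u) := fun _ _ _ => .addL u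
theorem isCtx_addR (t : Tm S) : IsCtx (fun u => .add t u) := fun _ _ _ => .addR t
theorem isCtx_esubL (p : Pat) (u : Tm S) : IsCtx (fun t => .esub p t u) := fun _ _ _ => .esubL p u
theorem isCtx_esubR (p : Pat) (t : Tm S) : IsCtx (fun u => .esub p t u) := fun _ _ _ => .esubR p t
theorem isCtx_fn (f : S.Sym) (ts : Fin (S.ar f) → Tm S) (i : Fin (S.ar f)) :
    IsCtx (fun u => .fn f (Function.update ts i u)) := fun Q t u h => by
  have := Cl.fn (Q := Q) f (Function.update ts i t) i (t' := u) (by simpa using h)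
  simpa using this

variable {n m : ℕ} {t t' u u' : Tm S}

theorem Run.lam (a : Ann) (h : Run n t u) : Run n (.lam a t) (.lam a u) :=
  fun _ => (h _).ctx (isCtx_lam a)

theorem Run.app (h : Run n t t') (h' : Run m u u') : Run (n + m) (.app t u) (.app t' u') :=
  fun f => ((h f).ctx (isCtx_appL _)).trans ((h' f).ctx (isCtx_appR _))

theorem Run.pair (h : Run n t t') (h' : Run m u u') : Run (n + m) (.pair t u) (.pair t' u') :=
  fun f => ((h f).ctx (isCtx_pairL _)).trans ((h' f).ctx (isCtx_pairR _))

theorem Run.add (h : Run n t t') (h' : Run m u u') : Run (n + m) (.add t u) (.add t' u') :=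
  fun f => ((h f).ctx (isCtx_addL _)).trans ((h' f).ctx (isCtx_addR _))

theorem Run.esub (p : Pat) (h : Run n t t') (h' : Run m u u') :
    Run (n + m) (.esub p t u) (.esub p t' u') :=
  fun f => ((h _).ctx (isCtx_esubL p _)).trans ((h' f).ctx (isCtx_esubR p _))

theorem Run.esubL (p : Pat) (u : Tm S) (h : Run n t t') : Run n (.esub p t u) (.esub p t' u) :=
  h.esub p (.refl u)

theorem Run.esubR (p : Pat) (t : Tm S) (h : Run n u u') : Run n (.esub p t u) (.esub p t u') :=
  ((Run.refl t).esub p h).mono (by omega)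

/-- The arguments are reduced one after the other, by induction on the set of those already reduced.
-/
theorem Runs.fn (f : S.Sym) {k : Fin (S.ar f) → ℕ} {ts us : Fin (S.ar f) → Tm S}
    (h : ∀ i, Runs (k i) (ts i) (us i)) : Runs (∑ i, k i) (.fn f ts) (.fn f us) := by
  classical
  suffices H : ∀ s : Finset (Fin (S.ar f)),
      Runs (∑ i ∈ s, k i) (.fn f ts) (.fn f (fun i => if i ∈ s then us i else ts i)) by
    simpa using H Finset.univ
  intro s
  induction s using Finset.induction_on with
  | empty => simpa using Runs.refl _
  | insert i s hi ih =>
    rw [Finset.sum_insert hi, add_comm]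
    refine ih.trans ?_
    have := (h i).ctx (isCtx_fn f (fun i => if i ∈ s then us i else ts i) i)
    convert this using 2
    · funext j; by_cases hj : j = i
      · subst hj; simp [hi]
      · simp [hj]
    · funext j; by_cases hj : j = i
      · subst hj; simp
      · simp [hj]

theorem Run.fn (f : S.Sym) {k : Fin (S.ar f) → ℕ} {ts us : Fin (S.ar f) → Tm S}
    (h : ∀ i, Run (k i) (ts i) (us i)) : Run (∑ i, k i) (.fn f ts) (.fn f us) :=
  fun g => Runs.fn f fun i => h i g

theorem mul_rename (t u : Tm S) (f : ℕ → ℕ) : (Tm.mul t u).rename f = Tm.mul (t.rename f) (u.rename f) := by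
  simp only [Tm.mul, Tm.rename]; congr 1; funext i; split_ifs <;> rfl

theorem mul_subst (t u : Tm S) (σ : Ann → ℕ → Tm S) :
    (Tm.mul t u).subst σ = Tm.mul (t.subst σ) (u.subst σ) := by
  simp only [Tm.mul, Tm.subst]; congr 1; funext i; split_ifs <;> rfl

theorem sum_ite_zero_fin {k : ℕ} (hk : k = 2) (a b : ℕ) :
    ∑ i : Fin k, (if i.val = 0 then a else b) = a + b := by
  subst hk; simp

theorem Run.mul (h : Run n t t') (h' : Run m u u') : Run (n + m) (Tm.mul t u) (Tm.mul t' u') := by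
  rw [← sum_ite_zero_fin S.ar_mul n m]
  exact Run.fn _ fun i => by split_ifs <;> assumption

/-! # Equivalence, uniformly for all renamings -/

/-- Structural equivalence, uniformly for all renamings. -/
def NEq (t u : Tm S) : Prop := ∀ f, Equiv (t.rename f) (u.rename f)

theorem NEq.refl (t : Tm S) : NEq t t := fun _ => .refl _
theorem NEq.symm (h : NEq t u) : NEq u t := fun f => .symm _ _ (h f)
theorem Equiv.trans {w : Tm S} (h : Equiv t u) (h' : Equiv u w) : Equiv t w :=
  Relation.EqvGen.trans _ _ _ h h'

theorem NEq.trans {w : Tm S} (h : NEq t u) (h' : NEq u w) : NEq t w := fun f => (h f).trans (h' f)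
theorem NEq.run (h : NEq t u) : Run 0 t u := fun f => .of_equiv (h f)
theorem Run.trans_neq {w : Tm S} (h : Run n t u) (h' : NEq u w) : Run n t w := h.trans h'.run
theorem NEq.trans_run {w : Tm S} (h : NEq t u) (h' : Run n u w) : Run n t w :=
  (h.run.trans h').mono (by omega)

theorem NEq.add (h : NEq t t') (h' : NEq u u') : NEq (.add t u) (.add t' u') :=
  fun f => ((h f).ctx (isCtx_addL (u.rename f))).trans ((h' f).ctx (isCtx_addR (t'.rename f)))

theorem NEq.esub (p : Pat) (h : NEq t t') (h' : NEq u u') : NEq (.esub p t u) (.esub p t' u') :=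
  fun f => ((h (up p.ar f)).ctx (isCtx_esubL p (u.rename f))).trans
    ((h' f).ctx (isCtx_esubR p (t'.rename (up p.ar f))))

theorem NEq.esubL (p : Pat) (u : Tm S) (h : NEq t t') : NEq (.esub p t u) (.esub p t' u) :=
  h.esub p (.refl u)

theorem NEq.esubR (p : Pat) (t : Tm S) (h : NEq u u') : NEq (.esub p t u) (.esub p t u') :=
  (NEq.refl t).esub p h

theorem Equiv.struct (h : StructRule t u) : Equiv t u := .rel _ _ (.root (.inl h))
theorem Equiv.sum (h : SumRule t u) : Equiv t u := .rel _ _ (.root (.inr h))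

/-- The exchange of a block of `p` variables with the block of `q` variables after it. -/
def swapIdx (p q : ℕ) (i : ℕ) : ℕ := if i < p then i + q else if i < p + q then i - p else i

theorem NEq.esub_comm (p q : Pat) (t u w : Tm S) :
    NEq (.esub q (.esub p t (u.wk 0 q.ar)) w)
      (.esub p (.esub q (t.rename (swapIdx p.ar q.ar)) (w.wk 0 p.ar)) u) := fun f => by
  have := StructRule.comm p q (t.rename (up p.ar (up q.ar f))) (u.rename f) (w.rename f)
  simp only [Tm.rename, wk_up]
  convert Equiv.struct this using 3
  rw [rename_rename, rename_rename]
  refine rename_ext _ fun i => ?_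
  simp only [swapIdx, up_up, Nat.add_comm q.ar p.ar]
  unfold up
  split_ifs <;> omega

theorem NEq.esub_esub (p q : Pat) (t u w : Tm S) :
    NEq (.esub q (.esub p (t.wk p.ar q.ar) u) w) (.esub p t (.esub q u w)) := fun f => by
  have := StructRule.esub p q (t.rename (up p.ar f)) (u.rename (up q.ar f)) (w.rename f)
  simp only [Tm.rename]
  convert Equiv.struct this using 3
  simp only [Tm.wk, rename_rename]
  refine rename_ext _ fun i => ?_
  by_cases h : i < p.ar
  · simp [up, h]
  · obtain ⟨j, rfl⟩ := Nat.exists_eq_add_of_le (Nat.le_of_not_lt h)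
    have e : p.ar + j + q.ar - p.ar = j + q.ar := by omega
    have e' : ¬ p.ar + j + q.ar < p.ar := by omega
    simp [up, e, e']; omega

theorem NEq.dup (A : Ty) (s u : Tm S) :
    NEq (.esub (.one (.exp A)) (s.rename (fun i => i - 1)) u)
      (.esub (.one (.exp A)) (.esub (.one (.exp A)) s (u.wk 0 1)) u) := fun f => by
  have := StructRule.dup A (s.rename (up 1 (up 1 f))) (u.rename f)
  simp only [Tm.rename, Pat.ar, wk_up]
  convert Equiv.struct this using 2
  simp only [rename_rename]
  refine rename_ext _ fun i => ?_
  unfold up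
  rcases i with _ | _ | i <;> simp

theorem BinOp.rename {op : Tm S → Tm S → Tm S} (h : BinOp op) (t u : Tm S) (f : ℕ → ℕ) :
    (op t u).rename f = op (t.rename f) (u.rename f) := by
  cases h
  case mul => exact mul_rename _ _ _
  all_goals rfl

theorem NEq.opL {op : Tm S → Tm S → Tm S} (h : BinOp op) (p : Pat) (s t u : Tm S) :
    NEq (.esub p (op s (t.wk 0 p.ar)) u) (op (.esub p s u) t) := fun f => by
  have := StructRule.opL op p (s.rename (up p.ar f)) (t.rename f) (u.rename f) h
  simp only [Tm.rename, h.rename, wk_up]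
  exact Equiv.struct this

theorem NEq.opR {op : Tm S → Tm S → Tm S} (h : BinOp op) (p : Pat) (s t u : Tm S) :
    NEq (.esub p (op (s.wk 0 p.ar) t) u) (op s (.esub p t u)) := fun f => by
  have := StructRule.opR op p (s.rename f) (t.rename (up p.ar f)) (u.rename f) h
  simp only [Tm.rename, h.rename, wk_up]
  exact Equiv.struct this

theorem NEq.add_assoc (t u w : Tm S) : NEq (.add (.add t u) w) (.add t (.add u w)) :=
  fun _ => .sum (.assoc _ _ _)

theorem NEq.add_comm (t u : Tm S) : NEq (.add t u) (.add u t) := fun _ => .sum (.comm _ _)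

/-! # Elementary steps -/

theorem Run.of_beta (h : ∀ f, BetaRule (t.rename f) (u.rename f)) : Run 1 t u :=
  fun f => .of_red (.root (.inl (h f)))

theorem Run.beta (a : Ann) (t u : Tm S) : Run 1 (.app (.lam a t) u) (.esub (.one a) t u) :=
  .of_beta fun f => by
    simpa [SCtx.plug, SCtx.bnd, wk_zero, Tm.rename, Pat.ar] using
      BetaRule.lam a (t.rename (up 1 f)) (u.rename f) []

theorem Run.split (A B : Ty) (s t u : Tm S) : Run 1 (.esub (.two A B) s (.pair t u))
    (.esub (.one (.exp B)) (.esub (.one (.exp A)) s (t.wk 0 1)) u) :=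
  .of_beta fun f => by
    have := BetaRule.pair A B (s.rename (up 2 f)) (t.rename f) (u.rename f) []
    simpa [SCtx.plug, SCtx.bnd, wk_zero, Tm.rename, Pat.ar, wk_up, up_up] using this

theorem Value.rename {v : Tm S} (h : Value v) (f : ℕ → ℕ) : Value (v.rename f) := by
  induction h with
  | var a i => exact .var _ _
  | num r => exact .num _
  | lam a t => exact .lam _ _
  | pair _ _ ih ih' => exact .pair ih ih'

theorem Run.gc (A : Ty) (t : Tm S) {v : Tm S} (hv : Value v) :
    Run 1 (.esub (.one (.exp A)) (t.wk 0 1) v) t :=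
  .of_beta fun f => by
    have := BetaRule.gc A (t.rename f) (v.rename f) [] (hv.rename f)
    simpa [SCtx.plug, SCtx.bnd, wk_zero, Tm.rename, Pat.ar, wk_up] using this

theorem Run.lin (t : Tm S) {v : Tm S} (hv : Value v) : Run 1 (.esub (.one .lin) t v) (t.inst v) :=
  .of_beta fun f => by
    have := BetaRule.lin (t.rename (up 1 f)) (v.rename f) [] (hv.rename f)
    simpa [SCtx.plug, SCtx.bnd, wk_zero, Tm.rename, Pat.ar, inst_rename] using this

theorem Run.linBeta (t : Tm S) {v : Tm S} (hv : Value v) : Run 2 (.app (.lam .lin t) v) (t.inst v) :=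
  (Run.beta _ _ _).trans (Run.lin _ hv)

theorem Run.add_num (r q : ℝ) : Run 1 (.add (.num r) (.num q) : Tm S) (.num (r + q)) :=
  .of_beta fun _ => BetaRule.add r q [] []

theorem plug_catAll_nil (k : ℕ) (t : Tm S) :
    SCtx.plug (SCtx.catAll (List.ofFn (fun _ : Fin k => ([] : SCtx S)))) t = t := by
  have : ∀ k, SCtx.catAll (List.ofFn (fun _ : Fin k => ([] : SCtx S))) = [] := by
    intro k
    induction k with
    | zero => rfl
    | succ k ih => rw [List.ofFn_succ]; simp only [SCtx.catAll, ih, SCtx.cat, SCtx.wk, List.append_nil]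
  rw [this]; rfl

theorem Run.fn_num (f : S.Sym) (r : Fin (S.ar f) → ℝ) :
    Run 1 (.fn f (fun i => .num (r i)) : Tm S) (.num (S.sem f r)) :=
  .of_beta fun _ => by
    have := BetaRule.fn f r (fun _ => [])
    rwa [plug_catAll_nil] at this

theorem Run.mul_num (r q : ℝ) : Run 1 (Tm.mul (.num r) (.num q) : Tm S) (.num (r * q)) := by
  have := Run.fn_num (S := S) S.mul (fun i => if i.val = 0 then r else q)
  have e : ∀ (k : ℕ) (hk : k = 2), ∏ i : Fin k, (if i.val = 0 then r else q) = r * q := by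
    rintro k rfl; simp
  rw [S.sem_mul, e _ S.ar_mul] at this
  convert this using 2
  unfold Tm.mul
  congr 1; funext i; split_ifs <;> rfl

/-- This gives separate names to the two components, so that the numeral can be copied while the
backpropagator remains shared. -/
theorem Run.etaPair (A B : Ty) (t u u' : Tm S) :
    Run 1 (.esub (.one (.exp (.prod A B))) t (.pair u u'))
      (.esub (.two A B)
        (.esub (.one (.exp (.prod A B))) (t.wk 1 2) (.pair (.var (.exp A) 0) (.var (.exp B) 1)))
        (.pair u u')) := fun f => by
  have := EtaRule.pair A B (t.rename (up 1 f)) (u.rename f) (u'.rename f)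
  refine .of_red (.root (.inr (.inl ?_)))
  simp only [Tm.rename, Pat.ar]
  convert this using 2
  simp only [Tm.wk, rename_rename]
  congr 1
  refine rename_ext _ fun i => ?_
  unfold up
  split_ifs <;> first | omega | (simp; try omega)

theorem Run.factor (d i : ℕ) (t t' : Tm S) :
    Run 1 (.add (.app (.var (.exp (.dual d)) i) t) (.app (.var (.exp (.dual d)) i) t'))
      (.app (.var (.exp (.dual d)) i) (.add t t')) := fun f => by
  have := LinRule.mk d (f i) (t.rename f) (t'.rename f) [] [] [] []
  refine .of_red (.root (.inr (.inr ?_)))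
  simpa [SCtx.plug, SCtx.bnd, SCtx.cat, SCtx.wk, wk_zero, Tm.rename] using this

end LSC
end

noncomputable section

namespace LSC

variable {S : Sig}

/-! # Replacement of all occurrences of a variable -/

theorem Replace.rename {A : Ty} {k : ℕ} {v t t' : Tm S} (h : Replace A k v t t') (f : ℕ → ℕ) :
    Replace A (f k) (v.rename f) (t.rename f) (t'.rename f) := by
  induction h generalizing f with
  | here k v => exact .here _ _
  | lam a _ ih =>
    have := ih (up 1 f)
    rw [wk_up] at this
    exact .lam a (by simpa [up] using this)
  | appL u _ ih => exact .appL _ (ih f)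
  | appR t _ ih => exact .appR _ (ih f)
  | pairL u _ ih => exact .pairL _ (ih f)
  | pairR t _ ih => exact .pairR _ (ih f)
  | esubL p u _ ih =>
    have := ih (up p.ar f)
    rw [wk_up] at this
    exact .esubL p _ (by simpa [up] using this)
  | esubR p t _ ih => exact .esubR p _ (ih f)
  | addL u _ ih => exact .addL _ (ih f)
  | addR t _ ih => exact .addR _ (ih f)
  | fn g ts i _ ih =>
    simp only [Tm.rename]
    convert Replace.fn g (fun j => (ts j).rename f) i (ih f) using 2
    funext j
    by_cases hj : j = i
    · subst hj; simp
    · simp [hj]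

/-- A chain of exactly `n` steps of a relation. -/
inductive Chain {α : Type*} (R : α → α → Prop) : ℕ → α → α → Prop
  | refl (a) : Chain R 0 a a
  | step {n a b c} : Chain R n a b → R b c → Chain R (n + 1) a c

theorem Chain.trans {α : Type*} {R : α → α → Prop} {n m : ℕ} {a b c : α} (h : Chain R n a b)
    (h' : Chain R m b c) : Chain R (n + m) a c := by
  induction h' with
  | refl => exact h
  | step _ q ih => exact .step (ih h) q

theorem Chain.map {α β : Type*} {R : α → α → Prop} {Q : β → β → Prop} {f : α → β}
    (hf : ∀ a b, R a b → Q (f a) (f b)) {n : ℕ} {a b : α} (h : Chain R n a b) :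
    Chain Q n (f a) (f b) := by
  induction h with
  | refl => exact .refl _
  | step _ q ih => exact .step ih (hf _ _ q)

theorem Chain.pi {α β : Type*} {k : ℕ} {R : α → α → Prop} {Q : β → β → Prop} {F : (Fin k → α) → β}
    (hF : ∀ ts i u, R (ts i) u → Q (F ts) (F (Function.update ts i u))) {n : Fin k → ℕ}
    {ts us : Fin k → α} (h : ∀ i, Chain R (n i) (ts i) (us i)) : Chain Q (∑ i, n i) (F ts) (F us) := by
  classical
  suffices H : ∀ s : Finset (Fin k),
      Chain Q (∑ i ∈ s, n i) (F ts) (F (fun i => if i ∈ s then us i else ts i)) by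
    simpa using H Finset.univ
  intro s
  induction s using Finset.induction_on with
  | empty => simpa using Chain.refl _
  | insert i s hi ih =>
    rw [Finset.sum_insert hi, add_comm]
    refine ih.trans ?_
    have := (h i).map (Q := Q) (f := fun u => F (Function.update (fun j => if j ∈ s then us j else ts j) i u))
      (fun a b hab => by
        have := hF (Function.update (fun j => if j ∈ s then us j else ts j) i a) i b (by simpa using hab)
        simpa using this)
    convert this using 2
    · funext j; by_cases hj : j = i
      · subst hj; simp [hi]
      · simp [hj]
    · funext j; by_cases hj : j = i
      · subst hj; simp
      · simp [hj]

/-- One of `n` consecutive variables is replaced at one place. -/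
def ReplaceAny (A : Ty) (n k : ℕ) (v : ℕ → Tm S) (t t' : Tm S) : Prop :=
  ∃ i < n, Replace A (k + i) ((v i).wk 0 k) t t'

theorem ReplaceAny.up {A : Ty} {n k m : ℕ} {v : ℕ → Tm S} {t t' : Tm S}
    (h : ReplaceAny A n (k + m) v t t') : ∃ i < n, Replace A (k + i + m) (((v i).wk 0 k).wk 0 m) t t' := by
  obtain ⟨i, hi, h⟩ := h
  refine ⟨i, hi, ?_⟩
  rw [wk_wk_zero, Nat.add_right_comm]; exact h

/-- The substitution for a block of `n` variables. -/
def blockSubst (n k : ℕ) (v : ℕ → Tm S) (a : Ann) (i : ℕ) : Tm S :=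
  if k ≤ i ∧ i < k + n then (v (i - k)).wk 0 k else .var a i

theorem upS_blockSubst (n k m : ℕ) (v : ℕ → Tm S) :
    upS m (blockSubst n k v) = blockSubst n (k + m) v := by
  funext a i
  unfold upS blockSubst
  split_ifs <;> first | rfl | omega | skip
  · rw [wk_wk_zero]; congr 2; omega
  · simp only [Tm.wk, Tm.rename]; congr 1; simp; omega

open Classical in
/-- The weight that counts the occurrences in a block that are not annotated by `A`. -/
def badWeight (A : Ty) (n k : ℕ) (a : Ann) (i : ℕ) : ℕ :=
  if (k ≤ i ∧ i < k + n) ∧ a ≠ .exp A then 1 else 0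

/-- The weight that counts the occurrences in a block. -/
def blockWeight (n k : ℕ) (_ : Ann) (i : ℕ) : ℕ := if k ≤ i ∧ i < k + n then 1 else 0

theorem badWeight_up (A : Ty) (n k m : ℕ) :
    (fun a i => if i < m then 0 else badWeight A n k a (i - m)) = badWeight A n (k + m) := by
  funext a i
  unfold badWeight
  split_ifs <;> first | rfl | omega | grind

theorem blockWeight_up (n k m : ℕ) :
    (fun a i => if i < m then 0 else blockWeight n k a (i - m)) = blockWeight n (k + m) := by
  funext a i
  unfold blockWeight
  split_ifs <;> first | rfl | omega

/-- A replacement acts only on occurrences annotated `exp A`, and raw terms may carry other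
annotations; hence the hypothesis. The recursion is on the original term, so inserted copies are not
searched again. A whole block is treated at once so that the cost counts occurrences and not
variables. -/
theorem replace_block (A : Ty) (n k : ℕ) (v : ℕ → Tm S) (t : Tm S) (h : t.occ (badWeight A n k) = 0) :
    Chain (ReplaceAny A n k v) (t.occ (blockWeight n k)) t (t.subst (blockSubst n k v)) := by
  induction t generalizing k with
  | var a i =>
    simp only [Tm.occ, badWeight, blockWeight, Tm.subst, blockSubst] at h ⊢
    by_cases hi : k ≤ i ∧ i < k + n
    · have ha : a = .exp A := by by_contra ha; simp [hi, ha] at h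
      simp only [hi, and_self, if_true]
      refine (Chain.refl _).step ⟨i - k, by omega, ?_⟩
      rw [ha, Nat.add_sub_cancel' hi.1]
      exact .here _ _
    · simp only [hi, if_false]; exact .refl _
  | num r => exact .refl _
  | lam a t ih =>
    simp only [Tm.occ, Tm.subst, badWeight_up, blockWeight_up, upS_blockSubst] at h ⊢
    exact (ih _ h).map (f := Tm.lam a) fun _ _ h => by
      obtain ⟨i, hi, h⟩ := h.up; exact ⟨i, hi, .lam a h⟩
  | app t u ih1 ih2 =>
    simp only [Tm.occ, Nat.add_eq_zero_iff] at h
    exact ((ih1 k h.1).map (f := fun t => Tm.app t u) fun _ _ ⟨i, hi, h⟩ => ⟨i, hi, .appL _ h⟩).trans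
      ((ih2 k h.2).map fun _ _ ⟨i, hi, h⟩ => ⟨i, hi, .appR _ h⟩)
  | pair t u ih1 ih2 =>
    simp only [Tm.occ, Nat.add_eq_zero_iff] at h
    exact ((ih1 k h.1).map (f := fun t => Tm.pair t u) fun _ _ ⟨i, hi, h⟩ => ⟨i, hi, .pairL _ h⟩).trans
      ((ih2 k h.2).map fun _ _ ⟨i, hi, h⟩ => ⟨i, hi, .pairR _ h⟩)
  | esub p t u ih1 ih2 =>
    simp only [Tm.occ, Nat.add_eq_zero_iff, Tm.subst, badWeight_up, blockWeight_up,
      upS_blockSubst] at h ⊢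
    exact ((ih1 _ h.1).map (f := fun t => Tm.esub p t u) fun _ _ h => by
      obtain ⟨i, hi, h⟩ := h.up; exact ⟨i, hi, .esubL p u h⟩).trans
      ((ih2 k h.2).map fun _ _ ⟨i, hi, h⟩ => ⟨i, hi, .esubR p _ h⟩)
  | add t u ih1 ih2 =>
    simp only [Tm.occ, Nat.add_eq_zero_iff] at h
    exact ((ih1 k h.1).map (f := fun t => Tm.add t u) fun _ _ ⟨i, hi, h⟩ => ⟨i, hi, .addL _ h⟩).trans
      ((ih2 k h.2).map fun _ _ ⟨i, hi, h⟩ => ⟨i, hi, .addR _ h⟩)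
  | fn f ts ih =>
    simp only [Tm.occ, Finset.sum_eq_zero_iff, Finset.mem_univ, true_implies] at h
    exact Chain.pi (F := Tm.fn f) (fun ts i u ⟨j, hj, h⟩ => ⟨j, hj, .fn f ts i h⟩) fun i => ih i k (h i)

theorem Chain.runs {R : Tm S → Tm S → Prop} {c : Tm S → Tm S} (hc : ∀ t t', R t t' → Red (c t) (c t'))
    {n : ℕ} {t u : Tm S} (h : Chain R n t u) : Runs n (c t) (c u) := by
  induction h with
  | refl => exact .refl _
  | step _ q ih => exact ih.trans (.of_red (hc _ _ q))

theorem Red.of_beta {t u : Tm S} (h : BetaRule t u) : Red t u := .root (.inl h)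

theorem Red.lookup {A : Ty} {t t' v : Tm S} (hv : Value v) (h : Replace A 0 (v.wk 0 1) t t') :
    Red (.esub (.one (.exp A)) t v) (.esub (.one (.exp A)) t' v) := by
  have := BetaRule.subst A t t' v [] hv (by simpa [SCtx.bnd, wk_zero] using h)
  exact .of_beta this

/-- One lookup for each occurrence, then one step to erase the substitution, which is no longer
used. -/
theorem Runs.inst (A : Ty) (t : Tm S) {v : Tm S} (hv : Value v) (h : t.occ (badWeight A 1 0) = 0) :
    Runs (t.occ (blockWeight 1 0) + 1) (.esub (.one (.exp A)) t v) (t.inst v) := by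
  have h1 := (replace_block A 1 0 (fun _ => v.wk 0 1) t h).runs
    (c := fun t => .esub (.one (.exp A)) t v) fun t t' ⟨i, hi, h⟩ => by
      obtain rfl : i = 0 := by omega
      rw [wk_zero] at h
      exact .lookup hv h
  refine h1.trans ?_
  convert (Run.gc A (t.inst v) hv).runs using 2
  simp only [Tm.wk, Tm.inst, subst_rename]
  congr 1
  funext a i
  rcases i with _ | i
  · simp [blockSubst, Tm.wk, rename_id]
  · simp [blockSubst, Tm.rename]

/-- Substitution of a value for all occurrences of an exponential variable. -/
theorem Run.inst (A : Ty) (t : Tm S) {v : Tm S} (hv : Value v) (h : t.occ (badWeight A 1 0) = 0) :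
    Run (t.occ (blockWeight 1 0) + 1) (.esub (.one (.exp A)) t v) (t.inst v) := fun f => by
  rw [inst_rename]
  -- A renaming extended below one binder fixes the index 0 and sends no other index to it, so both
  -- counts are unchanged.
  have e : ∀ i, ((0 ≤ up 1 f i ∧ up 1 f i < 0 + 1) ↔ (0 ≤ i ∧ i < 0 + 1)) := fun i => by
    unfold up; split_ifs <;> omega
  have e1 : (fun a i => badWeight A 1 0 a (up 1 f i)) = badWeight A 1 0 := by
    classical
    funext a i; exact if_congr (and_congr_left' (e i)) rfl rfl
  have e2 : (fun a i => blockWeight 1 0 a (up 1 f i)) = blockWeight 1 0 := by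
    funext a i; exact if_congr (e i) rfl rfl
  have := Runs.inst A (t.rename (up 1 f)) (hv.rename f) (by rwa [occ_rename, e1])
  rwa [occ_rename, e2] at this

end LSC
end

/-! ### Moving explicit substitutions by structural equivalence. -/

noncomputable section

namespace LSC

variable {S : Sig}

/-! # Iterated substitutions -/

theorem upS_upS (k m : ℕ) (σ : Ann → ℕ → Tm S) : upS k (upS m σ) = upS (k + m) σ := by
  funext a i
  unfold upS
  split_ifs <;> first | rfl | omega | skip
  · simp only [Tm.wk, Tm.rename]; congr 1; simp; omega
  · rw [wk_wk_zero, Nat.sub_sub, Nat.add_comm m k]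

theorem wk_subst_upS (t : Tm S) (k : ℕ) (σ : Ann → ℕ → Tm S) :
    (t.wk 0 k).subst (upS k σ) = (t.subst σ).wk 0 k := by
  simp only [Tm.wk, rename_subst, subst_rename]
  congr 1; funext a i; simp [upS, Tm.wk]

theorem wk_wk_same (t : Tm S) (c k m : ℕ) : (t.wk c k).wk c m = t.wk c (k + m) := by
  simp only [Tm.wk, rename_rename]
  refine rename_ext _ fun i => ?_
  split_ifs <;> omega

theorem letMany_rename (p : Pat) (us : List (Tm S)) (t : Tm S) (f : ℕ → ℕ) :
    (letMany p us t).rename f =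
      letMany p (us.map fun u => u.rename f) (t.rename (up (p.ar * us.length) f)) := by
  induction us generalizing t with
  | nil => simp [letMany, up_zero]
  | cons u us ih =>
    simp only [letMany, ih, List.map_cons, List.length_cons, List.length_map, Tm.rename, wk_up, up_up]
    rw [Nat.mul_succ, Nat.add_comm p.ar]

theorem letMany_subst (p : Pat) (us : List (Tm S)) (t : Tm S) (σ : Ann → ℕ → Tm S) :
    (letMany p us t).subst σ =
      letMany p (us.map fun u => u.subst σ) (t.subst (upS (p.ar * us.length) σ)) := by
  induction us generalizing t with
  | nil =>
    have : upS 0 σ = σ := by funext a i; simp [upS, wk_zero]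
    simp [letMany, this]
  | cons u us ih =>
    simp only [letMany, ih, List.map_cons, List.length_cons, List.length_map, Tm.subst, wk_subst_upS,
      upS_upS]
    rw [Nat.mul_succ, Nat.add_comm p.ar]

theorem occ_letMany (p : Pat) (us : List (Tm S)) (t : Tm S) (w : Ann → ℕ → ℕ) :
    (letMany p us t).occ w =
      t.occ (fun a i => if i < p.ar * us.length then 0 else w a (i - p.ar * us.length)) +
        (us.map fun u => u.occ w).sum := by
  induction us generalizing t with
  | nil => simp [letMany]
  | cons u us ih =>
    simp only [letMany, ih, List.map_cons, List.length_cons, Tm.occ, List.sum_cons]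
    rw [← Nat.add_assoc]
    congr 2
    · congr 1; funext a i
      have : p.ar * (us.length + 1) = p.ar + p.ar * us.length := by rw [Nat.mul_succ, Nat.add_comm]
      rw [this]
      split_ifs <;> first | rfl | omega | (congr 1; omega)
    · rw [Tm.wk, occ_rename]; congr 1; funext a i; simp

theorem Run.letMany (p : Pat) (us : List (Tm S)) {n : ℕ} {t t' : Tm S} (h : Run n t t') :
    Run n (letMany p us t) (letMany p us t') := by
  induction us generalizing t t' with
  | nil => exact h
  | cons u us ih => exact ih (h.esubL p _)

theorem NEq.letMany (p : Pat) (us : List (Tm S)) {t t' : Tm S} (h : NEq t t') :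
    NEq (letMany p us t) (letMany p us t') := by
  induction us generalizing t t' with
  | nil => exact h
  | cons u us ih => exact ih (h.esubL p _)

theorem Run.letMany_args (p : Pat) {k : ℕ} {n : Fin k → ℕ} {u u' : Fin k → Tm S}
    (h : ∀ i, Run (n i) (u i) (u' i)) (t : Tm S) :
    Run (∑ i, n i) (LSC.letMany p (List.ofFn u) t) (LSC.letMany p (List.ofFn u') t) := by
  induction k generalizing t with
  | zero => simpa using Run.refl _
  | succ k ih =>
    rw [Fin.sum_univ_succ, List.ofFn_succ, List.ofFn_succ]
    simp only [LSC.letMany, List.length_ofFn]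
    exact (((h 0).wk 0 _).esubR p t |>.letMany p _).trans (ih (fun i => h i.succ) _)

/-- The body `t` uses none of the variables of `ws`, so each of these substitutions can move into
the argument. -/
theorem NEq.letMany_esub (p q : Pat) (ws : List (Tm S)) (t u : Tm S) :
    NEq (LSC.letMany q ws (.esub p (t.wk p.ar (q.ar * ws.length)) u))
      (.esub p t (LSC.letMany q ws u)) := by
  induction ws generalizing u with
  | nil => simpa [LSC.letMany, wk_zero] using NEq.refl _
  | cons w ws ih =>
    simp only [LSC.letMany, List.length_cons]
    rw [Nat.mul_succ, ← wk_wk_same]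
    exact ((NEq.esub_esub p q _ u _).letMany q ws).trans (ih _)

theorem NEq.letMany_opL {op : Tm S → Tm S → Tm S} (h : BinOp op) (q : Pat) (ws : List (Tm S)) (s t : Tm S) :
    NEq (LSC.letMany q ws (op s (t.wk 0 (q.ar * ws.length)))) (op (LSC.letMany q ws s) t) := by
  induction ws generalizing s with
  | nil => simpa [LSC.letMany, wk_zero] using NEq.refl _
  | cons w ws ih =>
    simp only [LSC.letMany, List.length_cons]
    rw [Nat.mul_succ, ← wk_wk_same]
    exact ((NEq.opL h q s _ _).letMany q ws).trans (ih _)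

theorem NEq.letMany_opR {op : Tm S → Tm S → Tm S} (h : BinOp op) (q : Pat) (ws : List (Tm S)) (s t : Tm S) :
    NEq (LSC.letMany q ws (op (s.wk 0 (q.ar * ws.length)) t)) (op s (LSC.letMany q ws t)) := by
  induction ws generalizing t with
  | nil => simpa [LSC.letMany, wk_zero] using NEq.refl _
  | cons w ws ih =>
    simp only [LSC.letMany, List.length_cons]
    rw [Nat.mul_succ, ← wk_wk_same]
    exact ((NEq.opR h q _ t _).letMany q ws).trans (ih _)

/-! # Substitution contexts -/

open SCtx

theorem Run.plug (α : SCtx S) {n : ℕ} {t t' : Tm S} (h : Run n t t') : Run n (plug α t) (plug α t') := by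
  induction α generalizing t t' with
  | nil => exact h
  | cons x α ih => exact ih (h.esubL _ _)

theorem NEq.plug (α : SCtx S) {t t' : Tm S} (h : NEq t t') : NEq (plug α t) (plug α t') := by
  induction α generalizing t t' with
  | nil => exact h
  | cons x α ih => exact ih (h.esubL _ _)

theorem plug_append (α β : SCtx S) (t : Tm S) : plug (α ++ β) t = plug β (plug α t) := by
  induction α generalizing t with
  | nil => rfl
  | cons x α ih => exact ih _

theorem bnd_append (α β : SCtx S) : bnd (α ++ β) = bnd α + bnd β := by
  induction α with
  | nil => simp [bnd]
  | cons x α ih => simp only [List.cons_append, bnd, ih, Nat.add_assoc]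

theorem bnd_wk (k : ℕ) (α : SCtx S) : bnd (SCtx.wk k α) = bnd α := by
  induction α with
  | nil => rfl
  | cons x α ih => simp only [SCtx.wk, bnd, ih]

theorem ctxWk_wk (k m : ℕ) (α : SCtx S) : SCtx.wk m (SCtx.wk k α) = SCtx.wk (k + m) α := by
  induction α with
  | nil => rfl
  | cons x α ih => simp only [SCtx.wk, ih, bnd_wk, wk_wk_same]

theorem ctxWk_zero (α : SCtx S) : SCtx.wk 0 α = α := by
  induction α with
  | nil => rfl
  | cons x α ih => simp only [SCtx.wk, ih, wk_zero]

theorem up_shift (p c k : ℕ) : up p (fun i => if i < c then i else i + k) =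
    fun i => if i < p + c then i else i + k := by
  funext i; simp only [up]; split_ifs <;> omega

theorem plug_wk (α : SCtx S) (t : Tm S) (k : ℕ) :
    (plug α t).wk 0 k = plug (SCtx.wk k α) (t.wk (bnd α) k) := by
  induction α generalizing t with
  | nil => rfl
  | cons x α ih =>
    simp only [SCtx.plug, SCtx.wk, bnd, ih]
    simp only [Tm.wk, Tm.rename, up_shift]

/-- Together with `NEq.opL_plug`, this lets a β-rule whose redex carries a stack be used with an
empty stack: the stack is first moved outside at no cost. -/
theorem NEq.esub_plug (p : Pat) (t : Tm S) (α : SCtx S) (u : Tm S) :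
    NEq (.esub p t (SCtx.plug α u)) (SCtx.plug α (.esub p (t.wk p.ar (bnd α)) u)) := by
  induction α generalizing u with
  | nil => simpa [SCtx.plug, bnd, wk_zero] using NEq.refl _
  | cons x α ih =>
    refine (ih _).trans ?_
    simp only [SCtx.plug, bnd]
    rw [Nat.add_comm, ← wk_wk_same]
    exact ((NEq.esub_esub _ _ _ _ _).symm).plug α

theorem NEq.opL_plug {op : Tm S → Tm S → Tm S} (h : BinOp op) (α : SCtx S) (s t : Tm S) :
    NEq (op (SCtx.plug α s) t) (SCtx.plug α (op s (t.wk 0 (bnd α)))) := by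
  induction α generalizing s with
  | nil => simpa [SCtx.plug, bnd, wk_zero] using NEq.refl _
  | cons x α ih =>
    refine (ih _).trans ?_
    simp only [SCtx.plug, bnd]
    rw [Nat.add_comm, ← wk_wk_same]
    exact ((NEq.opL h _ _ _ _).symm).plug α

theorem NEq.esub_plug_body (p : Pat) (α : SCtx S) (t u : Tm S) :
    NEq (.esub p (SCtx.plug (SCtx.wk p.ar α) t) u)
      (SCtx.plug α (.esub p (t.rename (swapIdx (bnd α) p.ar)) (u.wk 0 (bnd α)))) := by
  induction α generalizing t with
  | nil =>
    have : swapIdx 0 p.ar = fun i => i := by funext i; simp [swapIdx]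
    simpa [SCtx.plug, SCtx.wk, bnd, wk_zero, this, rename_id] using NEq.refl _
  | cons x α ih =>
    obtain ⟨q, w⟩ := x
    simp only [SCtx.plug, SCtx.wk, bnd]
    refine (ih _).trans ?_
    have e1 : (w.wk (bnd α) p.ar).rename (swapIdx (bnd α) p.ar) = w.wk 0 p.ar := by
      simp only [Tm.wk, rename_rename]
      refine rename_ext _ fun i => ?_
      unfold swapIdx; split_ifs <;> omega
    simp only [Tm.rename, e1]
    have h2 := NEq.esub_comm q p (t.rename (up q.ar (swapIdx (bnd α) p.ar))) w (u.wk 0 (bnd α))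
    refine (h2.plug α).trans ?_
    rw [rename_rename, wk_wk_zero, Nat.add_comm (bnd α)]
    have e2 : ∀ i, swapIdx q.ar p.ar (up q.ar (swapIdx (bnd α) p.ar) i) = swapIdx (q.ar + bnd α) p.ar i := by
      intro i; simp only [swapIdx, up]; split_ifs <;> omega
    rw [rename_ext t e2]
    exact .refl _

/-- Terms without free variables, as far as renamings are concerned. -/
def Closed (t : Tm S) : Prop := ∀ f, t.rename f = t

/-- Commuting two blocks of substitutions requires that neither uses the variables of the other. The
weakening of `α` gives one half, closedness of `ws` the other. -/
theorem NEq.letMany_plug (p : Pat) (ws : List (Tm S)) (hw : ∀ w ∈ ws, Closed w) (α : SCtx S) (t : Tm S) :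
    NEq (LSC.letMany p ws (SCtx.plug (SCtx.wk (p.ar * ws.length) α) t))
      (SCtx.plug α (LSC.letMany p ws (t.rename (swapIdx (bnd α) (p.ar * ws.length))))) := by
  induction ws generalizing t with
  | nil =>
    have : swapIdx (bnd α) 0 = fun i => i := by funext i; simp [swapIdx]; omega
    simpa [LSC.letMany, this, rename_id, ctxWk_zero] using NEq.refl _
  | cons w ws ih =>
    have hc : Closed w := hw w (by simp)
    simp only [LSC.letMany, List.length_cons, Tm.wk, hc _]
    rw [Nat.mul_succ, ← ctxWk_wk]
    refine ((NEq.esub_plug_body p _ t w).letMany p ws).trans ?_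
    refine (ih (fun w h => hw w (by simp [h])) _).trans ?_
    simp only [Tm.wk, Tm.rename, hc _, rename_rename, bnd_wk]
    rw [rename_ext t (g := swapIdx (bnd α) (p.ar * ws.length + p.ar)) fun i => ?_]
    · exact .refl _
    · simp only [swapIdx, up]; split_ifs <;> omega

/-- Substitution contexts around the arguments of an iterated substitution can be pulled out. -/
theorem NEq.letMany_plug_args (p : Pat) (l : List (SCtx S × Tm S)) (hl : ∀ x ∈ l, Closed x.2) (t : Tm S) :
    NEq (LSC.letMany p (l.map fun x => SCtx.plug x.1 x.2) t)
      (SCtx.plug (catAll (l.map Prod.fst)) (LSC.letMany p (l.map Prod.snd)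
        (t.rename (up (p.ar * l.length) (fun i => i + bnd (catAll (l.map Prod.fst))))))) := by
  induction l generalizing t with
  | nil => simpa [LSC.letMany, catAll, SCtx.plug, up_zero, bnd, rename_id] using NEq.refl _
  | cons x l ih =>
    obtain ⟨α, w⟩ := x
    have hc : Closed w := hl (α, w) (by simp)
    have hl' : ∀ x ∈ l, Closed x.2 := fun x h => hl x (by simp [h])
    simp only [List.map_cons, LSC.letMany, List.length_map, List.length_cons, catAll]
    refine (ih hl' _).trans ?_
    set A := catAll (l.map Prod.fst)
    simp only [Tm.rename, wk_up]
    have e : ((SCtx.plug α w).rename (fun i => i + bnd A)) = SCtx.plug (SCtx.wk (bnd A) α) w := by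
      have := plug_wk α w (bnd A)
      simpa [Tm.wk, hc _] using this
    rw [e, plug_wk]
    have hcw : w.wk (bnd (SCtx.wk (bnd A) α)) (p.ar * l.length) = w := hc _
    rw [hcw, cat, plug_append]
    refine NEq.plug A ?_
    refine ((NEq.esub_plug p _ _ w).letMany p _).trans ?_
    have h := NEq.letMany_plug p (l.map Prod.snd) (by simpa using fun w x h => hl' (x, w) h)
      (SCtx.wk (bnd A) α)
      (.esub p ((t.rename (up p.ar (up (p.ar * l.length) (fun i => i + bnd A)))).wk p.ar (bnd α)) w)
    simp only [List.length_map, bnd_wk] at h ⊢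
    refine h.trans (NEq.plug _ ?_)
    simp only [Tm.rename, hc _, Tm.wk, rename_rename, bnd_append, bnd_wk]
    rw [rename_ext t fun i => ?_]
    · exact .refl _
    -- What remains is to compare two renamings index by index: the variables of the patterns are
    -- fixed, all others skip the variables of both stacks.
    · rw [Nat.mul_succ]
      simp only [swapIdx, up]; split_ifs <;> omega

end LSC
end

/-! ### Typing for the eta-rule, sums modulo the monoid laws, shared calls. -/

noncomputable section

namespace LSC

variable {S : Sig}

/-! # Typing -/

theorem zero_rename (d : ℕ) (f : ℕ → ℕ) : (Tm.zero d : Tm S).rename f = .zero d := by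
  induction d with
  | zero => rfl
  | succ d ih => simp only [Tm.zero, Tm.rename, ih]

theorem zero_subst (d : ℕ) (σ : Ann → ℕ → Tm S) : (Tm.zero d : Tm S).subst σ = .zero d := by
  induction d with
  | zero => rfl
  | succ d ih => simp only [Tm.zero, Tm.subst, ih]

theorem zero_occ (d : ℕ) (w : Ann → ℕ → ℕ) : (Tm.zero d : Tm S).occ w = 0 := by
  induction d with
  | zero => rfl
  | succ d ih => simp only [Tm.zero, Tm.occ, ih]

theorem lookup_up1 {Γ Δ : List Ann} {f : ℕ → ℕ} (b : Ann)
    (h : ∀ i a, Γ[i]? = some a → Δ[f i]? = some a) (i : ℕ) (a : Ann)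
    (hi : (b :: Γ)[i]? = some a) : (b :: Δ)[up 1 f i]? = some a := by
  rcases i with _ | i
  · simpa [up] using hi
  · simpa [up] using h i a (by simpa using hi)

theorem HasTy.rename {Γ : List Ann} {z : Option ℕ} {t : Tm S} {A : Ty} (h : HasTy Γ z t A)
    {Δ : List Ann} {f : ℕ → ℕ} (hf : ∀ i a, Γ[i]? = some a → Δ[f i]? = some a) :
    HasTy Δ (z.map f) (t.rename f) A := by
  induction h generalizing Δ f with
  | lvar h => exact .lvar (hf _ _ h)
  | var h => exact .var (hf _ _ h)
  | pair hz _ _ ih ih' => exact .pair (by simpa using hz) (ih hf) (ih' hf)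
  | @esub2 Γ z t u A B C _ _ ih ih' =>
    refine .esub2 (ih hf) ?_
    have := ih' (lookup_up1 (.exp A) (lookup_up1 (.exp B) hf))
    rw [up_up] at this
    simpa [Option.map_map, Function.comp_def, up, Pat.ar] using this
  | lam _ ih => exact .lam (ih (lookup_up1 _ hf))
  | app _ _ ih ih' => exact .app (ih hf) (ih' hf)
  | llam _ ih => exact .llam (by simpa [up] using ih (lookup_up1 _ hf))
  | lapp _ _ ih ih' => exact .lapp (ih hf) (ih' hf)
  | @esub Γ z t u A C _ _ ih ih' =>
    refine .esub (ih hf) ?_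
    simpa [Option.map_map, Function.comp_def, up, Pat.ar] using ih' (lookup_up1 (.exp A) hf)
  | lesub _ _ ih ih' => exact .lesub (ih hf) (by simpa [up, Pat.ar] using ih' (lookup_up1 _ hf))
  | fn _ ih => exact .fn fun i => ih i hf
  | num => exact .num
  | mulL _ _ ih ih' => rw [mul_rename]; exact .mulL (ih hf) (ih' hf)
  | mulR _ _ ih ih' => rw [mul_rename]; exact .mulR (ih hf) (ih' hf)
  | zero h => rw [zero_rename]; exact .zero (hf _ _ h)
  | add _ _ ih ih' => exact .add (ih hf) (ih' hf)

theorem mul_occ (t u : Tm S) (w : Ann → ℕ → ℕ) : (Tm.mul t u).occ w = t.occ w + u.occ w := by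
  simp only [Tm.mul, Tm.occ, apply_ite (fun t : Tm S => t.occ w)]
  exact sum_ite_zero_fin S.ar_mul _ _

/-- The weight that counts the occurrences of index at least `k`. -/
def geWeight (k : ℕ) (_ : Ann) (i : ℕ) : ℕ := if i < k then 0 else 1

theorem geWeight_up (k m : ℕ) :
    (fun a i => if i < m then 0 else geWeight k a (i - m)) = geWeight (k + m) := by
  funext a i; simp only [geWeight]; split_ifs <;> first | rfl | omega

theorem HasTy.occ_eq_zero {Γ : List Ann} {z : Option ℕ} {t : Tm S} {A : Ty} (h : HasTy Γ z t A) :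
    t.occ (geWeight Γ.length) = 0 := by
  induction h with
  | lvar h => simp [Tm.occ, geWeight, (List.getElem?_eq_some_iff.1 h).1]
  | var h => simp [Tm.occ, geWeight, (List.getElem?_eq_some_iff.1 h).1]
  | pair _ _ _ ih ih' => simp [Tm.occ, ih, ih']
  | esub2 _ _ ih ih' => simp only [Tm.occ, ih, geWeight_up, Nat.add_zero]; exact ih'
  | lam _ ih => simp only [Tm.occ, geWeight_up]; exact ih
  | app _ _ ih ih' => simp [Tm.occ, ih, ih']
  | llam _ ih => simp only [Tm.occ, geWeight_up]; exact ih
  | lapp _ _ ih ih' => simp [Tm.occ, ih, ih']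
  | esub _ _ ih ih' => simp only [Tm.occ, ih, geWeight_up, Nat.add_zero]; exact ih'
  | lesub _ _ ih ih' => simp only [Tm.occ, ih, geWeight_up, Nat.add_zero]; exact ih'
  | fn _ ih => simp [Tm.occ, ih]
  | num => rfl
  | mulL _ _ ih ih' => simp [mul_occ, ih, ih']
  | mulR _ _ ih ih' => simp [mul_occ, ih, ih']
  | zero h => exact zero_occ _ _
  | add _ _ ih ih' => simp [Tm.occ, ih, ih']

theorem HasTy.append {Γ : List Ann} {z : Option ℕ} {t : Tm S} {A : Ty} (h : HasTy Γ z t A)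
    (Δ : List Ann) : HasTy (Γ ++ Δ) z t A := by
  have := h.rename (Δ := Γ ++ Δ) (f := fun i => i) fun i a hi => by
    rw [List.getElem?_append_left (List.getElem?_eq_some_iff.1 hi).1, hi]
  simpa [rename_id] using this

theorem HasTy.subst_eq {t : Tm S} {A : Ty} (h : HasTy [] none t A) (σ : Ann → ℕ → Tm S) :
    t.subst σ = t := by
  conv_rhs => rw [← subst_var t]
  exact subst_congr h.occ_eq_zero fun a i => by simp [geWeight]

theorem HasTy.closed {t : Tm S} {A : Ty} (h : HasTy [] none t A) : Closed t := fun f => by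
  rw [rename_eq_subst, h.subst_eq]

theorem HasTy.occ_closed {t : Tm S} {A : Ty} (h : HasTy [] none t A) (w : Ann → ℕ → ℕ) :
    t.occ w = 0 := occ_eq_zero_mono h.occ_eq_zero fun a i => by simp [geWeight]

/-- A context of exponential variables whose type is a linear negation. -/
abbrev dualCtx (d N : ℕ) : List Ann := List.replicate N (.exp (.dual d))

/-- Typability in a context of variables whose type is a linear negation. -/
def DTy (d : ℕ) (t : Tm S) (A : Ty) : Prop := ∃ N, HasTy (dualCtx d N) none t A

theorem HasTy.mono {d N M : ℕ} {z : Option ℕ} {t : Tm S} {A : Ty} (h : HasTy (dualCtx d N) z t A) (hN : N ≤ M) :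
    HasTy (dualCtx d M) z t A := by
  obtain ⟨k, rfl⟩ := Nat.exists_eq_add_of_le hN
  have := h.append (dualCtx d k)
  rwa [List.replicate_append_replicate] at this

theorem DTy.rename {d : ℕ} {t : Tm S} {A : Ty} (h : DTy d t A) (f : ℕ → ℕ) : DTy d (t.rename f) A := by
  obtain ⟨N, h⟩ := h
  refine ⟨(Finset.range N).sup f + 1, h.rename fun i a hi => ?_⟩
  have := (List.getElem?_eq_some_iff.1 hi).1
  rw [List.length_replicate] at this
  simp only [List.getElem?_replicate, this, if_true] at hi ⊢
  rw [if_pos, hi]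
  exact Nat.lt_succ_of_le (Finset.le_sup (f := f) (Finset.mem_range.2 this))

theorem DTy.app_num {d : ℕ} {t : Tm S} (h : DTy d t (.dual d)) (c : ℝ) : DTy d (.app t (.num c)) (.pow d) := by
  obtain ⟨N, h⟩ := h
  exact ⟨N, .lapp h .num⟩

theorem DTy.var (d i : ℕ) : DTy d (.var (.exp (.dual d)) i : Tm S) (.dual d) :=
  ⟨i + 1, .var (by simp)⟩

theorem DTy.esub {d : ℕ} {t u : Tm S} {A : Ty} (h : DTy d t A) (h' : DTy d u (.dual d)) :
    DTy d (.esub (.one (.exp (.dual d))) t u) A := by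
  obtain ⟨N, h⟩ := h
  obtain ⟨M, h'⟩ := h'
  refine ⟨max N M, .esub (h'.mono (le_max_right _ _)) ?_⟩
  simpa [dualCtx, List.replicate_succ] using h.mono (M := max N M + 1) (by omega)

theorem DTy.etaExpand {d : ℕ} {t : Tm S} (h : DTy d t (.dual d)) :
    DTy d (.lam .lin (.app (t.wk 0 1) (.var .lin 0))) (.dual d) := by
  obtain ⟨N, h⟩ := h
  refine ⟨N, .llam (.lapp ?_ (.lvar rfl))⟩
  exact h.rename fun i a hi => by simpa using hi

/-- The eta-rule requires a typing in some context. `DTy` leaves the context existential and is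
stable under renaming, so the step is available after every renaming. -/
theorem Run.etaDual {d : ℕ} {t : Tm S} (h : DTy d t (.dual d)) :
    Run 1 t (.lam .lin (.app (t.wk 0 1) (.var .lin 0))) := fun f => by
  obtain ⟨N, hN⟩ := h.rename f
  refine .of_red (.root (.inr (.inl ?_)))
  simp only [Tm.rename, wk_up]
  exact .dual _ _ _ hN

/-- Application of an eta-expansion. -/
theorem Run.etaApp (t : Tm S) {v : Tm S} (hv : Value v) :
    Run 2 (.app (.lam .lin (.app (t.wk 0 1) (.var .lin 0))) v) (.app t v) := by
  have := Run.linBeta (.app (t.wk 0 1) (.var .lin 0)) hv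
  have e : (Tm.app (t.wk 0 1) (.var .lin 0)).inst v = .app t v := by
    show Tm.app ((t.wk 0 1).inst v) v = _
    rw [wk_inst]
  rwa [e] at this

theorem HasTy.letMany {Γ : List Ann} {A C : Ty} {us : List (Tm S)} {t : Tm S}
    (hu : ∀ u ∈ us, HasTy Γ none u A) (ht : HasTy (List.replicate us.length (.exp A) ++ Γ) none t C) :
    HasTy Γ none (LSC.letMany (.one (.exp A)) us t) C := by
  induction us generalizing t with
  | nil => exact ht
  | cons u us ih =>
    refine ih (fun u h => hu u (by simp [h])) (.esub ?_ ?_)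
    · refine (hu u (by simp)).rename fun i a hi => ?_
      rw [List.getElem?_append_right (by simp [Pat.ar])]
      simpa [Pat.ar] using hi
    · simpa [List.replicate_succ] using ht

/-! # Sums -/

theorem NEq.add_zero {d : ℕ} {t : Tm S} (h : DTy d t (.pow d)) : NEq (.add t (.zero d)) t := fun f => by
  obtain ⟨N, hN⟩ := h.rename f
  simp only [Tm.rename, zero_rename]
  exact .sum (.zero _ _ _ _ hN)

theorem NEq.zero_add_zero (d : ℕ) : NEq (.add (.zero d) (.zero d)) (.zero d : Tm S) := fun f => by
  simp only [Tm.rename, zero_rename]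
  exact .sum (.zero [.lin] (some 0) _ _ (.zero rfl))

theorem sum_rename (d : ℕ) (l : List (Tm S)) (f : ℕ → ℕ) :
    (Tm.sum d l).rename f = Tm.sum d (l.map fun t => t.rename f) := by
  match l with
  | [] => exact zero_rename _ _
  | [t] => rfl
  | t :: u :: l => simpa only [Tm.sum, Tm.rename, List.map_cons] using congrArg _ (sum_rename d (u :: l) f)

theorem sum_subst (d : ℕ) (l : List (Tm S)) (σ : Ann → ℕ → Tm S) :
    (Tm.sum d l).subst σ = Tm.sum d (l.map fun t => t.subst σ) := by
  match l with
  | [] => exact zero_subst _ _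
  | [t] => rfl
  | t :: u :: l => simpa only [Tm.sum, Tm.subst, List.map_cons] using congrArg _ (sum_subst d (u :: l) σ)

theorem sum_occ (d : ℕ) (l : List (Tm S)) (w : Ann → ℕ → ℕ) :
    (Tm.sum d l).occ w = (l.map fun t => t.occ w).sum := by
  match l with
  | [] => exact zero_occ _ _
  | [t] => simp [Tm.sum]
  | t :: u :: l => simpa only [Tm.sum, Tm.occ, List.map_cons, List.sum_cons] using congrArg _ (sum_occ d (u :: l) w)

theorem HasTy.sum {Γ : List Ann} {i d : ℕ} (hi : Γ[i]? = some .lin) {l : List (Tm S)}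
    (h : ∀ t ∈ l, HasTy Γ (some i) t (.pow d)) : HasTy Γ (some i) (Tm.sum d l) (.pow d) := by
  match l with
  | [] => exact .zero hi
  | [t] => exact h t (by simp)
  | t :: u :: l => exact .add (h t (by simp)) (HasTy.sum hi fun t ht => h t (by simp at ht ⊢; tauto))

theorem Run.sum_map (d : ℕ) {ι : Type*} (l : List ι) {n : ι → ℕ} {f g : ι → Tm S}
    (h : ∀ i ∈ l, Run (n i) (f i) (g i)) :
    Run ((l.map n).sum) (Tm.sum d (l.map f)) (Tm.sum d (l.map g)) := by
  match l with
  | [] => exact .refl _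
  | [t] => simpa [Tm.sum] using h t (by simp)
  | t :: u :: l =>
    simpa only [Tm.sum, List.map_cons, List.sum_cons] using
      (h t (by simp)).add (Run.sum_map d (u :: l) fun i hi => h i (by simp at hi ⊢; tauto))

/-- A sum of one term does not end in zero, so that case needs the neutrality of zero; since that
law is typed, a typing is assumed. -/
theorem NEq.sum_cons {d : ℕ} {t : Tm S} (h : DTy d t (.pow d)) (l : List (Tm S)) :
    NEq (Tm.sum d (t :: l)) (.add t (Tm.sum d l)) := by
  match l with
  | [] => exact (NEq.add_zero h).symm
  | u :: l => exact .refl _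

theorem NEq.add_left_comm (t u w : Tm S) : NEq (.add t (.add u w)) (.add u (.add t w)) :=
  (NEq.add_assoc _ _ _).symm.trans (((NEq.add_comm t u).add (.refl w)).trans (NEq.add_assoc _ _ _))

theorem NEq.zero_add_sum {d : ℕ} {l : List (Tm S)} (h : ∀ t ∈ l, DTy d t (.pow d)) :
    NEq (.add (.zero d) (Tm.sum d l)) (Tm.sum d l) := by
  match l with
  | [] => exact .zero_add_zero d
  | t :: l =>
    have ht := h t (by simp)
    have hl := NEq.zero_add_sum (l := l) fun u hu => h u (by simp [hu])
    exact ((NEq.refl _).add (NEq.sum_cons ht l)).trans ((NEq.add_left_comm _ _ _).trans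
      (((NEq.refl _).add hl).trans (NEq.sum_cons ht l).symm))

theorem NEq.sum_append {d : ℕ} {l l' : List (Tm S)} (h : ∀ t ∈ l, DTy d t (.pow d))
    (h' : ∀ t ∈ l', DTy d t (.pow d)) :
    NEq (.add (Tm.sum d l) (Tm.sum d l')) (Tm.sum d (l ++ l')) := by
  induction l with
  | nil => exact NEq.zero_add_sum h'
  | cons t l ih =>
    have ht := h t (by simp)
    exact ((NEq.sum_cons ht l).add (.refl _)).trans ((NEq.add_assoc _ _ _).trans
      (((NEq.refl _).add (ih fun u hu => h u (by simp [hu]))).trans (NEq.sum_cons ht _).symm))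

theorem NEq.sum_perm {d : ℕ} {l l' : List (Tm S)} (hp : l.Perm l') (h : ∀ t ∈ l, DTy d t (.pow d)) :
    NEq (Tm.sum d l) (Tm.sum d l') := by
  induction hp with
  | nil => exact .refl _
  | @cons t l₁ l₂ _ ih =>
    have ht := h t (by simp)
    exact (NEq.sum_cons ht _).trans (((NEq.refl _).add (ih fun u hu => h u (by simp [hu]))).trans
      (NEq.sum_cons ht _).symm)
  | swap t u l =>
    have ht := h t (by simp)
    have hu := h u (by simp)
    have e : ∀ {t u : Tm S}, DTy d t (.pow d) → DTy d u (.pow d) →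
        NEq (Tm.sum d (t :: u :: l)) (.add t (.add u (Tm.sum d l))) := fun ht hu =>
      (NEq.sum_cons ht _).trans ((NEq.refl _).add (NEq.sum_cons hu l))
    exact (e hu ht).trans ((NEq.add_left_comm _ _ _).trans (e ht hu).symm)
  | trans h1 _ ih ih' => exact (ih h).trans (ih' fun u hu => h u (h1.mem_iff.2 hu))

/-! # Tokens -/

/-- The term `x c[x := L]`. -/
def tok (d : ℕ) (L : Tm S) (c : ℝ) : Tm S :=
  .esub (.one (.exp (.dual d))) (.app (.var (.exp (.dual d)) 0) (.num c)) L

theorem tok_rename (d : ℕ) (L : Tm S) (c : ℝ) (f : ℕ → ℕ) :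
    (tok d L c).rename f = tok d (L.rename f) c := by
  simp [tok, Tm.rename, up, Pat.ar]

theorem DTy.tok {d : ℕ} {L : Tm S} (h : DTy d L (.dual d)) (c : ℝ) : DTy d (tok d L c) (.pow d) :=
  ((DTy.var d 0).app_num c).esub h

theorem Run.tok {d : ℕ} {L : Tm S} (hL : Value L) (c : ℝ) : Run 2 (LSC.tok d L c) (.app L (.num c)) := by
  have := Run.inst (.dual d) (.app (.var (.exp (.dual d)) 0) (.num c)) hL (by simp [Tm.occ, badWeight])
  simpa [Tm.occ, blockWeight, Tm.inst, Tm.subst, LSC.tok] using this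

/-- Linear factoring applies to variables only, which is why a closed backpropagator is called
through a name. The two substitutions are moved outside the sum and identified by the duplication
law; then the calls are factored and the numerals added, in one step each. -/
theorem Run.tok_add {d : ℕ} {L : Tm S} (hL : Closed L) (c c' : ℝ) :
    Run 2 (.add (LSC.tok d L c) (LSC.tok d L c')) (LSC.tok d L (c + c')) := by
  let x : ℕ → ℝ → Tm S := fun i c => .app (.var (.exp (.dual d)) i) (.num c)
  let p : Pat := .one (.exp (.dual d))
  have h1 : NEq (.add (.esub p (x 0 c) L) (.esub p (x 0 c') L))
      (.esub p (.add (x 0 c) ((Tm.esub p (x 0 c') L).wk 0 1)) L) := (NEq.opL .add p _ _ L).symm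
  have e : (Tm.esub p (x 0 c') L).wk 0 1 = .esub p (x 0 c') L := by
    simp only [Tm.wk, Tm.rename, hL _]; simp [x, Tm.rename, up, p, Pat.ar]
  rw [e] at h1
  have h2 : NEq (.esub p (.add (x 0 c) (.esub p (x 0 c') L)) L)
      (.esub p (.esub p (.add ((x 0 c).wk 0 1) (x 0 c')) L) L) :=
    (NEq.opR .add p (x 0 c) _ L).symm.esubL p L
  have h3 := NEq.dup (.dual d) (.add ((x 0 c).wk 0 1) (x 0 c')) L
  have e3 : (Tm.add ((x 0 c).wk 0 1) (x 0 c')).rename (fun i => i - 1) = .add (x 0 c) (x 0 c') := by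
    simp [x, Tm.wk, Tm.rename]
  have eL : L.wk 0 1 = L := hL _
  rw [e3, eL] at h3
  refine ((h1.trans h2).trans h3.symm).trans_run ?_
  exact Run.esubL p L ((Run.factor d 0 (.num c) (.num c')).trans
    (((Run.refl _).app (Run.add_num c c')).mono (m := 1) (by omega)))

end LSC
end

/-! ### The cost of one transformed operation. -/

noncomputable section

namespace LSC

variable {S : Sig}

/-! # Substitution of pairs of a numeral and a backpropagator -/

/-- The pattern of a variable whose type is a linear negation. -/
abbrev dualPat (d : ℕ) : Pat := .one (.exp (.dual d))

/-- The pattern of a real variable together with its backpropagator. -/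
abbrev revPat (d : ℕ) : Pat := .two .R (.dual d)

/-- The substitution that replaces the first variable of each of `k` pairs of variables by a
numeral. -/
def evenSubst (k : ℕ) (r : Fin k → ℝ) (a : Ann) (i : ℕ) : Tm S :=
  if h : i / 2 < k then (if i % 2 = 0 then .num (r ⟨i / 2, h⟩) else .var a (i / 2)) else .var a (i - k)

/-- The weight that counts the occurrences of the first variables of `k` pairs. -/
def evenWeight (k : ℕ) (_ : Ann) (i : ℕ) : ℕ := if i / 2 < k ∧ i % 2 = 0 then 1 else 0

open Classical in
/-- The weight that counts the occurrences of the first variables of `k` pairs that are not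
annotated by the type of reals. -/
def evenBad (k : ℕ) (a : Ann) (i : ℕ) : ℕ := if (i / 2 < k ∧ i % 2 = 0) ∧ a ≠ .exp .R then 1 else 0

theorem evenSubst_succ (k : ℕ) (r : Fin (k + 1) → ℝ) (t : Tm S) :
    (t.inst (.num (r 0))).subst (upS 1 (evenSubst k fun i => r i.succ)) = t.subst (evenSubst (k + 1) r) := by
  simp only [Tm.inst, subst_subst]
  congr 1
  funext a i
  match i with
  | 0 => simp [evenSubst, Tm.subst]
  | 1 => simp [evenSubst, Tm.subst, upS]
  | i + 2 =>
    have e : (i + 2) / 2 = i / 2 + 1 := by omega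
    have e2 : (i + 2) % 2 = i % 2 := by omega
    by_cases h : i / 2 < k
    · by_cases h2 : i % 2 = 0 <;> simp [Tm.subst, upS, evenSubst, e, e2, h, h2, Tm.wk, Tm.rename]
    · have : i + 1 + 1 - (k + 1) = i - k + 1 := by omega
      simp [Tm.subst, upS, evenSubst, e, h, Tm.wk, Tm.rename]
      omega

/-- Each pair is split, its numeral is copied to all its occurrences, and its backpropagator stays
in an explicit substitution, so it is never duplicated. The cost is two steps per pair, for
splitting and erasing, plus one per copied numeral. -/
theorem Run.letMany_pairs (d : ℕ) {k : ℕ} (r : Fin k → ℝ) {W : Fin k → Tm S} (hW : ∀ i, Value (W i)) (t : Tm S)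
    (ht : t.occ (evenBad k) = 0) :
    Run (2 * k + t.occ (evenWeight k))
      (LSC.letMany (revPat d) (List.ofFn fun i => .pair (.num (r i)) (W i)) t)
      (LSC.letMany (dualPat d) (List.ofFn W) (t.subst (evenSubst k r))) := by
  induction k generalizing t with
  | zero =>
    have : t.subst (evenSubst 0 r) = t := by
      conv_rhs => rw [← subst_var t]
      congr 1
    simp only [List.ofFn_zero, LSC.letMany, this]
    exact (Run.refl _).mono (by omega)
  | succ k ih =>
    simp only [List.ofFn_succ, LSC.letMany, List.length_ofFn]
    let t' : Tm S := .esub (dualPat d) (t.inst (.num (r 0))) ((W 0).wk 0 ((revPat d).ar * k))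
    have h0 : t.occ (badWeight .R 1 0) = 0 := occ_eq_zero_mono ht fun a i h => by
      simp only [evenBad, badWeight] at h ⊢
      by_cases hi : i = 0
      · subst hi; simpa using h
      · rw [if_neg]; omega
    have h1 : Run (1 + (t.occ (blockWeight 1 0) + 1))
        (.esub (revPat d) t ((Tm.pair (.num (r 0)) (W 0)).wk 0 ((revPat d).ar * k))) t' :=
      (Run.split .R (.dual d) t (.num (r 0)) _).trans ((Run.inst .R t (.num (r 0)) h0).esubL _ _)
    -- The argument `W 0` is weakened past the remaining `2 * k` variables, so a weight supported on
    -- these does not see it.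
    have hw : ∀ w : Ann → ℕ → ℕ, (∀ a i, 2 * k ≤ i → w a i = 0) →
        t'.occ w = t.occ (fun a i => if i < 2 then 0 else w a (i - 2)) := by
      intro w hw
      simp only [t', Tm.occ, Tm.inst, occ_subst, Tm.wk, occ_rename, Pat.ar]
      have : (fun a i => w a (if i < 0 then i else i + 2 * k)) = fun _ _ => 0 := by
        funext a i; exact hw _ _ (by simp)
      rw [this, occ_zero, Nat.add_zero]
      congr 1; funext a i
      match i with
      | 0 => simp [Tm.occ]
      | 1 => simp [Tm.occ]
      | i + 2 => simp [Tm.occ]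
    have h2 := ih (fun i => r i.succ) (fun i => hW i.succ) t' (by
      rw [hw _ fun a i hi => by simp only [evenBad]; rw [if_neg]; omega]
      refine occ_eq_zero_mono ht fun a i h => ?_
      simp only [evenBad] at h ⊢
      split_ifs with h3 h4
      · rfl
      · rw [if_pos ⟨⟨by omega, by omega⟩, h4.2⟩] at h
        exact absurd h one_ne_zero
      · rfl)
    have e : t.occ (evenWeight (k + 1)) = t.occ (blockWeight 1 0) + t'.occ (evenWeight k) := by
      rw [hw _ fun a i hi => by simp only [evenWeight]; rw [if_neg]; omega, ← occ_add]
      congr 1; funext a i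
      simp only [evenWeight, blockWeight]
      split_ifs <;> omega
    have e3 : t'.subst (evenSubst k fun i => r i.succ) =
        .esub (dualPat d) (t.subst (evenSubst (k + 1) r)) ((W 0).wk 0 ((dualPat d).ar * k)) := by
      simp only [t', Tm.subst, Pat.ar, evenSubst_succ, one_mul]
      congr 1
      rw [Tm.wk, rename_subst, Tm.wk, rename_eq_subst]
      congr 1; funext a i
      have h1 : ¬ (i + 2 * k) / 2 < k := by omega
      simp [evenSubst, h1]; omega
    rw [e3] at h2
    exact ((h1.letMany _ _).trans h2).mono (by omega)

/-! # Nodes -/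

/-- A term that multiplies the linear variable of index `0` by a scalar. -/
def IsArg (c : ℝ) (t : Tm S) : Prop := t = .var .lin 0 ∧ c = 1 ∨ t = Tm.mul (.num c) (.var .lin 0)

theorem IsArg.hasTy {c : ℝ} {t : Tm S} (h : IsArg c t) (Γ : List Ann) : HasTy (.lin :: Γ) (some 0) t .R := by
  rcases h with ⟨rfl, _⟩ | rfl
  · exact .lvar rfl
  · exact .mulR .num (.lvar rfl)

theorem IsArg.run {c : ℝ} {t : Tm S} (h : IsArg c t) (x : ℝ) : Run 1 (t.inst (.num x)) (.num (x * c)) := by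
  rcases h with ⟨rfl, rfl⟩ | rfl
  · rw [mul_one]; exact (Run.refl _).mono (by omega)
  · simp only [Tm.inst, mul_subst, Tm.subst]
    rw [mul_comm x c]; exact Run.mul_num c x

/-- The backpropagator with the arguments `W`, each multiplied by a scalar. -/
def nodeCore (d : ℕ) {k : ℕ} (W arg : Fin k → Tm S) : Tm S :=
  LSC.letMany (dualPat d) (List.ofFn W) (.lam .lin (Tm.sum d (List.ofFn fun i =>
    .app (.var (.exp (.dual d)) (i.val + 1)) (arg i))))

/-- The eta-expansion of `nodeCore`. -/
def node (d : ℕ) {k : ℕ} (W arg : Fin k → Tm S) : Tm S :=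
  .lam .lin (.app ((nodeCore d W arg).wk 0 1) (.var .lin 0))

theorem ofFn_fold {α β : Type*} {k : ℕ} (f : Fin k → α) (g : α → β) :
    (List.ofFn f).map g = List.ofFn (fun i => g (f i)) := by
  rw [List.map_ofFn]; rfl

theorem nodeCore_hasTy {d k N : ℕ} {W arg : Fin k → Tm S} {c : Fin k → ℝ} (ha : ∀ i, IsArg (c i) (arg i))
    (hW : ∀ i, HasTy (dualCtx d N) none (W i) (.dual d)) :
    HasTy (dualCtx d N) none (nodeCore d W arg) (.dual d) := by
  refine HasTy.letMany (by simpa [List.mem_ofFn] using hW) (.llam (HasTy.sum rfl ?_))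
  simp only [List.mem_ofFn, List.length_ofFn]
  rintro _ ⟨i, rfl⟩
  refine .lapp (.var ?_) ((ha i).hasTy _)
  rw [List.getElem?_cons_succ, List.getElem?_append_left (by simp)]
  simp

theorem HasTy.etaExpand {d N : ℕ} {t : Tm S} (h : HasTy (dualCtx d N) none t (.dual d)) :
    HasTy (dualCtx d N) none (.lam .lin (.app (t.wk 0 1) (.var .lin 0))) (.dual d) := by
  refine .llam (.lapp ?_ (.lvar rfl))
  exact h.rename fun i a hi => by simpa using hi

theorem node_hasTy {d k N : ℕ} {W arg : Fin k → Tm S} {c : Fin k → ℝ} (ha : ∀ i, IsArg (c i) (arg i))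
    (hW : ∀ i, HasTy (dualCtx d N) none (W i) (.dual d)) :
    HasTy (dualCtx d N) none (node d W arg) (.dual d) :=
  (nodeCore_hasTy ha hW).etaExpand

theorem DTy.uniform {d k : ℕ} {W : Fin k → Tm S} {A : Ty} (h : ∀ i, DTy d (W i) A) :
    ∃ N, ∀ i, HasTy (dualCtx d N) none (W i) A := by
  choose N hN using h
  exact ⟨Finset.univ.sup N, fun i => (hN i).mono (Finset.le_sup (f := N) (Finset.mem_univ i))⟩

theorem node_dTy {d k : ℕ} {W arg : Fin k → Tm S} {c : Fin k → ℝ} (ha : ∀ i, IsArg (c i) (arg i))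
    (hW : ∀ i, DTy d (W i) (.dual d)) : DTy d (node d W arg) (.dual d) := by
  obtain ⟨N, hN⟩ := DTy.uniform hW
  exact ⟨N, node_hasTy ha hN⟩

/-- The body of the transformation of an operation with `k` arguments. -/
def opBody (d : ℕ) {k : ℕ} (s : Tm S) (g : Fin k → Tm S) : Tm S :=
  .pair s (.lam .lin (Tm.sum d (List.ofFn fun i => .app (.var (.exp (.dual d)) (2 * i.val + 2)) (g i))))

/-- Once the numerals are in place, the remaining substitutions concern the backpropagator alone and
are moved into the second component. The final eta step encloses them in an abstraction, so that the
result is a value without a stack. -/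
theorem Run.node {d k : ℕ} (s : Tm S) (g : Fin k → Tm S) (r : Fin k → ℝ) {W : Fin k → Tm S}
    (hW : ∀ i, Value (W i)) (hT : ∀ i, DTy d (W i) (.dual d)) {x : ℝ} {arg : Fin k → Tm S} {c : Fin k → ℝ}
    (ha : ∀ i, IsArg (c i) (arg i)) {n : ℕ} {m : Fin k → ℕ} (hs : Run n (s.subst (evenSubst k r)) (.num x))
    (hg : ∀ i, Run (m i) ((g i).subst (upS 1 (evenSubst k r))) (arg i))
    (hb : (opBody d s g).occ (evenBad k) = 0) :
    Run (2 * k + (opBody d s g).occ (evenWeight k) + (n + ∑ i, m i) + 1)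
      (LSC.letMany (revPat d) (List.ofFn fun i => .pair (.num (r i)) (W i)) (opBody d s g))
      (.pair (.num x) (LSC.node d W arg)) := by
  have hD : DTy d (nodeCore d W arg) (.dual d) := by
    obtain ⟨N, hN⟩ := DTy.uniform hT
    exact ⟨N, nodeCore_hasTy ha hN⟩
  refine ((Run.letMany_pairs d r hW _ hb).trans ?_).trans
    (((Run.refl (.num x)).pair (Run.etaDual (t := nodeCore d W arg) hD)).mono (m := 1) (by omega))
  refine Run.trans_neq (u := LSC.letMany (dualPat d) (List.ofFn W) (.pair (.num x) (.lam .lin (Tm.sum d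
    (List.ofFn fun i => .app (.var (.exp (.dual d)) (i.val + 1)) (arg i)))))) ?_
    (NEq.letMany_opR .pair _ _ (.num x) _)
  refine Run.letMany _ _ ?_
  simp only [opBody, Tm.subst, sum_subst, ofFn_fold]
  refine hs.pair (Run.lam _ ?_)
  have h := Run.sum_map d (List.finRange k) (n := fun i => 0 + m i)
    (f := fun i => Tm.app (.var (.exp (.dual d)) (i.val + 1)) ((g i).subst (upS 1 (evenSubst k r))))
    (g := fun i => Tm.app (.var (.exp (.dual d)) (i.val + 1)) (arg i))
    fun i _ => (Run.refl _).app (hg i)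
  simp only [← List.ofFn_eq_map, List.sum_ofFn, zero_add] at h
  convert h using 5 with i
  have h1 : (2 * i.val + 1) / 2 = i.val := by omega
  simp [upS, evenSubst, h1, Tm.wk, Tm.rename]

/-- Each substituted variable is used by exactly one summand, so its substitution can be moved
there. -/
theorem NEq.letMany_sum {d k : ℕ} {W : Fin k → Tm S} (hW : ∀ i, DTy d (W i) (.dual d)) (c : Fin k → ℝ) :
    NEq (LSC.letMany (dualPat d) (List.ofFn W) (Tm.sum d (List.ofFn fun i =>
        .app (.var (.exp (.dual d)) i.val) (.num (c i)))))
      (Tm.sum d (List.ofFn fun i => LSC.tok d (W i) (c i))) := by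
  induction k with
  | zero => simpa [LSC.letMany] using NEq.refl _
  | succ k ih =>
    simp only [List.ofFn_succ, LSC.letMany, List.length_ofFn]
    have h1 := NEq.sum_cons ((DTy.var d 0).app_num (c 0)) (List.ofFn fun i : Fin k =>
        (.app (.var (.exp (.dual d)) i.succ.val) (.num (c i.succ)) : Tm S))
    have e : Tm.sum d (List.ofFn fun i : Fin k =>
        (.app (.var (.exp (.dual d)) i.succ.val) (.num (c i.succ)) : Tm S)) =
      (Tm.sum d (List.ofFn fun i : Fin k =>
        (.app (.var (.exp (.dual d)) i.val) (.num (c i.succ)) : Tm S))).wk 0 1 := by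
      simp [Tm.wk, sum_rename, Tm.rename, Function.comp_def]
    rw [e] at h1
    have e2 : Tm.esub (dualPat d) (.app (.var (.exp (.dual d)) 0) (.num (c 0)))
        ((W 0).wk 0 ((dualPat d).ar * k)) = (LSC.tok d (W 0) (c 0)).wk 0 ((dualPat d).ar * k) := by
      rw [Tm.wk, Tm.wk, tok_rename]; rfl
    have h2 := (h1.esubL (dualPat d) ((W 0).wk 0 ((dualPat d).ar * k))).trans
      (NEq.opL .add (dualPat d) (.app (.var (.exp (.dual d)) 0) (.num (c 0))) _ _)
    rw [e2] at h2
    refine (h2.letMany _ _).trans ?_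
    have h3 := NEq.letMany_opR .add (dualPat d) (List.ofFn fun i => W i.succ) (LSC.tok d (W 0) (c 0))
      (Tm.sum d (List.ofFn fun i : Fin k =>
        (.app (.var (.exp (.dual d)) i.val) (.num (c i.succ)) : Tm S)))
    rw [List.length_ofFn] at h3
    exact (h3.trans ((NEq.refl _).add (ih (fun i => hW i.succ) fun i => c i.succ))).trans
      (NEq.sum_cons ((hW 0).tok _) _).symm

/-- Two steps undo the eta-expansion, two apply the linear abstraction inside, and each of the `k`
arguments takes at most one multiplication. -/
theorem Run.node_app {d k : ℕ} {W arg : Fin k → Tm S} {c : Fin k → ℝ} (ha : ∀ i, IsArg (c i) (arg i))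
    (hT : ∀ i, DTy d (W i) (.dual d)) (x : ℝ) :
    Run (4 + k) (.app (LSC.node d W arg) (.num x))
      (Tm.sum d (List.ofFn fun i => LSC.tok d (W i) (x * c i))) := by
  have h1 := Run.etaApp (nodeCore d W arg) (.num x)
  have h2 : NEq _ (.app (nodeCore d W arg) (.num x)) := NEq.letMany_opL .app (dualPat d) (List.ofFn W)
    (.lam .lin (Tm.sum d (List.ofFn fun i => .app (.var (.exp (.dual d)) (i.val + 1)) (arg i)))) (.num x)
  have h3 := Run.linBeta (Tm.sum d (List.ofFn fun i => .app (.var (.exp (.dual d)) (i.val + 1)) (arg i)))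
    (.num x)
  have h4 := Run.sum_map d (List.finRange k) (n := fun _ => 0 + 1)
    (f := fun i => Tm.app (.var (.exp (.dual d)) i.val) ((arg i).inst (.num x)))
    (g := fun i => Tm.app (.var (.exp (.dual d)) i.val) (.num (x * c i)))
    fun i _ => (Run.refl _).app ((ha i).run x)
  simp only [← List.ofFn_eq_map, List.sum_ofFn, zero_add, Finset.sum_const, Finset.card_univ, Fintype.card_fin,
    smul_eq_mul, mul_one] at h4
  have e : (Tm.sum d (List.ofFn fun i => .app (.var (.exp (.dual d)) (i.val + 1)) (arg i))).inst (.num x) =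
      Tm.sum d (List.ofFn fun i => .app (.var (.exp (.dual d)) i.val) ((arg i).inst (.num x))) := by
    simp [Tm.inst, sum_subst, Tm.subst, Function.comp_def]
  rw [e] at h3
  refine ((h1.trans_neq h2.symm).trans
    (((h3.trans h4).letMany _ _).trans_neq (NEq.letMany_sum hT _))).mono (by omega)

end LSC
end

/-! ### A denotational invariant of evaluation. -/

noncomputable section

namespace LSC

variable {S : Sig}

/-! # Evaluation in environments of typed values -/

/-- An element of the denotation of some type. -/
abbrev DVal := Σ A : Ty, A.den

/-- Extension of an environment by the value of a new variable of index `0`. -/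
def econs (a : DVal) (e : ℕ → DVal) : ℕ → DVal
  | 0 => a
  | i + 1 => e i

/-- `PBind p a e e'`: binding the pattern `p` to the value `a` extends `e` to `e'`. -/
def PBind : Pat → DVal → (ℕ → DVal) → (ℕ → DVal) → Prop
  | .one (.exp A), a, e, e' => a.1 = A ∧ e' = econs a e
  | .one .lin, _, _, _ => False
  | .two A B, a, e, e' => ∃ (x : A.den) (y : B.den), a = ⟨.prod A B, (x, y)⟩ ∧
      e' = econs ⟨A, x⟩ (econs ⟨B, y⟩ e)

/-- `Ev t e v`: the source term `t` has the value `v` in the environment `e`. -/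
def Ev : Tm S → (ℕ → DVal) → DVal → Prop
  | .var (.exp A) i, e, v => e i = v ∧ v.1 = A
  | .var .lin _, _, _ => False
  | .num r, _, v => v = ⟨.R, r⟩
  | .lam (.exp A) t, e, v => ∃ (B : Ty) (f : A.den → B.den), v = ⟨.arr A B, f⟩ ∧
      ∀ a, Ev t (econs ⟨A, a⟩ e) ⟨B, f a⟩
  | .lam .lin _, _, _ => False
  | .app t u, e, v => ∃ (A B : Ty) (f : A.den → B.den) (a : A.den), Ev t e ⟨.arr A B, f⟩ ∧
      Ev u e ⟨A, a⟩ ∧ v = ⟨B, f a⟩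
  | .pair t u, e, v => ∃ a b : DVal, Ev t e a ∧ Ev u e b ∧ v = ⟨.prod a.1 b.1, (a.2, b.2)⟩
  | .esub p t u, e, v => ∃ (a : DVal) (e' : ℕ → DVal), Ev u e a ∧ PBind p a e e' ∧ Ev t e' v
  | .add t u, e, v => ∃ x y : ℝ, Ev t e ⟨.R, x⟩ ∧ Ev u e ⟨.R, y⟩ ∧ v = ⟨.R, (x + y : ℝ)⟩
  | .fn f ts, e, v => f ∈ S.F ∧ ∃ xs : Fin (S.ar f) → ℝ, (∀ i, Ev (ts i) e ⟨.R, xs i⟩) ∧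
      v = ⟨.R, S.sem f xs⟩

theorem econs_up (a : DVal) (e : ℕ → DVal) (f : ℕ → ℕ) :
    (fun i => econs a e (up 1 f i)) = econs a (fun i => e (f i)) := by
  funext i; rcases i with _ | i <;> simp [up, econs]

theorem econs_econs_up (a b : DVal) (e : ℕ → DVal) (f : ℕ → ℕ) :
    (fun i => econs a (econs b e) (up 2 f i)) = econs a (econs b (fun i => e (f i))) := by
  funext i
  match i with
  | 0 => rfl
  | 1 => rfl
  | i + 2 => simp [up, econs]

theorem PBind.shift {p : Pat} {a : DVal} {e e' : ℕ → DVal} (h : PBind p a e e') (i : ℕ) :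
    e' (i + p.ar) = e i := by
  match p, h with
  | .one (.exp A), ⟨_, h⟩ => subst h; rfl
  | .two A B, ⟨x, y, _, h⟩ => subst h; rfl

theorem PBind.up {p : Pat} {a : DVal} {e e' : ℕ → DVal} {f : ℕ → ℕ} (h : PBind p a e e') :
    PBind p a (fun i => e (f i)) (fun i => e' (up p.ar f i)) := by
  match p, h with
  | .one (.exp A), ⟨h1, h⟩ => subst h; exact ⟨h1, econs_up _ _ _⟩
  | .two A B, ⟨x, y, h1, h⟩ =>
    subst h
    refine ⟨x, y, h1, ?_⟩
    exact econs_econs_up _ _ _ _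

theorem PBind.up_iff {p : Pat} {a : DVal} {e e'' : ℕ → DVal} {f : ℕ → ℕ}
    (h : PBind p a (fun i => e (f i)) e'') : ∃ e', PBind p a e e' ∧ e'' = fun i => e' (LSC.up p.ar f i) := by
  match p, h with
  | .one (.exp A), ⟨h1, h⟩ =>
    exact ⟨econs a e, ⟨h1, rfl⟩, by rw [h]; exact (econs_up _ _ _).symm⟩
  | .two A B, ⟨x, y, h1, h⟩ =>
    refine ⟨econs ⟨A, x⟩ (econs ⟨B, y⟩ e), ⟨x, y, h1, rfl⟩, ?_⟩
    rw [h]; exact (econs_econs_up _ _ _ _).symm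

theorem ev_rename (t : Tm S) (f : ℕ → ℕ) (e : ℕ → DVal) (v : DVal) :
    Ev (t.rename f) e v ↔ Ev t (fun i => e (f i)) v := by
  induction t generalizing f e v with
  | var a i => cases a <;> rfl
  | num r => rfl
  | lam a t ih => cases a <;> simp only [Tm.rename, Ev, ih, econs_up]
  | app t u ih1 ih2 => simp only [Tm.rename, Ev, ih1, ih2]
  | pair t u ih1 ih2 => simp only [Tm.rename, Ev, ih1, ih2]
  | esub p t u ih1 ih2 =>
    simp only [Tm.rename, Ev, ih1, ih2]
    constructor
    · rintro ⟨a, e', h1, h2, h3⟩; exact ⟨a, _, h1, h2.up, h3⟩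
    · rintro ⟨a, e'', h1, h2, h3⟩
      obtain ⟨e', h4, rfl⟩ := h2.up_iff
      exact ⟨a, e', h1, h4, h3⟩
  | add t u ih1 ih2 => simp only [Tm.rename, Ev, ih1, ih2]
  | fn g ts ih => simp only [Tm.rename, Ev, ih]

theorem ev_wk_zero (t : Tm S) (k : ℕ) (e e' : ℕ → DVal) (v : DVal) (h : ∀ i, e' (i + k) = e i) :
    Ev (t.wk 0 k) e' v ↔ Ev t e v := by
  rw [Tm.wk, ev_rename]; simp [h]

/-- The environment at the hole depends on the stack alone, so any other term with a value there may
be put in the hole. -/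
theorem Ev.plug {α : SCtx S} {t : Tm S} {e : ℕ → DVal} {v : DVal} (h : Ev (SCtx.plug α t) e v) :
    ∃ e', (∀ i, e' (i + SCtx.bnd α) = e i) ∧ Ev t e' v ∧
      ∀ t' v', Ev t' e' v' → Ev (SCtx.plug α t') e v' := by
  induction α generalizing t v with
  | nil => exact ⟨e, fun i => rfl, h, fun _ _ h => h⟩
  | cons x α ih =>
    obtain ⟨p, u⟩ := x
    obtain ⟨e₁, h1, ⟨a, e₂, h2, h3, h4⟩, h5⟩ := ih (t := .esub p t u) h
    refine ⟨e₂, fun i => ?_, h4, fun t' v' ht => h5 (.esub p t' u) v' ⟨a, e₂, h2, h3, ht⟩⟩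
    rw [← h1 i, ← h3.shift, SCtx.bnd]; congr 1; omega

theorem Ev.replace {A : Ty} {k : ℕ} {u t t' : Tm S} (h : Replace A k u t t') {e : ℕ → DVal} {v : DVal}
    (hv : Ev t e v) (hu : Ev u e (e k)) : Ev t' e v := by
  induction h generalizing e v with
  | here k u => obtain ⟨rfl, _⟩ := hv; exact hu
  | lam a _ ih =>
    cases a with
    | lin => exact hv.elim
    | exp A =>
      obtain ⟨B, f, h1, h2⟩ := hv
      exact ⟨B, f, h1, fun a => ih (h2 a) ((ev_wk_zero _ 1 e _ _ fun _ => rfl).2 hu)⟩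
  | appL u _ ih => obtain ⟨A, B, f, a, h1, h2, h3⟩ := hv; exact ⟨A, B, f, a, ih h1 hu, h2, h3⟩
  | appR u _ ih => obtain ⟨A, B, f, a, h1, h2, h3⟩ := hv; exact ⟨A, B, f, a, h1, ih h2 hu, h3⟩
  | pairL u _ ih => obtain ⟨a, b, h1, h2, h3⟩ := hv; exact ⟨a, b, ih h1 hu, h2, h3⟩
  | pairR u _ ih => obtain ⟨a, b, h1, h2, h3⟩ := hv; exact ⟨a, b, h1, ih h2 hu, h3⟩
  | esubL p u _ ih =>
    obtain ⟨a, e', h1, h2, h3⟩ := hv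
    refine ⟨a, e', h1, h2, ih h3 ?_⟩
    rw [h2.shift]
    exact (ev_wk_zero _ _ e e' _ h2.shift).2 hu
  | esubR p u _ ih => obtain ⟨a, e', h1, h2, h3⟩ := hv; exact ⟨a, e', ih h1 hu, h2, h3⟩
  | addL u _ ih => obtain ⟨a, b, h1, h2, h3⟩ := hv; exact ⟨a, b, ih h1 hu, h2, h3⟩
  | addR u _ ih => obtain ⟨a, b, h1, h2, h3⟩ := hv; exact ⟨a, b, h1, ih h2 hu, h3⟩
  | fn f ts i _ ih =>
    obtain ⟨hf, xs, h1, h2⟩ := hv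
    refine ⟨hf, xs, fun j => ?_, h2⟩
    by_cases hj : j = i
    · subst hj; simpa using ih (h1 j) hu
    · simpa [hj] using h1 j

/-- All stacks have values in the same ambient environment. They are entered from the last to the
first, the earlier ones being weakened; nothing of the resulting environment matters, as `t` has its
value in all environments. -/
theorem Ev.plug_catAll {k : ℕ} {α : Fin k → SCtx S} {x : Fin k → ℝ} {y : Fin k → ℝ} {e : ℕ → DVal}
    (h : ∀ i, Ev (SCtx.plug (α i) (.num (x i))) e ⟨.R, y i⟩) {t : Tm S} {v : DVal} (ht : ∀ e, Ev t e v) :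
    (∀ i, y i = x i) ∧ Ev (SCtx.plug (SCtx.catAll (List.ofFn α)) t) e v := by
  refine ⟨fun i => ?_, ?_⟩
  · obtain ⟨e', _, h2, _⟩ := (h i).plug
    have h2 : (⟨.R, y i⟩ : DVal) = ⟨.R, x i⟩ := h2
    exact eq_of_heq (Sigma.mk.inj h2).2
  suffices H : ∀ (k : ℕ) (α : Fin k → SCtx S) (x y : Fin k → ℝ) (e : ℕ → DVal),
      (∀ i, Ev (SCtx.plug (α i) (.num (x i))) e ⟨.R, y i⟩) →
      ∃ e', (∀ i, e' (i + SCtx.bnd (SCtx.catAll (List.ofFn α))) = e i) ∧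
        ∀ t' v', Ev t' e' v' → Ev (SCtx.plug (SCtx.catAll (List.ofFn α)) t') e v' by
    obtain ⟨e', _, h'⟩ := H k α x y e h
    exact h' _ _ (ht _)
  intro k
  induction k with
  | zero => exact fun α x y e _ => ⟨e, fun i => rfl, fun _ _ h => h⟩
  | succ k ih =>
    intro α x y e h
    obtain ⟨e₁, h1, h2⟩ := ih (fun i => α i.succ) _ _ e fun i => h i.succ
    rw [List.ofFn_succ, SCtx.catAll, SCtx.cat]
    set A := SCtx.catAll (List.ofFn fun i : Fin k => α i.succ)
    have h0 : Ev ((SCtx.plug (α 0) (.num (x 0))).wk 0 (SCtx.bnd A)) e₁ ⟨.R, y 0⟩ :=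
      (ev_wk_zero _ _ e e₁ _ h1).2 (h 0)
    rw [plug_wk] at h0
    obtain ⟨e₂, h3, _, h4⟩ := h0.plug
    refine ⟨e₂, fun i => ?_, fun t' v' ht => ?_⟩
    · rw [← h1, ← h3, bnd_append]; congr 1; omega
    · rw [plug_append]; exact h2 _ _ (h4 _ _ ht)

theorem ev_wk_one (t : Tm S) (k : ℕ) (a : DVal) (e e' : ℕ → DVal) (v : DVal) (h : ∀ i, e' (i + k) = e i) :
    Ev (t.wk 1 k) (econs a e') v ↔ Ev t (econs a e) v := by
  rw [Tm.wk, ev_rename]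
  have : (fun i => econs a e' (if i < 1 then i else i + k)) = econs a e := by
    funext i
    rcases i with _ | i
    · rfl
    · rw [if_neg (by omega), Nat.add_right_comm]; exact h i
  rw [this]

/-- This takes the place of subject reduction. The linear rule and the sum of pairs are vacuous: no
linear binding has a value, and a sum has one only if both summands denote reals. -/
theorem Ev.betaRule {t t' : Tm S} (h : BetaRule t t') {e : ℕ → DVal} {v : DVal} (hv : Ev t e v) :
    Ev t' e v := by
  cases h with
  | lam a t u α =>
    obtain ⟨A, B, f, x, h1, h2, rfl⟩ := hv
    obtain ⟨e', h3, h4, h5⟩ := h1.plug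
    cases a with
    | lin => exact h4.elim
    | exp A' =>
      obtain ⟨B', f', h6, h7⟩ := h4
      cases h6
      exact h5 _ _ ⟨⟨A, x⟩, _, (ev_wk_zero _ _ e e' _ h3).2 h2, ⟨rfl, rfl⟩, h7 x⟩
  | pair A B s t u α =>
    obtain ⟨a, e₁, h1, ⟨x, y, rfl, rfl⟩, h3⟩ := hv
    obtain ⟨e', h4, ⟨b, c, h5, h6, h7⟩, h8⟩ := h1.plug
    obtain ⟨B₁, b⟩ := b
    obtain ⟨C₁, c⟩ := c
    cases h7
    refine h8 _ _ ⟨⟨C₁, c⟩, _, h6, ⟨rfl, rfl⟩, ⟨⟨B₁, b⟩, _, ?_, ⟨rfl, rfl⟩, ?_⟩⟩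
    · exact (ev_wk_zero _ 1 e' _ _ fun _ => rfl).2 h5
    · rw [Tm.wk, ev_rename]
      convert h3 using 1
      funext i
      match i with
      | 0 => rfl
      | 1 => rfl
      | i + 2 => rw [if_neg (by omega), Nat.add_right_comm]; exact h4 i
  | subst A t t' u α _ hr =>
    obtain ⟨a, e₁, h1, ⟨h2, rfl⟩, h3⟩ := hv
    obtain ⟨e', h4, h5, h6⟩ := h1.plug
    refine h6 _ _ ⟨a, _, h5, ⟨h2, rfl⟩, ?_⟩
    exact ((ev_wk_one t _ a e e' _ h4).2 h3).replace hr ((ev_wk_zero _ 1 e' _ _ fun _ => rfl).2 h5)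
  | gc A t u α _ =>
    obtain ⟨a, e₁, h1, ⟨h2, rfl⟩, h3⟩ := hv
    obtain ⟨e', h4, _, h6⟩ := h1.plug
    exact h6 _ _ ((ev_wk_zero _ _ e e' _ h4).2 ((ev_wk_zero _ 1 e _ _ fun _ => rfl).1 h3))
  | lin t u α _ => obtain ⟨a, e₁, _, h2, _⟩ := hv; exact h2.elim
  | add r q α β =>
    obtain ⟨x, y, h1, h2, rfl⟩ := hv
    -- A sum is treated as an operation with two arguments.
    have h := Ev.plug_catAll (k := 2) (α := ![α, β]) (x := ![r, q]) (y := ![x, y]) (e := e)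
      (fun i => by fin_cases i; exacts [h1, h2]) (t := .num (r + q)) (v := ⟨.R, (r + q : ℝ)⟩) fun _ => rfl
    have hx : x = r := h.1 0
    have hy : y = q := h.1 1
    subst hx hy
    simpa [SCtx.catAll, SCtx.cat, SCtx.wk, ctxWk_zero, SCtx.bnd] using h.2
  | addPair t₁ t₂ u₁ u₂ α β =>
    obtain ⟨x, y, h1, _, _⟩ := hv
    obtain ⟨e', _, ⟨a, b, _, _, h2⟩, _⟩ := h1.plug
    cases h2
  | fn f r α =>
    obtain ⟨hf, xs, h1, rfl⟩ := hv
    have h := Ev.plug_catAll h1 (t := .num (S.sem f r)) (v := ⟨.R, S.sem f r⟩) fun _ => rfl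
    rw [funext h.1]
    exact h.2

/-- Evaluation may take place under an abstraction; an arbitrary argument is then needed in order to
have a value for the body. -/
instance denInhabited : (A : Ty) → Inhabited A.den
  | .R => ⟨(0 : ℝ)⟩
  | .prod A B => ⟨((denInhabited A).default, (denInhabited B).default)⟩
  | .arr _ B => ⟨fun _ => (denInhabited B).default⟩
  | .dual d => ⟨(0 : ℝ →ₗ[ℝ] (Fin (d + 1) → ℝ))⟩

theorem Ev.beta {t t' : Tm S} (h : Beta t t') {e : ℕ → DVal} {v : DVal} (hv : Ev t e v) : Ev t' e v := by
  unfold Beta at h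
  induction h generalizing e v with
  | root h => exact hv.betaRule h
  | lam a _ ih =>
    cases a with
    | lin => exact hv.elim
    | exp A => obtain ⟨B, f, h1, h2⟩ := hv; exact ⟨B, f, h1, fun a => ih (h2 a)⟩
  | appL u _ ih => obtain ⟨A, B, f, a, h1, h2, h3⟩ := hv; exact ⟨A, B, f, a, ih h1, h2, h3⟩
  | appR u _ ih => obtain ⟨A, B, f, a, h1, h2, h3⟩ := hv; exact ⟨A, B, f, a, h1, ih h2, h3⟩
  | pairL u _ ih => obtain ⟨a, b, h1, h2, h3⟩ := hv; exact ⟨a, b, ih h1, h2, h3⟩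
  | pairR u _ ih => obtain ⟨a, b, h1, h2, h3⟩ := hv; exact ⟨a, b, h1, ih h2, h3⟩
  | esubL p u _ ih => obtain ⟨a, e', h1, h2, h3⟩ := hv; exact ⟨a, e', h1, h2, ih h3⟩
  | esubR p u _ ih => obtain ⟨a, e', h1, h2, h3⟩ := hv; exact ⟨a, e', ih h1, h2, h3⟩
  | addL u _ ih => obtain ⟨a, b, h1, h2, h3⟩ := hv; exact ⟨a, b, ih h1, h2, h3⟩
  | addR u _ ih => obtain ⟨a, b, h1, h2, h3⟩ := hv; exact ⟨a, b, h1, ih h2, h3⟩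
  | fn f ts i _ ih =>
    obtain ⟨hf, xs, h1, h2⟩ := hv
    refine ⟨hf, xs, fun j => ?_, h2⟩
    by_cases hj : j = i
    · subst hj; simpa using ih (h1 j)
    · simpa [hj] using h1 j

/-! # Agreement with the denotation -/

/-- The environment of an element of the denotation of a context. -/
def envOf : (Γ : List Ty) → Env Γ → ℕ → DVal
  -- Outside the context the value is deliberately not a real, so a ground term that has a value
  -- cannot use an index out of scope.
  | [], _ => fun _ => ⟨.arr .R .R, fun x => x⟩
  | A :: Γ, g => econs ⟨A, g.1⟩ (envOf Γ g.2)

theorem envOf_idx {Γ : List Ty} {A : Ty} (x : Mem Γ A) (g : Env Γ) : envOf Γ g x.idx = ⟨A, x.den g⟩ := by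
  induction x with
  | head => rfl
  | tail x ih => exact ih _

theorem Deriv.ev {Γ : List Ty} {t : Tm S} {A : Ty} (D : Deriv Γ t A) (g : Env Γ) :
    Ev t (envOf Γ g) ⟨A, D.den g⟩ := by
  induction D with
  | var x => exact ⟨envOf_idx x g, rfl⟩
  | num r => rfl
  | lam _ D ih => exact ⟨_, _, rfl, fun a => ih (a, g)⟩
  | app D E ih ih' => exact ⟨_, _, _, _, ih g, ih' g, rfl⟩
  | pair D E ih ih' => exact ⟨_, _, ih g, ih' g, rfl⟩
  | esub D E ih ih' => exact ⟨_, _, ih' g, ⟨rfl, rfl⟩, ih (E.den g, g)⟩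
  | esub2 D E ih ih' => exact ⟨_, _, ih' g, ⟨_, _, rfl, rfl⟩, ih ((E.den g).1, (E.den g).2, g)⟩
  | add D E ih ih' => exact ⟨_, _, ih g, ih' g, rfl⟩
  | fn hf D ih => exact ⟨hf, _, fun i => ih i g, rfl⟩

theorem envOf_realEnv_lt {n : ℕ} (r : Fin n → ℝ) (i : Fin n) :
    envOf (realCtx n) (realEnv n r) i = ⟨.R, r i⟩ := by
  induction n with
  | zero => exact i.elim0
  | succ n ih =>
    refine Fin.cases rfl (fun i => ?_) i
    exact ih (fun i => r i.succ) i

theorem envOf_realEnv_ge {n : ℕ} (r : Fin n → ℝ) (i : ℕ) (hi : n ≤ i) :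
    envOf (realCtx n) (realEnv n r) i = ⟨.arr .R .R, fun x => x⟩ := by
  induction n generalizing i with
  | zero => rfl
  | succ n ih =>
    obtain ⟨j, rfl⟩ : ∃ j, i = j + 1 := ⟨i - 1, by omega⟩
    exact ih (fun i => r i.succ) j (by omega)

/-- Extension of an environment of reals. -/
def rcons (a : ℝ) (e : ℕ → ℝ) : ℕ → ℝ
  | 0 => a
  | i + 1 => e i

/-- The value of a ground term. -/
def gval : Tm S → (ℕ → ℝ) → ℝ
  | .var _ i, e => e i
  | .num r, _ => r
  | .esub _ F G, e => gval F (rcons (gval G e) e)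
  | .add F G, e => gval F e + gval G e
  | .fn f Gs, e => S.sem f (fun i => gval (Gs i) e)
  | _, _ => 0

/-- The real environment has to agree only where `e` holds a real: a variable of a ground term has a
value only there. -/
theorem Ev.gval {G : Tm S} (hG : Ground G) {e : ℕ → DVal} {ρ : ℕ → ℝ} {v : DVal}
    (hρ : ∀ i x, e i = ⟨.R, x⟩ → ρ i = x) (h : Ev G e v) : v = ⟨.R, LSC.gval G ρ⟩ := by
  induction hG generalizing e ρ v with
  | var i =>
    obtain ⟨h1, h2⟩ := h
    obtain ⟨A, x⟩ := v
    obtain rfl : A = .R := h2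
    show _ = (⟨.R, ρ i⟩ : DVal)
    rw [hρ i x h1]
  | num r => exact h
  | esub _ _ ih ih' =>
    obtain ⟨a, e', h1, ⟨h2, rfl⟩, h3⟩ := h
    obtain rfl := ih' hρ h1
    refine ih (fun i x hx => ?_) h3
    rcases i with _ | i
    · exact eq_of_heq (Sigma.mk.inj hx).2
    · exact hρ i x hx
  | fn hf _ ih =>
    obtain ⟨_, xs, h1, rfl⟩ := h
    have : xs = fun i => LSC.gval _ ρ := funext fun i => eq_of_heq (Sigma.mk.inj (ih i hρ (h1 i))).2
    rw [this]; rfl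
  | add _ _ ih ih' =>
    obtain ⟨x, y, h1, h2, rfl⟩ := h
    have hx := eq_of_heq (Sigma.mk.inj (ih hρ h1)).2
    have hy := eq_of_heq (Sigma.mk.inj (ih' hρ h2)).2
    rw [hx, hy]; rfl

/-- A ground term with a value reads only entries of type `R`. This gives the scoping of `G` without
any typing of it. -/
theorem Ev.occ_ground {G : Tm S} (hG : Ground G) {e : ℕ → DVal} {v : DVal} (h : Ev G e v) {w : Ann → ℕ → ℕ}
    (hw : ∀ i, (e i).1 = .R → w (.exp .R) i = 0) : G.occ w = 0 := by
  induction hG generalizing e v w with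
  | var i => obtain ⟨rfl, h2⟩ := h; exact hw i h2
  | num r => rfl
  | esub _ _ ih ih' =>
    obtain ⟨a, e', h1, ⟨h2, rfl⟩, h3⟩ := h
    simp only [Tm.occ, ih' h1 hw, Nat.add_zero]
    refine ih h3 fun i hi => ?_
    rcases i with _ | i
    · rfl
    · exact hw i hi
  | fn hf _ ih =>
    obtain ⟨_, xs, h1, rfl⟩ := h
    simp only [Tm.occ]
    exact Finset.sum_eq_zero fun i _ => ih i (h1 i) hw
  | add _ _ ih ih' =>
    obtain ⟨x, y, h1, h2, rfl⟩ := h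
    simp only [Tm.occ, ih h1 hw, ih' h2 hw]

end LSC
end

/-! ### The transform with non-zero backpropagators at numerals. -/

noncomputable section

namespace LSC

variable {S : Sig}

/-! # The transformed operations -/

/-- The body of the transformation of a sum. -/
def addBody (d : ℕ) : Tm S :=
  opBody d (k := 2) (.add (.var (.exp .R) 0) (.var (.exp .R) 2)) fun _ => .var .lin 0

/-- The body of the transformation of a function symbol. -/
def fnBody (d : ℕ) (f : S.Sym) : Tm S :=
  opBody d (k := S.ar f) (.fn f fun j => .var (.exp .R) (2 * j.val)) fun i =>
    Tm.mul (.fn (S.pd f i) fun j => .var (.exp .R) (2 * j.val + 1)) (.var .lin 0)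

theorem rev_add (d : ℕ) (t u : Tm S) :
    (Tm.add t u).rev d = letMany (revPat d) [t.rev d, u.rev d] (addBody d) := by
  simp [Tm.rev, addBody, opBody, List.ofFn_succ, Tm.sum]

theorem rev_fn (d : ℕ) (f : S.Sym) (ts : Fin (S.ar f) → Tm S) :
    (Tm.fn f ts).rev d = letMany (revPat d) (List.ofFn fun i => (ts i).rev d) (fnBody d f) := rfl

theorem opBody_occ (d : ℕ) {k : ℕ} (s : Tm S) (g : Fin k → Tm S) (w : Ann → ℕ → ℕ) :
    (opBody d s g).occ w = s.occ w + ∑ i, (w (.exp (.dual d)) (2 * i.val + 1) +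
      (g i).occ fun a i => if i < 1 then 0 else w a (i - 1)) := by
  simp [opBody, Tm.occ, sum_occ, List.sum_ofFn, Function.comp_def]

theorem addBody_occ (d : ℕ) (w : Ann → ℕ → ℕ) : (addBody d : Tm S).occ w =
    w (.exp .R) 0 + w (.exp .R) 2 + (w (.exp (.dual d)) 1 + w (.exp (.dual d)) 3) := by
  simp [addBody, opBody_occ, Tm.occ]

theorem fnBody_occ (d : ℕ) (f : S.Sym) (w : Ann → ℕ → ℕ) : (fnBody d f).occ w =
    (∑ j : Fin (S.ar f), w (.exp .R) (2 * j.val)) + ∑ i : Fin (S.ar f), (w (.exp (.dual d)) (2 * i.val + 1) +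
      ∑ j : Fin (S.ar (S.pd f i)), w (.exp .R) (2 * j.val)) := by
  simp [fnBody, opBody_occ, Tm.occ, mul_occ]

theorem occ_rename_up {t : Tm S} {k : ℕ} (h : t.occ (geWeight k) = 0) (f : ℕ → ℕ) : t.rename (up k f) = t := by
  conv_rhs => rw [← subst_var t]
  rw [rename_eq_subst]
  refine subst_congr h fun a i hi => ?_
  simp only [geWeight] at hi
  by_cases h : i < k
  · simp [up, h]
  · simp [h] at hi

theorem addBody_up (d : ℕ) (f : ℕ → ℕ) : (addBody d : Tm S).rename (up 4 f) = addBody d :=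
  occ_rename_up (by simp [addBody_occ, geWeight]) f

/-- Membership of `f` in `S.F` is needed because only then do the symbols `S.pd f i` have the arity
of `f`, so that their arguments stay within the bound variables. -/
theorem fnBody_up (d : ℕ) {f : S.Sym} (hf : f ∈ S.F) (g : ℕ → ℕ) :
    (fnBody d f).rename (up (2 * S.ar f) g) = fnBody d f := by
  refine occ_rename_up ?_ g
  rw [fnBody_occ]
  have h1 : ∀ j : Fin (S.ar f), geWeight (2 * S.ar f) (.exp .R) (2 * j.val) = 0 := fun j => by
    have := j.2; simp only [geWeight]; rw [if_pos (by omega)]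
  have h2 : ∀ j : Fin (S.ar f), geWeight (2 * S.ar f) (.exp (.dual d)) (2 * j.val + 1) = 0 := fun j => by
    have := j.2; simp only [geWeight]; rw [if_pos (by omega)]
  have h3 : ∀ (i : Fin (S.ar f)) (j : Fin (S.ar (S.pd f i))),
      geWeight (2 * S.ar f) (.exp .R) (2 * j.val) = 0 := fun i j => by
    have := j.2; have := S.ar_pd f hf i; simp only [geWeight]; rw [if_pos (by omega)]
  simp [h1, h2, h3]

theorem Run.add_node {d : ℕ} (r : Fin 2 → ℝ) {W : Fin 2 → Tm S} (hW : ∀ i, Value (W i))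
    (hT : ∀ i, DTy d (W i) (.dual d)) :
    Run 8 (LSC.letMany (revPat d) (List.ofFn fun i => .pair (.num (r i)) (W i)) (addBody d))
      (.pair (.num (r 0 + r 1)) (LSC.node d W fun _ => .var .lin 0)) := by
  have h := Run.node (d := d) (k := 2) (.add (.var (.exp .R) 0) (.var (.exp .R) 2)) (fun _ => .var .lin 0) r hW hT
    (x := r 0 + r 1) (arg := fun _ => .var .lin 0) (c := fun _ => 1) (fun i => .inl ⟨rfl, rfl⟩) (n := 1)
    (m := fun _ => 0) (by simpa [Tm.subst, evenSubst] using Run.add_num (r 0) (r 1))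
    (fun i => by simpa [Tm.subst, upS] using Run.refl _)
    (by rw [← addBody, addBody_occ]; simp [evenBad])
  rw [← addBody, addBody_occ] at h
  simpa [evenWeight] using h

/-- A bound on the cost of the transformation of a symbol with `k` arguments. -/
def nodeCost (k : ℕ) : ℕ := k * k + 5 * k + 8

theorem Run.fn_node {d : ℕ} {f : S.Sym} (hf : f ∈ S.F) (r : Fin (S.ar f) → ℝ) {W : Fin (S.ar f) → Tm S}
    (hW : ∀ i, Value (W i)) (hT : ∀ i, DTy d (W i) (.dual d)) :
    Run (nodeCost (S.ar f)) (LSC.letMany (revPat d) (List.ofFn fun i => .pair (.num (r i)) (W i)) (fnBody d f))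
      (.pair (.num (S.sem f r)) (LSC.node d W fun i =>
        Tm.mul (.num (fderiv ℝ (S.sem f) r (Pi.single i 1))) (.var .lin 0))) := by
  have e2 : ∀ j : ℕ, (2 * j + 1 - 1) / 2 = j := by omega
  have h := Run.node (d := d) (.fn f fun j => .var (.exp .R) (2 * j.val)) (fun i =>
      Tm.mul (.fn (S.pd f i) fun j => .var (.exp .R) (2 * j.val + 1)) (.var .lin 0)) r hW hT
    (x := S.sem f r) (arg := fun i => Tm.mul (.num (fderiv ℝ (S.sem f) r (Pi.single i 1))) (.var .lin 0))
    (c := fun i => fderiv ℝ (S.sem f) r (Pi.single i 1)) (fun i => .inr rfl) (n := 1)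
    (m := fun _ => 1) (by simpa [Tm.subst, evenSubst] using Run.fn_num f r)
    (fun i => by
      rw [← S.sem_pd f hf i r]
      have h1 := Run.fn_num (S.pd f i) fun j => r (Fin.cast (S.ar_pd f hf i) j)
      simp only [mul_subst, Tm.subst]
      have e1 : (fun j : Fin (S.ar (S.pd f i)) => upS 1 (evenSubst (S.ar f) r) (.exp .R) (2 * j.val + 1)) =
          fun j => (.num (r (Fin.cast (S.ar_pd f hf i) j)) : Tm S) := by
        funext j
        have := j.2
        have h3 : j.val < S.ar f := by rw [← S.ar_pd f hf i]; exact this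
        simp [upS, evenSubst, h3, Tm.wk, Tm.rename]
        rfl
      rw [e1]
      exact (h1.mul (Run.refl _)).mono (by omega))
    (by
      rw [← fnBody, fnBody_occ]
      have h2 : ∀ j : ℕ, (2 * j + 1) % 2 = 1 := by omega
      simp [evenBad, h2])
  rw [← fnBody, fnBody_occ] at h
  -- The quadratic term of `nodeCost` counts the numerals copied into the partial derivatives: there
  -- are `S.ar f` of these symbols, each with `S.ar f` arguments.
  refine h.mono ?_
  have h2 : ∀ i, S.ar (S.pd f i) = S.ar f := S.ar_pd f hf
  have h3 : ∀ (k : ℕ) (w : Fin k → ℕ), (∀ i, w i ≤ 1) → ∑ i, w i ≤ k := fun k w hw => by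
    simpa using Finset.sum_le_sum (s := Finset.univ) fun i _ => hw i
  have h4 : ∀ a i, evenWeight (S.ar f) a i ≤ 1 := fun a i => by unfold evenWeight; split_ifs <;> omega
  have h5 := h3 (S.ar f) (fun j => evenWeight (S.ar f) (.exp .R) (2 * j.val)) fun i => h4 _ _
  have h6 : ∑ i : Fin (S.ar f), (evenWeight (S.ar f) (.exp (.dual d)) (2 * i.val + 1) +
      ∑ j : Fin (S.ar (S.pd f i)), evenWeight (S.ar f) (.exp .R) (2 * j.val)) ≤ ∑ i : Fin (S.ar f), (1 + S.ar f) := by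
    refine Finset.sum_le_sum fun i _ => Nat.add_le_add (h4 _ _) ?_
    exact (h3 _ _ fun j => h4 _ _).trans (h2 i).le
  simp only [Finset.sum_const, Finset.card_univ, Fintype.card_fin, smul_eq_mul, mul_one, nodeCost] at h6 ⊢
  nlinarith

/-! # The relation between terms and their transformations -/

/-- `Rv d L t x`: the term `x` is the transformation of `t`, except that the backpropagators of
the numerals are taken from `L`. -/
def Rv (d : ℕ) (L : List (Tm S)) : Tm S → Tm S → Prop
  | .var a i, x => x = .var (a.rev d) i
  | .num r, x => ∃ W ∈ L, x = .pair (.num r) W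
  | .lam a t, x => ∃ t', Rv d L t t' ∧ x = .lam (a.rev d) t'
  | .app t u, x => ∃ t' u', Rv d L t t' ∧ Rv d L u u' ∧ x = .app t' u'
  | .pair t u, x => ∃ t' u', Rv d L t t' ∧ Rv d L u u' ∧ x = .pair t' u'
  | .esub p t u, x => ∃ t' u', Rv d L t t' ∧ Rv d L u u' ∧ x = .esub (p.rev d) t' u'
  | .add t u, x => ∃ t' u', Rv d L t t' ∧ Rv d L u u' ∧ x = letMany (revPat d) [t', u'] (addBody d)
  | .fn f ts, x => ∃ ts', (∀ i, Rv d L (ts i) (ts' i)) ∧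
      x = letMany (revPat d) (List.ofFn ts') (fnBody d f)

theorem Rv.mono {d : ℕ} {L L' : List (Tm S)} (hL : L ⊆ L') {t x : Tm S} (h : Rv d L t x) : Rv d L' t x := by
  induction t generalizing x with
  | var a i => exact h
  | num r => obtain ⟨W, h1, h2⟩ := h; exact ⟨W, hL h1, h2⟩
  | lam a t ih => obtain ⟨t', h1, h2⟩ := h; exact ⟨t', ih h1, h2⟩
  | app t u ih ih' => obtain ⟨t', u', h1, h2, h3⟩ := h; exact ⟨t', u', ih h1, ih' h2, h3⟩
  | pair t u ih ih' => obtain ⟨t', u', h1, h2, h3⟩ := h; exact ⟨t', u', ih h1, ih' h2, h3⟩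
  | esub p t u ih ih' => obtain ⟨t', u', h1, h2, h3⟩ := h; exact ⟨t', u', ih h1, ih' h2, h3⟩
  | add t u ih ih' => obtain ⟨t', u', h1, h2, h3⟩ := h; exact ⟨t', u', ih h1, ih' h2, h3⟩
  | fn f ts ih => obtain ⟨ts', h1, h2⟩ := h; exact ⟨ts', fun i => ih i (h1 i), h2⟩

theorem Rv.rev {d : ℕ} {L : List (Tm S)} (hL : .lam .lin (.zero d) ∈ L) (t : Tm S) : Rv d L t (t.rev d) := by
  induction t with
  | var a i => rfl
  | num r => exact ⟨_, hL, rfl⟩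
  | lam a t ih => exact ⟨_, ih, rfl⟩
  | app t u ih ih' => exact ⟨_, _, ih, ih', rfl⟩
  | pair t u ih ih' => exact ⟨_, _, ih, ih', rfl⟩
  | esub p t u ih ih' => exact ⟨_, _, ih, ih', rfl⟩
  | add t u ih ih' => exact ⟨_, _, ih, ih', rev_add _ _ _⟩
  | fn f ts ih => exact ⟨_, ih, rev_fn _ _ _⟩

@[simp] theorem rev_ar (d : ℕ) (p : Pat) : (p.rev d).ar = p.ar := by cases p <;> rfl

/-- Terms all of whose function symbols belong to the source language. -/
def Src : Tm S → Prop
  | .var _ _ => True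
  | .num _ => True
  | .lam _ t => Src t
  | .app t u => Src t ∧ Src u
  | .pair t u => Src t ∧ Src u
  | .esub _ t u => Src t ∧ Src u
  | .add t u => Src t ∧ Src u
  | .fn f ts => f ∈ S.F ∧ ∀ i, Src (ts i)

theorem Ev.src {t : Tm S} {e : ℕ → DVal} {v : DVal} (h : Ev t e v) : Src t := by
  induction t generalizing e v with
  | var a i => trivial
  | num r => trivial
  | lam a t ih =>
    cases a with
    | lin => exact h.elim
    | exp A => obtain ⟨B, f, h1, h2⟩ := h; exact ih (h2 (denInhabited A).default)
  | app t u ih ih' => obtain ⟨A, B, f, a, h1, h2, h3⟩ := h; exact ⟨ih h1, ih' h2⟩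
  | pair t u ih ih' => obtain ⟨a, b, h1, h2, h3⟩ := h; exact ⟨ih h1, ih' h2⟩
  | esub p t u ih ih' => obtain ⟨a, e', h1, h2, h3⟩ := h; exact ⟨ih h3, ih' h1⟩
  | add t u ih ih' => obtain ⟨a, b, h1, h2, h3⟩ := h; exact ⟨ih h1, ih' h2⟩
  | fn f ts ih => obtain ⟨hf, xs, h1, h2⟩ := h; exact ⟨hf, fun i => ih i (h1 i)⟩

theorem src_rename (t : Tm S) (f : ℕ → ℕ) : Src (t.rename f) ↔ Src t := by
  induction t generalizing f <;> simp [Tm.rename, Src, *]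

theorem Rv.rename {d : ℕ} {L : List (Tm S)} (hL : ∀ W ∈ L, Closed W) {t x : Tm S} (h : Rv d L t x)
    (hs : Src t) (f : ℕ → ℕ) : Rv d L (t.rename f) (x.rename f) := by
  induction t generalizing x f with
  | var a i => subst h; rfl
  | num r => obtain ⟨W, h1, rfl⟩ := h; exact ⟨W, h1, by simp [Tm.rename, hL W h1 f]⟩
  | lam a t ih => obtain ⟨t', h1, rfl⟩ := h; exact ⟨_, ih h1 hs _, rfl⟩
  | app t u ih ih' => obtain ⟨t', u', h1, h2, rfl⟩ := h; exact ⟨_, _, ih h1 hs.1 f, ih' h2 hs.2 f, rfl⟩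
  | pair t u ih ih' => obtain ⟨t', u', h1, h2, rfl⟩ := h; exact ⟨_, _, ih h1 hs.1 f, ih' h2 hs.2 f, rfl⟩
  | esub p t u ih ih' =>
    obtain ⟨t', u', h1, h2, rfl⟩ := h
    exact ⟨_, _, ih h1 hs.1 _, ih' h2 hs.2 f, by simp [Tm.rename]⟩
  | add t u ih ih' =>
    obtain ⟨t', u', h1, h2, rfl⟩ := h
    exact ⟨_, _, ih h1 hs.1 f, ih' h2 hs.2 f, by simp [letMany_rename, Pat.ar, addBody_up]⟩
  | fn g ts ih =>
    obtain ⟨ts', h1, rfl⟩ := h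
    refine ⟨_, fun i => ih i (h1 i) (hs.2 i) f, ?_⟩
    simp [letMany_rename, Pat.ar, fnBody_up d hs.1, Function.comp_def]

/-- The transform introduces no free variables, as the members of `L` are closed. This is what
allows an unused substitution to be erased also after transformation. -/
theorem Rv.rename_inv {d : ℕ} {L : List (Tm S)} (hL : ∀ W ∈ L, Closed W) {t x : Tm S} {f : ℕ → ℕ}
    (h : Rv d L (t.rename f) x) (hs : Src t) : ∃ y, Rv d L t y ∧ x = y.rename f := by
  induction t generalizing x f with
  | var a i => subst h; exact ⟨_, rfl, rfl⟩
  | num r => obtain ⟨W, h1, rfl⟩ := h; exact ⟨_, ⟨W, h1, rfl⟩, by simp [Tm.rename, hL W h1 f]⟩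
  | lam a t ih =>
    obtain ⟨t', h1, rfl⟩ := h
    obtain ⟨y, h2, rfl⟩ := ih h1 hs
    exact ⟨_, ⟨_, h2, rfl⟩, rfl⟩
  | app t u ih ih' =>
    obtain ⟨t', u', h1, h2, rfl⟩ := h
    obtain ⟨y, h3, rfl⟩ := ih h1 hs.1
    obtain ⟨z, h4, rfl⟩ := ih' h2 hs.2
    exact ⟨_, ⟨_, _, h3, h4, rfl⟩, rfl⟩
  | pair t u ih ih' =>
    obtain ⟨t', u', h1, h2, rfl⟩ := h
    obtain ⟨y, h3, rfl⟩ := ih h1 hs.1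
    obtain ⟨z, h4, rfl⟩ := ih' h2 hs.2
    exact ⟨_, ⟨_, _, h3, h4, rfl⟩, rfl⟩
  | esub p t u ih ih' =>
    obtain ⟨t', u', h1, h2, rfl⟩ := h
    obtain ⟨y, h3, rfl⟩ := ih h1 hs.1
    obtain ⟨z, h4, rfl⟩ := ih' h2 hs.2
    exact ⟨_, ⟨_, _, h3, h4, rfl⟩, by simp [Tm.rename]⟩
  | add t u ih ih' =>
    obtain ⟨t', u', h1, h2, rfl⟩ := h
    obtain ⟨y, h3, rfl⟩ := ih h1 hs.1
    obtain ⟨z, h4, rfl⟩ := ih' h2 hs.2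
    exact ⟨_, ⟨_, _, h3, h4, rfl⟩, by simp [letMany_rename, Pat.ar, addBody_up]⟩
  | fn g ts ih =>
    obtain ⟨ts', h1, rfl⟩ := h
    choose y h2 h3 using fun i => ih i (h1 i) (hs.2 i)
    refine ⟨_, ⟨y, h2, rfl⟩, ?_⟩
    rw [funext h3]
    simp [letMany_rename, Pat.ar, fnBody_up d hs.1, Function.comp_def]

theorem Rv.value {d : ℕ} {L : List (Tm S)} (hL : ∀ W ∈ L, Value W) {t x : Tm S} (h : Rv d L t x)
    (hv : Value t) : Value x := by
  induction hv generalizing x with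
  | var a i => subst h; exact .var _ _
  | num r => obtain ⟨W, h1, rfl⟩ := h; exact .pair (.num _) (hL W h1)
  | lam a t => obtain ⟨t', h1, rfl⟩ := h; exact .lam _ _
  | pair _ _ ih ih' => obtain ⟨t', u', h1, h2, rfl⟩ := h; exact .pair (ih h1) (ih' h2)

theorem Replace.letMany_body {A : Ty} (p : Pat) (us : List (Tm S)) {k : ℕ} {v t t' : Tm S}
    (h : Replace A (k + p.ar * us.length) (v.wk 0 (p.ar * us.length)) t t') :
    Replace A k v (LSC.letMany p us t) (LSC.letMany p us t') := by
  induction us generalizing t t' with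
  | nil => simpa [LSC.letMany, wk_zero] using h
  | cons u us ih =>
    refine ih (.esubL p _ ?_)
    rw [wk_wk_zero]
    simpa [Nat.mul_succ, Nat.add_assoc] using h

theorem Replace.letMany_arg {A : Ty} (p : Pat) {n : ℕ} (us : Fin n → Tm S) (i : Fin n) {k : ℕ} {v u' t : Tm S}
    (h : Replace A k v (us i) u') :
    Replace A k v (LSC.letMany p (List.ofFn us) t) (LSC.letMany p (List.ofFn (Function.update us i u')) t) := by
  induction n generalizing t with
  | zero => exact i.elim0
  | succ n ih =>
    rw [List.ofFn_succ, List.ofFn_succ]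
    simp only [LSC.letMany, List.length_ofFn]
    induction i using Fin.cases with
    | zero =>
      have e : (fun j : Fin n => Function.update us 0 u' j.succ) = fun j => us j.succ := by
        funext j; simp
      rw [e, Function.update_self]
      refine .letMany_body _ _ (.esubR p _ ?_)
      rw [List.length_ofFn]
      have := h.rename (fun i => i + p.ar * n)
      simpa [Tm.wk] using this
    | succ i =>
      have e : (fun j : Fin n => Function.update us i.succ u' j.succ) =
          Function.update (fun j => us j.succ) i u' := by
        funext j; simp [Function.update_apply]
      have e0 : Function.update us i.succ u' 0 = us 0 := Function.update_of_ne (Fin.succ_ne_zero i).symm _ _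
      rw [e, e0]
      exact ih (fun j => us j.succ) i h

/-- Each variable occurrence of `t` corresponds to exactly one in its transform, so a single
replacement is matched by a single one. -/
theorem Rv.replace {d : ℕ} {L : List (Tm S)} (hL : ∀ W ∈ L, Closed W) {A : Ty} {k : ℕ} {v t t' : Tm S}
    (hr : Replace A k v t t') {x y : Tm S} (h : Rv d L t x) (hv : Rv d L v y) (hs : Src v) :
    ∃ x', Rv d L t' x' ∧ Replace (A.rev d) k y x x' := by
  induction hr generalizing x y with
  | here k v => subst h; exact ⟨y, hv, .here _ _⟩
  | lam a _ ih =>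
    obtain ⟨t', h1, rfl⟩ := h
    obtain ⟨x', h2, h3⟩ := ih h1 (hv.rename hL hs _) ((src_rename _ _).2 hs)
    exact ⟨_, ⟨_, h2, rfl⟩, .lam _ h3⟩
  | appL u _ ih =>
    obtain ⟨t', u', h1, h2, rfl⟩ := h
    obtain ⟨x', h3, h4⟩ := ih h1 hv hs
    exact ⟨_, ⟨_, _, h3, h2, rfl⟩, .appL _ h4⟩
  | appR u _ ih =>
    obtain ⟨t', u', h1, h2, rfl⟩ := h
    obtain ⟨x', h3, h4⟩ := ih h2 hv hs
    exact ⟨_, ⟨_, _, h1, h3, rfl⟩, .appR _ h4⟩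
  | pairL u _ ih =>
    obtain ⟨t', u', h1, h2, rfl⟩ := h
    obtain ⟨x', h3, h4⟩ := ih h1 hv hs
    exact ⟨_, ⟨_, _, h3, h2, rfl⟩, .pairL _ h4⟩
  | pairR u _ ih =>
    obtain ⟨t', u', h1, h2, rfl⟩ := h
    obtain ⟨x', h3, h4⟩ := ih h2 hv hs
    exact ⟨_, ⟨_, _, h1, h3, rfl⟩, .pairR _ h4⟩
  | esubL p u _ ih =>
    obtain ⟨t', u', h1, h2, rfl⟩ := h
    obtain ⟨x', h3, h4⟩ := ih h1 (hv.rename hL hs _) ((src_rename _ _).2 hs)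
    exact ⟨_, ⟨_, _, h3, h2, rfl⟩, .esubL _ _ (by rw [rev_ar]; exact h4)⟩
  | esubR p t _ ih =>
    obtain ⟨t', u', h1, h2, rfl⟩ := h
    obtain ⟨x', h3, h4⟩ := ih h2 hv hs
    exact ⟨_, ⟨_, _, h1, h3, rfl⟩, .esubR _ _ h4⟩
  | addL u _ ih =>
    obtain ⟨t', u', h1, h2, rfl⟩ := h
    obtain ⟨x', h3, h4⟩ := ih h1 hv hs
    refine ⟨_, ⟨_, _, h3, h2, rfl⟩, ?_⟩
    have := Replace.letMany_arg (revPat d) ![t', u'] 0 (t := addBody d) h4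
    simpa [List.ofFn_succ] using this
  | addR t _ ih =>
    obtain ⟨t', u', h1, h2, rfl⟩ := h
    obtain ⟨x', h3, h4⟩ := ih h2 hv hs
    refine ⟨_, ⟨_, _, h1, h3, rfl⟩, ?_⟩
    have := Replace.letMany_arg (revPat d) ![t', u'] 1 (t := addBody d) h4
    simpa [List.ofFn_succ, Function.update_apply] using this
  | fn f ts i _ ih =>
    obtain ⟨ts', h1, rfl⟩ := h
    obtain ⟨x', h3, h4⟩ := ih (h1 i) hv hs
    refine ⟨_, ⟨Function.update ts' i x', fun j => ?_, rfl⟩, .letMany_arg _ _ _ h4⟩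
    by_cases hj : j = i
    · subst hj; simpa using h3
    · simpa [hj] using h1 j

/-- The transformation of substitution contexts. -/
def RvC (d : ℕ) (L : List (Tm S)) : SCtx S → SCtx S → Prop
  | [], β => β = []
  | (p, u) :: α, β => ∃ u' β', Rv d L u u' ∧ RvC d L α β' ∧ β = (p.rev d, u') :: β'

theorem Rv.plug_inv {d : ℕ} {L : List (Tm S)} {α : SCtx S} {t x : Tm S} (h : Rv d L (SCtx.plug α t) x) :
    ∃ β y, RvC d L α β ∧ Rv d L t y ∧ x = SCtx.plug β y := by
  induction α generalizing t with
  | nil => exact ⟨[], x, rfl, h, rfl⟩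
  | cons a α ih =>
    obtain ⟨p, u⟩ := a
    obtain ⟨β, y, h1, ⟨t', u', h2, h3, rfl⟩, rfl⟩ := ih (t := .esub p t u) h
    exact ⟨_, t', ⟨u', β, h3, h1, rfl⟩, h2, rfl⟩

theorem RvC.plug {d : ℕ} {L : List (Tm S)} {α β : SCtx S} (h : RvC d L α β) {t x : Tm S} (ht : Rv d L t x) :
    Rv d L (SCtx.plug α t) (SCtx.plug β x) := by
  induction α generalizing β t x with
  | nil => subst h; exact ht
  | cons a α ih =>
    obtain ⟨u', β', h1, h2, rfl⟩ := h
    exact ih h2 ⟨_, _, ht, h1, rfl⟩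

theorem RvC.bnd {d : ℕ} {L : List (Tm S)} {α β : SCtx S} (h : RvC d L α β) : SCtx.bnd β = SCtx.bnd α := by
  induction α generalizing β with
  | nil => subst h; rfl
  | cons a α ih => obtain ⟨u', β', h1, h2, rfl⟩ := h; simp [SCtx.bnd, ih h2]

theorem RvC.mono {d : ℕ} {L L' : List (Tm S)} (hL : L ⊆ L') {α β : SCtx S} (h : RvC d L α β) : RvC d L' α β := by
  induction α generalizing β with
  | nil => exact h
  | cons a α ih => obtain ⟨u', β', h1, h2, rfl⟩ := h; exact ⟨_, _, h1.mono hL, ih h2, rfl⟩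

theorem RvC.append {d : ℕ} {L : List (Tm S)} {α α' β β' : SCtx S} (h : RvC d L α β) (h' : RvC d L α' β') :
    RvC d L (α ++ α') (β ++ β') := by
  induction α generalizing β with
  | nil => subst h; exact h'
  | cons a α ih => obtain ⟨u', β', h1, h2, rfl⟩ := h; exact ⟨_, _, h1, ih h2, rfl⟩

theorem RvC.wk {d : ℕ} {L : List (Tm S)} (hL : ∀ W ∈ L, Closed W) {α β : SCtx S} (h : RvC d L α β)
    (hs : ∀ x ∈ α, Src x.2) (k : ℕ) : RvC d L (SCtx.wk k α) (SCtx.wk k β) := by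
  induction α generalizing β with
  | nil => subst h; rfl
  | cons a α ih =>
    obtain ⟨u', β', h1, h2, rfl⟩ := h
    refine ⟨_, _, h1.rename hL (hs a (by simp)) _, ih h2 fun x hx => hs x (by simp [hx]), ?_⟩
    simp only [SCtx.wk, h2.bnd, Tm.wk]

theorem src_plug {α : SCtx S} {t : Tm S} (h : Src (SCtx.plug α t)) : (∀ x ∈ α, Src x.2) ∧ Src t := by
  induction α generalizing t with
  | nil => exact ⟨by simp, h⟩
  | cons a α ih =>
    obtain ⟨h1, h2, h3⟩ := ih (t := .esub a.1 t a.2) h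
    exact ⟨List.forall_mem_cons.2 ⟨h3, h1⟩, h2⟩

theorem RvC.catAll {d : ℕ} {L : List (Tm S)} (hL : ∀ W ∈ L, Closed W) {k : ℕ} {α β : Fin k → SCtx S}
    (h : ∀ i, RvC d L (α i) (β i)) (hs : ∀ i, ∀ x ∈ α i, Src x.2) :
    RvC d L (SCtx.catAll (List.ofFn α)) (SCtx.catAll (List.ofFn β)) := by
  induction k with
  | zero => rfl
  | succ k ih =>
    rw [List.ofFn_succ, List.ofFn_succ]
    have h1 := ih (fun i => h i.succ) fun i => hs i.succ
    simp only [SCtx.catAll, SCtx.cat, h1.bnd]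
    exact ((h 0).wk hL (hs 0) _).append h1

end LSC
end

noncomputable section

namespace LSC

variable {S : Sig}

/-! # Simulation of evaluation by the transformed terms -/

/-- Lists of backpropagators, each of which is constant zero or combines later ones. -/
inductive Leaves (d B : ℕ) : List (Tm S) → Prop
  | base : Leaves d B [.lam .lin (.zero d)]
  | node {L : List (Tm S)} {k : ℕ} {W arg : Fin k → Tm S} {c : Fin k → ℝ} : Leaves d B L → k ≤ B →
      (∀ i, W i ∈ L) → (∀ i, IsArg (c i) (arg i)) → Leaves d B (LSC.node d W arg :: L)

theorem Leaves.leaf {d B : ℕ} {L : List (Tm S)} (h : Leaves d B L) {W : Tm S} (hW : W ∈ L) :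
    Value W ∧ HasTy [] none W (.dual d) := by
  induction h generalizing W with
  | base =>
    obtain rfl := List.mem_singleton.1 hW
    exact ⟨.lam _ _, .llam (.zero rfl)⟩
  | node _ _ h1 h2 ih =>
    rcases List.mem_cons.1 hW with rfl | hW
    · exact ⟨.lam _ _, node_hasTy (N := 0) h2 fun i => (ih (h1 i)).2⟩
    · exact ih hW

theorem Leaves.closed {d B : ℕ} {L : List (Tm S)} (h : Leaves d B L) : ∀ W ∈ L, Closed W :=
  fun _ hW => (h.leaf hW).2.closed

theorem Leaves.value {d B : ℕ} {L : List (Tm S)} (h : Leaves d B L) : ∀ W ∈ L, Value W :=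
  fun _ hW => (h.leaf hW).1

theorem Leaves.dTy {d B : ℕ} {L : List (Tm S)} (h : Leaves d B L) : ∀ W ∈ L, DTy d W (.dual d) :=
  fun _ hW => ⟨0, (h.leaf hW).2⟩

theorem nodeCost_mono {k B : ℕ} (h : k ≤ B) : nodeCost k ≤ nodeCost B := by
  unfold nodeCost; nlinarith

theorem Closed.pair_num {W : Tm S} (h : Closed W) (r : ℝ) : Closed (.pair (.num r) W) := fun f => by
  simp [Tm.rename, h f]

/-- `Sim d B L t x`: in boundedly many steps, `x` becomes a transformation of `t`, relative to a
list that extends `L` by at most one element. -/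
def Sim (d B : ℕ) (L : List (Tm S)) (t x : Tm S) : Prop :=
  ∃ L' x', Leaves d B L' ∧ L ⊆ L' ∧ L'.length ≤ L.length + 1 ∧ Rv d L' t x' ∧ Run (nodeCost B) x x'

theorem Sim.of_run {d B : ℕ} {L : List (Tm S)} (hL : Leaves d B L) {t x x' : Tm S} (h : Rv d L t x')
    (hr : Run 1 x x') : Sim d B L t x :=
  ⟨L, x', hL, fun _ h => h, by omega, h, hr.mono (by unfold nodeCost; omega)⟩

/-- Evaluating an operation on numerals creates one numeral, whose backpropagator is the single new
element of the list. The stacks of the operands are moved outside by equivalence first; this needs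
the pairs of numerals and backpropagators to be closed. -/
theorem Sim.node {d B : ℕ} {L : List (Tm S)} (hL : Leaves d B L) {k : ℕ}
    (hk : k ≤ B) {α β : Fin k → SCtx S} (hα : ∀ i, RvC d L (α i) (β i)) (hs : ∀ i, ∀ x ∈ α i, Src x.2)
    (r : Fin k → ℝ) {W : Fin k → Tm S} (hW : ∀ i, W i ∈ L) {b : Tm S} (hb : ∀ g, b.rename (up (2 * k) g) = b)
    {s : ℝ} {arg : Fin k → Tm S} {c : Fin k → ℝ} (ha : ∀ i, IsArg (c i) (arg i)) {n : ℕ} (hn : n ≤ nodeCost B)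
    (hr : Run n (LSC.letMany (revPat d) (List.ofFn fun i => .pair (.num (r i)) (W i)) b)
      (.pair (.num s) (LSC.node d W arg))) :
    Sim d B L (SCtx.plug (SCtx.catAll (List.ofFn α)) (.num s))
      (LSC.letMany (revPat d) (List.ofFn fun i => SCtx.plug (β i) (.pair (.num (r i)) (W i))) b) := by
  have hsub : L ⊆ LSC.node d W arg :: L := fun _ h => List.mem_cons_of_mem _ h
  have hL' : Leaves d B (LSC.node d W arg :: L) := .node hL hk hW ha
  refine ⟨_, SCtx.plug (SCtx.catAll (List.ofFn β)) (.pair (.num s) (LSC.node d W arg)), hL', hsub,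
    by simp, ?_, ?_⟩
  · exact (RvC.catAll hL'.closed (fun i => (hα i).mono hsub) hs).plug ⟨_, by simp, rfl⟩
  · have h := NEq.letMany_plug_args (revPat d) (List.ofFn fun i => (β i, Tm.pair (.num (r i)) (W i)))
      (fun x hx => by
        obtain ⟨i, rfl⟩ := List.mem_ofFn.1 hx
        exact (hL.closed _ (hW i)).pair_num _) b
    simp only [ofFn_fold, List.length_ofFn] at h
    rw [show (revPat d).ar = 2 from rfl, hb] at h
    exact h.trans_run ((hr.mono hn).plug _)

/-- The structural rules are matched by one step, after moving stacks by equivalence; only sums and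
function symbols have a larger cost and extend the list. The remaining rules cannot occur on a term
that has a value. -/
theorem Rv.sim_root {d B : ℕ} (hB : ∀ f ∈ S.F, S.ar f ≤ B) {L : List (Tm S)} (hL : Leaves d B L) {t t' : Tm S}
    (h : BetaRule t t') {e : ℕ → DVal} {v : DVal} (hv : Ev t e v) {x : Tm S} (hx : Rv d L t x) :
    Sim d B L t' x := by
  have hs := hv.src
  have h0 : 2 ≤ B := by rw [← S.ar_mul]; exact hB _ S.mul_mem
  cases h with
  | lam a t u α =>
    obtain ⟨x, u', h1, h2, rfl⟩ := hx
    obtain ⟨β, y, h3, ⟨t', h4, rfl⟩, rfl⟩ := h1.plug_inv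
    refine .of_run hL ?_ ((NEq.opL_plug .app β _ u').trans_run ((Run.beta _ _ _).plug β))
    exact h3.plug ⟨_, _, h4, h2.rename hL.closed hs.2 _, by rw [h3.bnd]; rfl⟩
  | pair A B s t u α =>
    obtain ⟨s', x, h1, h2, rfl⟩ := hx
    obtain ⟨β, y, h3, ⟨t', u', h4, h5, rfl⟩, rfl⟩ := h2.plug_inv
    refine .of_run hL ?_ ((NEq.esub_plug _ _ β _).trans_run ((Run.split _ _ _ _ _).plug β))
    refine h3.plug ⟨_, _, ⟨_, _, h1.rename hL.closed hs.1 _, h4.rename hL.closed (src_plug hs.2).2.1 _, ?_⟩, h5, rfl⟩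
    rw [h3.bnd]; rfl
  | subst A t t' w α hw hr =>
    obtain ⟨x, y, h1, h2, rfl⟩ := hx
    obtain ⟨β, y, h3, h4, rfl⟩ := h2.plug_inv
    have hsw := (src_plug hs.2).2
    obtain ⟨x', h5, h6⟩ := (h1.rename hL.closed hs.1 (fun i => if i < 1 then i else i + SCtx.bnd α)).replace
      hL.closed hr (h4.rename hL.closed hsw _) ((src_rename _ _).2 hsw)
    refine .of_run hL (h3.plug ⟨_, _, h5, h4, rfl⟩) ((NEq.esub_plug _ _ β _).trans_run (Run.plug β ?_))
    rw [h3.bnd]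
    intro f
    have h7 : Replace (A.rev d) 0 ((y.wk 0 1).rename (up 1 f)) ((x.wk 1 (SCtx.bnd α)).rename (up 1 f))
      (x'.rename (up 1 f)) := h6.rename (up 1 f)
    rw [wk_up] at h7
    exact .of_red (.lookup ((h4.value hL.value hw).rename f) h7)
  | gc A t w α hw =>
    obtain ⟨x, y, h1, h2, rfl⟩ := hx
    obtain ⟨β, y, h3, h4, rfl⟩ := h2.plug_inv
    obtain ⟨x, h5, rfl⟩ := h1.rename_inv hL.closed ((src_rename _ _).1 hs.1)
    refine .of_run hL (h3.plug (h5.rename hL.closed ((src_rename _ _).1 hs.1) _))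
      ((NEq.esub_plug _ _ β _).trans_run (Run.plug β ?_))
    rw [h3.bnd]
    have h6 := Run.gc (A.rev d) (x.wk 0 (SCtx.bnd α)) (h4.value hL.value hw)
    have e1 : (x.wk 0 (SCtx.bnd α)).wk 0 1 = (x.wk 0 1).wk 1 (SCtx.bnd α) := by
      simp only [Tm.wk, rename_rename]
      exact rename_ext _ fun i => by simp; omega
    rw [e1] at h6
    exact h6
  | lin t w α _ => obtain ⟨a, e₁, _, h2, _⟩ := hv; exact h2.elim
  | add r q α β =>
    obtain ⟨x, y, h1, h2, rfl⟩ := hx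
    obtain ⟨α', y, h3, ⟨W, h4, rfl⟩, rfl⟩ := h1.plug_inv
    obtain ⟨β', y, h5, ⟨V, h6, rfl⟩, rfl⟩ := h2.plug_inv
    have hW : ∀ i, ![W, V] i ∈ L := fun i => by fin_cases i; exacts [h4, h6]
    have := Sim.node hL (k := 2) h0 (α := ![α, β]) (β := ![α', β'])
      (fun i => by fin_cases i; exacts [h3, h5])
      (fun i => by fin_cases i; exacts [(src_plug hs.1).1, (src_plug hs.2).1]) ![r, q] hW (addBody_up d)
      (fun i => .inl ⟨rfl, rfl⟩) (n := 8) (by unfold nodeCost; omega)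
      (Run.add_node ![r, q] (fun i => hL.value _ (hW i)) (fun i => hL.dTy _ (hW i)))
    simpa [List.ofFn_succ, SCtx.catAll, SCtx.cat, SCtx.wk, ctxWk_zero, SCtx.bnd] using this
  | addPair t₁ t₂ u₁ u₂ α β =>
    obtain ⟨x, y, h1, _, _⟩ := hv
    obtain ⟨e', _, ⟨a, b, _, _, h2⟩, _⟩ := h1.plug
    cases h2
  | fn f r α =>
    obtain ⟨ts, h1, rfl⟩ := hx
    choose β y h3 h4 h5 using fun i => (h1 i).plug_inv
    choose W h6 h7 using h4
    obtain rfl := funext h5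
    obtain rfl := funext h7
    exact Sim.node hL (hB f hs.1) h3 (fun i => (src_plug (hs.2 i)).1) r h6 (fnBody_up d hs.1)
      (fun i => .inr rfl) (nodeCost_mono (hB f hs.1))
      (Run.fn_node hs.1 r (fun i => hL.value _ (h6 i)) (fun i => hL.dTy _ (h6 i)))

theorem Rv.sim {d B : ℕ} (hB : ∀ f ∈ S.F, S.ar f ≤ B) {L : List (Tm S)} (hL : Leaves d B L) {t t' : Tm S}
    (h : Beta t t') {e : ℕ → DVal} {v : DVal} (hv : Ev t e v) {x : Tm S} (hx : Rv d L t x) :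
    Sim d B L t' x := by
  unfold Beta at h
  induction h generalizing e v x with
  | root h => exact hx.sim_root hB hL h hv
  | lam a _ ih =>
    cases a with
    | lin => exact hv.elim
    | exp A =>
      obtain ⟨C, f, h1, h2⟩ := hv
      obtain ⟨t', h3, rfl⟩ := hx
      -- Any argument will do: the value serves only to show that the body is a meaningful source
      -- term.
      obtain ⟨L', x', i1, i2, i3, i4, i5⟩ := ih (h2 (denInhabited A).default) h3
      exact ⟨L', _, i1, i2, i3, ⟨_, i4, rfl⟩, i5.lam _⟩
  | appL u _ ih =>
    obtain ⟨_, _, _, _, h1, h2, _⟩ := hv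
    obtain ⟨t', u', h3, h4, rfl⟩ := hx
    obtain ⟨L', x', i1, i2, i3, i4, i5⟩ := ih h1 h3
    exact ⟨L', _, i1, i2, i3, ⟨_, _, i4, h4.mono i2, rfl⟩, i5.app (.refl _)⟩
  | appR u _ ih =>
    obtain ⟨_, _, _, _, h1, h2, _⟩ := hv
    obtain ⟨t', u', h3, h4, rfl⟩ := hx
    obtain ⟨L', x', i1, i2, i3, i4, i5⟩ := ih h2 h4
    exact ⟨L', _, i1, i2, i3, ⟨_, _, h3.mono i2, i4, rfl⟩, ((Run.refl _).app i5).mono (by omega)⟩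
  | pairL u _ ih =>
    obtain ⟨_, _, h1, h2, _⟩ := hv
    obtain ⟨t', u', h3, h4, rfl⟩ := hx
    obtain ⟨L', x', i1, i2, i3, i4, i5⟩ := ih h1 h3
    exact ⟨L', _, i1, i2, i3, ⟨_, _, i4, h4.mono i2, rfl⟩, i5.pair (.refl _)⟩
  | pairR u _ ih =>
    obtain ⟨_, _, h1, h2, _⟩ := hv
    obtain ⟨t', u', h3, h4, rfl⟩ := hx
    obtain ⟨L', x', i1, i2, i3, i4, i5⟩ := ih h2 h4
    exact ⟨L', _, i1, i2, i3, ⟨_, _, h3.mono i2, i4, rfl⟩, ((Run.refl _).pair i5).mono (by omega)⟩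
  | esubL p u _ ih =>
    obtain ⟨_, _, h1, h2, h2'⟩ := hv
    obtain ⟨t', u', h3, h4, rfl⟩ := hx
    obtain ⟨L', x', i1, i2, i3, i4, i5⟩ := ih h2' h3
    exact ⟨L', _, i1, i2, i3, ⟨_, _, i4, h4.mono i2, rfl⟩, i5.esubL _ _⟩
  | esubR p u _ ih =>
    obtain ⟨_, _, h1, h2, _⟩ := hv
    obtain ⟨t', u', h3, h4, rfl⟩ := hx
    obtain ⟨L', x', i1, i2, i3, i4, i5⟩ := ih h1 h4
    exact ⟨L', _, i1, i2, i3, ⟨_, _, h3.mono i2, i4, rfl⟩, i5.esubR _ _⟩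
  | addL u _ ih =>
    obtain ⟨_, _, h1, h2, _⟩ := hv
    obtain ⟨t', u', h3, h4, rfl⟩ := hx
    obtain ⟨L', x', i1, i2, i3, i4, i5⟩ := ih h1 h3
    exact ⟨L', _, i1, i2, i3, ⟨_, _, i4, h4.mono i2, rfl⟩, ((i5.wk _ _).esubR _ _).esubL _ _⟩
  | addR u _ ih =>
    obtain ⟨_, _, h1, h2, _⟩ := hv
    obtain ⟨t', u', h3, h4, rfl⟩ := hx
    obtain ⟨L', x', i1, i2, i3, i4, i5⟩ := ih h2 h4
    refine ⟨L', _, i1, i2, i3, ⟨_, _, h3.mono i2, i4, rfl⟩, ?_⟩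
    exact (i5.wk _ _).esubR _ _
  | fn f ts i _ ih =>
    obtain ⟨_, _, h1, _⟩ := hv
    obtain ⟨ts', h3, rfl⟩ := hx
    obtain ⟨L', x', i1, i2, i3, i4, i5⟩ := ih (h1 i) (h3 i)
    refine ⟨L', _, i1, i2, i3, ⟨Function.update ts' i x', fun j => ?_, rfl⟩, ?_⟩
    · by_cases hj : j = i
      · subst hj; simpa using i4
      · simpa [hj] using (h3 j).mono i2
    · have := Run.letMany_args (revPat d) (u := ts') (u' := Function.update ts' i x')
        (n := fun j => if j = i then nodeCost B else 0) (fun j => by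
          by_cases hj : j = i
          · subst hj; simpa using i5
          · simpa [hj] using Run.refl _) (fnBody d f)
      simpa using this

/-- The list starts with the constant zero backpropagator, which the transform attaches to every
numeral of `t`; hence the bound `m + 1` on its final length. -/
theorem Rv.sim_steps {d B : ℕ} (hB : ∀ f ∈ S.F, S.ar f ≤ B) {t : Tm S} {e : ℕ → DVal} {v : DVal} (hv : Ev t e v)
    {m : ℕ} {t' : Tm S} (h : Steps Beta m t t') : Ev t' e v ∧
    ∃ L x, Leaves d B L ∧ L.length ≤ m + 1 ∧ Rv d L t' x ∧ Run (m * nodeCost B) (t.rev d) x := by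
  induction h with
  | refl t => exact ⟨hv, _, _, .base, by simp, Rv.rev (by simp) t, by simpa using Run.refl _⟩
  | step _ q ih =>
    obtain ⟨h1, L, x, h2, h3, h4, h5⟩ := ih hv
    obtain ⟨L', x', i1, i2, i3, i4, i5⟩ := h4.sim hB h2 q h1
    exact ⟨h1.beta q, L', x', i1, by omega, i4, (h5.trans i5).mono (by rw [Nat.succ_mul])⟩

end LSC
end

noncomputable section

namespace LSC

variable {S : Sig}

/-! # Linear combinations of backpropagators -/

/-- The names of the backpropagators in a linear combination: variables, or closed terms. -/
abbrev Lbl (S : Sig) := ℕ ⊕ Tm S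

/-- A backpropagator applied to a numeral. -/
def atom (d : ℕ) : Lbl S → ℝ → Tm S
  | .inl i, c => .app (.var (.exp (.dual d)) i) (.num c)
  | .inr W, c => tok d W c

/-- Multiplication of the coefficients of a linear combination by a scalar. -/
def scale (c : ℝ) (l : List (Lbl S × ℝ)) : List (Lbl S × ℝ) := l.map fun p => (p.1, c * p.2)

/-- The term denoted by a linear combination. -/
def comb (d : ℕ) (l : List (Lbl S × ℝ)) : Tm S := Tm.sum d (l.map fun p => atom d p.1 p.2)

/-- The value of a linear combination of variables; the closed terms count as zero. -/
def lsem {E : Type*} [AddCommGroup E] [Module ℝ E] (w : ℕ → E) (l : List (Lbl S × ℝ)) : E :=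
  (l.map fun p => p.2 • Sum.elim w (fun _ => 0) p.1).sum

/-- The closed terms of the linear combination belong to `L`. -/
def TokIn (L : List (Tm S)) (l : List (Lbl S × ℝ)) : Prop := ∀ p ∈ l, ∀ W, p.1 = .inr W → W ∈ L

theorem scale_scale (c c' : ℝ) (l : List (Lbl S × ℝ)) : scale c (scale c' l) = scale (c * c') l := by
  simp [scale, mul_assoc]

theorem scale_one (l : List (Lbl S × ℝ)) : scale 1 l = l := by simp [scale]

theorem scale_append (c : ℝ) (l l' : List (Lbl S × ℝ)) : scale c (l ++ l') = scale c l ++ scale c l' := by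
  simp [scale]

@[simp] theorem scale_length (c : ℝ) (l : List (Lbl S × ℝ)) : (scale c l).length = l.length := by simp [scale]

theorem scale_keys (c : ℝ) (l : List (Lbl S × ℝ)) : (scale c l).map Prod.fst = l.map Prod.fst := by
  simp [scale]

theorem tokIn_iff {L : List (Tm S)} {l : List (Lbl S × ℝ)} :
    TokIn L l ↔ ∀ W, .inr W ∈ l.map Prod.fst → W ∈ L := by
  simp only [TokIn, List.mem_map]
  constructor
  · rintro h W ⟨p, hp, hW⟩; exact h p hp W hW
  · intro h p hp W hW; exact h W ⟨p, hp, hW⟩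

theorem lsem_scale {E : Type*} [AddCommGroup E] [Module ℝ E] (w : ℕ → E) (c : ℝ) (l : List (Lbl S × ℝ)) :
    lsem w (scale c l) = c • lsem w l := by
  simp [lsem, scale, List.smul_sum, Function.comp_def, mul_smul]

theorem lsem_append {E : Type*} [AddCommGroup E] [Module ℝ E] (w : ℕ → E) (l l' : List (Lbl S × ℝ)) :
    lsem w (l ++ l') = lsem w l + lsem w l' := by
  simp [lsem]

theorem lsem_cons {E : Type*} [AddCommGroup E] [Module ℝ E] (w : ℕ → E) (p : Lbl S × ℝ) (l : List (Lbl S × ℝ)) :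
    lsem w (p :: l) = p.2 • Sum.elim w (fun _ => 0) p.1 + lsem w l := by
  simp [lsem]

theorem lsem_perm {E : Type*} [AddCommGroup E] [Module ℝ E] (w : ℕ → E) {l l' : List (Lbl S × ℝ)}
    (h : l.Perm l') : lsem w l = lsem w l' := (h.map _).sum_eq

theorem lsem_flatMap {E : Type*} [AddCommGroup E] [Module ℝ E] (w : ℕ → E) {ι : Type*} (is : List ι)
    (l : ι → List (Lbl S × ℝ)) : lsem w (is.flatMap l) = (is.map fun i => lsem w (l i)).sum := by
  induction is with
  | nil => simp [lsem]
  | cons i is ih => simp [List.flatMap_cons, lsem_append, ih]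

theorem HasTy.zero_none (Γ : List Ann) (d : ℕ) : HasTy Γ none (.zero d : Tm S) (.pow d) := by
  induction d with
  | zero => exact .num
  | succ d ih => exact .pair (fun h => absurd rfl h) .num ih

theorem DTy.add {d : ℕ} {t u : Tm S} (h : DTy d t (.pow d)) (h' : DTy d u (.pow d)) :
    DTy d (.add t u) (.pow d) := by
  obtain ⟨N, h⟩ := h
  obtain ⟨M, h'⟩ := h'
  exact ⟨max N M, .add (h.mono (le_max_left _ _)) (h'.mono (le_max_right _ _))⟩

theorem DTy.sum {d : ℕ} {l : List (Tm S)} (h : ∀ t ∈ l, DTy d t (.pow d)) : DTy d (Tm.sum d l) (.pow d) := by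
  match l with
  | [] => exact ⟨0, HasTy.zero_none _ _⟩
  | [t] => exact h t (by simp)
  | t :: u :: l => exact .add (h t (by simp)) (DTy.sum fun v hv => h v (by simp_all))

theorem DTy.atom {d : ℕ} (x : Lbl S) (c : ℝ) (h : ∀ W, x = .inr W → DTy d W (.dual d)) :
    DTy d (LSC.atom d x c) (.pow d) := by
  match x with
  | .inl i => exact (DTy.var d i).app_num c
  | .inr W => exact (h W rfl).tok c

theorem Leaves.comb_dTy {d B : ℕ} {L : List (Tm S)} (hL : Leaves d B L) {l : List (Lbl S × ℝ)} (h : TokIn L l) :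
    ∀ t ∈ l.map (fun p => atom d p.1 p.2), DTy d t (.pow d) := by
  intro t ht
  obtain ⟨p, hp, rfl⟩ := List.mem_map.1 ht
  exact .atom _ _ fun W hW => hL.dTy W (h p hp W hW)

theorem comb_cons {d B : ℕ} {L : List (Tm S)} (hL : Leaves d B L) {p : Lbl S × ℝ} {l : List (Lbl S × ℝ)}
    (h : TokIn L (p :: l)) : NEq (comb d (p :: l)) (.add (atom d p.1 p.2) (comb d l)) :=
  NEq.sum_cons (hL.comb_dTy h _ (by simp)) _

theorem comb_append {d B : ℕ} {L : List (Tm S)} (hL : Leaves d B L) {l l' : List (Lbl S × ℝ)}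
    (h : TokIn L l) (h' : TokIn L l') : NEq (.add (comb d l) (comb d l')) (comb d (l ++ l')) := by
  rw [comb, comb, comb, List.map_append]
  exact NEq.sum_append (hL.comb_dTy h) (hL.comb_dTy h')

theorem comb_perm {d B : ℕ} {L : List (Tm S)} (hL : Leaves d B L) {l l' : List (Lbl S × ℝ)} (hp : l.Perm l')
    (h : TokIn L l) : NEq (comb d l) (comb d l') :=
  NEq.sum_perm (hp.map _) (hL.comb_dTy h)

theorem comb_flatMap {d B : ℕ} {L : List (Tm S)} (hL : Leaves d B L) {ι : Type*} (is : List ι)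
    {l : ι → List (Lbl S × ℝ)} (h : ∀ i ∈ is, TokIn L (l i)) :
    NEq (Tm.sum d (is.map fun i => comb d (l i))) (comb d (is.flatMap l)) := by
  induction is with
  | nil => exact .refl _
  | cons i is ih =>
    have h1 : TokIn L (is.flatMap l) := fun p hp => by
      obtain ⟨j, hj, hp⟩ := List.mem_flatMap.1 hp
      exact h j (by simp [hj]) p hp
    exact (NEq.sum_cons (DTy.sum (hL.comb_dTy (h i (by simp)))) _).trans
      (((NEq.refl _).add (ih fun j hj => h j (by simp [hj]))).trans (comb_append hL (h i (by simp)) h1))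

/-- For a variable factoring applies directly; a closed backpropagator is first shared under one
name. -/
theorem Run.atom_add {d B : ℕ} {L : List (Tm S)} (hL : Leaves d B L) (x : Lbl S) (hx : ∀ W, x = .inr W → W ∈ L)
    (c c' : ℝ) : Run 2 (.add (LSC.atom d x c) (LSC.atom d x c')) (LSC.atom d x (c + c')) := by
  match x with
  | .inl i => exact (Run.factor d i _ _).trans ((Run.refl _).app (Run.add_num c c'))
  | .inr W => exact Run.tok_add (hL.closed W (hx W rfl)) c c'

theorem TokIn.scale {L : List (Tm S)} {l : List (Lbl S × ℝ)} (h : TokIn L l) (c : ℝ) : TokIn L (scale c l) := by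
  rw [tokIn_iff, scale_keys, ← tokIn_iff]; exact h

/-- Linear combinations can be normalized so that every backpropagator occurs at most once. -/
theorem comb_normalize {d B : ℕ} {L : List (Tm S)} (hL : Leaves d B L) (l : List (Lbl S × ℝ)) (h : TokIn L l) :
    ∃ (l' : List (Lbl S × ℝ)) (n : ℕ), (l'.map Prod.fst).Nodup ∧ n + 2 * l'.length = 2 * l.length ∧
      (∀ x ∈ l'.map Prod.fst, x ∈ l.map Prod.fst) ∧
      (∀ {E : Type} [AddCommGroup E] [Module ℝ E] (w : ℕ → E), lsem w l' = lsem w l) ∧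
      -- The merges depend on the names alone, so a single normal form and a single count serve for
      -- all scalar multiples.
      ∀ c, Run n (comb d (scale c l)) (comb d (scale c l')) := by
  induction l with
  | nil => exact ⟨[], 0, by simp, by simp, by simp, fun _ => rfl, fun c => .refl _⟩
  | cons p l ih =>
    obtain ⟨x, a⟩ := p
    have h' : TokIn L l := fun q hq => h q (by simp [hq])
    obtain ⟨l', n, h1, h2, h3, h4, h5⟩ := ih h'
    have ht' : TokIn L l' := tokIn_iff.2 fun W hW => tokIn_iff.1 h' W (h3 _ hW)
    have hx : ∀ W, x = .inr W → W ∈ L := h (x, a) (by simp)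
    have hcons : ∀ c, Run n (comb d (scale c ((x, a) :: l))) (.add (atom d x (c * a)) (comb d (scale c l'))) := by
      intro c
      refine (comb_cons hL (h.scale c)).trans_run ?_
      exact ((Run.refl _).add (h5 c)).mono (by omega)
    -- If the new name is already present, its two calls are merged: two steps and one entry fewer,
    -- which keeps the sum of the steps and twice the length constant.
    by_cases hk : x ∈ l'.map Prod.fst
    · obtain ⟨q, hq, rfl⟩ := List.mem_map.1 hk
      obtain ⟨l₁, l₂, rfl⟩ := List.append_of_mem hq
      have hp : (l₁ ++ q :: l₂).Perm (q :: (l₁ ++ l₂)) := List.perm_middle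
      have hk := (hp.map Prod.fst).nodup_iff.1 h1
      refine ⟨(q.1, a + q.2) :: (l₁ ++ l₂), n + 2, by simpa using hk, by simp at h2 ⊢; omega, ?_, ?_, ?_⟩
      · intro y hy
        have hy' : y ∈ (q :: (l₁ ++ l₂)).map Prod.fst := by simpa using hy
        have := h3 y ((hp.map Prod.fst).mem_iff.2 hy')
        simp at this ⊢; exact .inr this
      · intro E _ _ w
        rw [lsem_cons, lsem_cons, ← h4 w, lsem_perm w hp, lsem_cons]
        simp only [add_smul, add_assoc]
      · intro c
        have ht2 : TokIn L (q :: (l₁ ++ l₂)) := fun r hr => ht' r (hp.mem_iff.2 hr)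
        have ht3 : TokIn L ((q.1, a + q.2) :: (l₁ ++ l₂)) := by
          rw [tokIn_iff] at ht2 ⊢; simpa using ht2
        have e1 := (comb_perm hL (l' := scale c (q :: (l₁ ++ l₂))) (hp.map _) (ht'.scale c)).trans
          (comb_cons hL (p := (q.1, c * q.2)) (l := scale c (l₁ ++ l₂)) (ht2.scale c))
        refine ((hcons c).trans_neq (((NEq.refl _).add e1).trans (NEq.add_assoc _ _ _).symm)).trans ?_
        refine (((Run.atom_add hL q.1 hx _ _).add (Run.refl _)).mono (by omega)).trans_neq ?_
        rw [← mul_add]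
        exact (comb_cons hL (p := (q.1, c * (a + q.2))) (l := scale c (l₁ ++ l₂)) (ht3.scale c)).symm
    · have ht : TokIn L ((x, a) :: l') := fun q hq => by
        rcases List.mem_cons.1 hq with rfl | hq
        · exact hx
        · exact ht' q hq
      refine ⟨(x, a) :: l', n, by simpa using ⟨by simpa using hk, h1⟩, by simp; omega, ?_, ?_, ?_⟩
      · intro y hy
        rcases List.mem_cons.1 hy with rfl | hy
        · simp
        · exact List.mem_cons_of_mem _ (h3 y hy)
      · intro E _ _ w
        rw [lsem_cons, lsem_cons, h4 w]
      · intro c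
        exact (hcons c).trans_neq (comb_cons hL (p := (x, c * a)) (l := scale c l') (ht.scale c)).symm

/-- Removal of the variable of index `0` from a linear combination that does not use it. -/
def lower (l : List (Lbl S × ℝ)) : List (Lbl S × ℝ) := l.map fun p => (Sum.map Nat.pred id p.1, p.2)

theorem comb_lower {d B : ℕ} {L : List (Tm S)} (hL : Leaves d B L) {l : List (Lbl S × ℝ)} (h : TokIn L l)
    (h0 : .inl 0 ∉ l.map Prod.fst) : (comb d (lower l)).wk 0 1 = comb d l := by
  simp only [comb, Tm.wk, sum_rename, lower, List.map_map]
  congr 1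
  refine List.map_congr_left fun p hp => ?_
  obtain ⟨x, c⟩ := p
  match x with
  | .inl 0 => exact absurd (List.mem_map.2 ⟨_, hp, rfl⟩) h0
  | .inl (i + 1) => rfl
  | .inr W =>
    simp only [Function.comp_apply, Sum.map_inr, id, atom, tok_rename]
    rw [hL.closed W (h _ hp W rfl)]

theorem lsem_lower {E : Type*} [AddCommGroup E] [Module ℝ E] (w w' : ℕ → E) (hw : ∀ i, w' (i + 1) = w i)
    {l : List (Lbl S × ℝ)} (h0 : .inl 0 ∉ l.map Prod.fst) : lsem w (lower l) = lsem w' l := by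
  simp only [lsem, lower, List.map_map]
  congr 1
  refine List.map_congr_left fun p hp => ?_
  obtain ⟨x, c⟩ := p
  match x with
  | .inl 0 => exact absurd (List.mem_map.2 ⟨_, hp, rfl⟩) h0
  | .inl (i + 1) => simp [hw]
  | .inr W => simp

theorem TokIn.lower {L : List (Tm S)} {l : List (Lbl S × ℝ)} (h : TokIn L l) : TokIn L (lower l) := by
  intro p hp W hW
  obtain ⟨⟨x, c⟩, hq, rfl⟩ := List.mem_map.1 hp
  match x, hW with
  | .inr V, hW => exact h _ hq W (by simpa using hW)

theorem scale_lower (c : ℝ) (l : List (Lbl S × ℝ)) : scale c (lower l) = lower (scale c l) := by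
  simp [scale, lower]

/-- A call unfolds into at most `B` calls of members of `L`, and no variable appears since all of
them are closed. -/
theorem Leaves.app {d B : ℕ} {L : List (Tm S)} (hL : Leaves d B L) {W : Tm S} (hW : W ∈ L) :
    ∃ l : List (Lbl S × ℝ), l.length ≤ B ∧ TokIn L l ∧ (∀ i, .inl i ∉ l.map Prod.fst) ∧
      ∀ c, Run (4 + B) (.app W (.num c)) (comb d (scale c l)) := by
  induction hL generalizing W with
  | base =>
    obtain rfl := List.mem_singleton.1 hW
    refine ⟨[], by simp, by simp [TokIn], by simp, fun c => ?_⟩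
    have := Run.linBeta (.zero d : Tm S) (.num c)
    rw [Tm.inst, zero_subst] at this
    exact this.mono (by omega)
  | @node L k W' arg c hL hk h1 h2 ih =>
    rcases List.mem_cons.1 hW with rfl | hW
    · refine ⟨List.ofFn fun i => (.inr (W' i), c i), by simpa using hk, ?_, by simp [List.mem_ofFn], fun x => ?_⟩
      · intro p hp V hV
        obtain ⟨i, rfl⟩ := List.mem_ofFn.1 hp
        cases hV
        exact List.mem_cons_of_mem _ (h1 i)
      · have := Run.node_app h2 (fun i => hL.dTy _ (h1 i)) x
        rw [scale, comb, ofFn_fold, ofFn_fold]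
        exact this.mono (by omega)
    · obtain ⟨l, i1, i2, i3, i4⟩ := ih hW
      exact ⟨l, i1, fun p hp V hV => List.mem_cons_of_mem _ (i2 p hp V hV), i3, i4⟩

end LSC
end

noncomputable section

namespace LSC

variable {S : Sig}

/-! # Backpropagation in ground terms -/

/-- The substitution of real variables by numerals together with eta-expanded backpropagators. -/
def dualSubst (d : ℕ) (ρ : ℕ → ℝ) (_ : Ann) (i : ℕ) : Tm S :=
  .pair (.num (ρ i)) (.lam .lin (.app (.var (.exp (.dual d)) (i + 1)) (.var .lin 0)))

/-- The term `u` evaluates in `n` steps to the numeral `x` together with the backpropagator `W`, and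
`W` evaluates in `m` steps to the linear combination `l`. -/
structure Bp (d : ℕ) (L : List (Tm S)) (n m : ℕ) (u : Tm S) (x : ℝ) (W : Tm S) (l : List (Lbl S × ℝ)) : Prop where
  value : Value W
  dTy : DTy d W (.dual d)
  eval : Run n u (.pair (.num x) W)
  back : ∀ c, Run m (.app W (.num c)) (comb d (scale c l))
  tok : TokIn L l

/-- The chain rule for one operation: the combinations of the arguments are scaled by the partial
derivatives and concatenated. The cost of a call is that of the node, plus two steps per argument to
fetch its backpropagator from its name. -/
theorem Bp.op {d B : ℕ} {L : List (Tm S)} (hL : Leaves d B L) {k : ℕ} {n m : Fin k → ℕ} {u W : Fin k → Tm S}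
    {x : Fin k → ℝ} {l : Fin k → List (Lbl S × ℝ)} (h : ∀ i, Bp d L (n i) (m i) (u i) (x i) (W i) (l i))
    {b : Tm S} {arg : Fin k → Tm S} {c : Fin k → ℝ} (ha : ∀ i, IsArg (c i) (arg i)) {N : ℕ} {s : ℝ}
    (hr : Run N (letMany (revPat d) (List.ofFn fun i => .pair (.num (x i)) (W i)) b)
      (.pair (.num s) (node d W arg))) :
    Bp d L (∑ i, n i + N) (4 + k + ∑ i, (2 + m i)) (letMany (revPat d) (List.ofFn u) b) s (node d W arg)
      ((List.finRange k).flatMap fun i => scale (c i) (l i)) where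
  value := .lam _ _
  dTy := node_dTy ha fun i => (h i).dTy
  eval := (Run.letMany_args _ (fun i => (h i).eval) b).trans hr
  back := fun y => by
    refine (Run.node_app ha (fun i => (h i).dTy) y).trans ?_
    have h1 := Run.sum_map d (List.finRange k) (n := fun i => 2 + m i)
      (f := fun i => LSC.tok d (W i) (y * c i)) (g := fun i => comb d (scale (y * c i) (l i)))
      fun i _ => (Run.tok (h i).value _).trans ((h i).back _)
    simp only [← List.ofFn_eq_map, List.sum_ofFn] at h1
    refine h1.trans_neq ?_
    have h2 := comb_flatMap hL (List.finRange k) (l := fun i => scale (y * c i) (l i))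
      fun i _ => (h i).tok.scale _
    simp only [← List.ofFn_eq_map] at h2
    have e : scale y ((List.finRange k).flatMap fun i => scale (c i) (l i)) =
        (List.finRange k).flatMap fun i => scale (y * c i) (l i) := by
      rw [scale, List.map_flatMap]
      congr 1; funext i; exact scale_scale _ _ _
    rw [e]; exact h2
  tok := fun p hp => by
    obtain ⟨i, _, hp⟩ := List.mem_flatMap.1 hp
    exact (h i).tok.scale _ p hp

/-- The backpropagator `W` must not be copied to the occurrences of the bound variable. The eta-rule
for pairs names its components `y` and `y*`; the value `⟨y, λa. y* a⟩` is copied, then the numeral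
is substituted for `y`, while `W` stays in a substitution for `y*`. Each occurrence thus costs two
steps. The other six are the three eta-expansions, the splitting of the pair and two erasures. -/
theorem Run.let_dual {d : ℕ} {t u W V : Tm S} {ρ : ℕ → ℝ} {x y : ℝ} {n n' : ℕ} (hu : Run n u (.pair (.num x) W))
    (hW : DTy d W (.dual d)) (ht : Run n' (t.subst (dualSubst d (rcons x ρ))) (.pair (.num y) V))
    (hV : DTy d V (.dual d)) (hb : t.occ (badWeight (Ty.rev d .R) 1 0) = 0) :
    Run (n + n' + 2 * t.occ (blockWeight 1 0) + 6)
      (.esub (.one (.exp (Ty.rev d .R))) (t.subst (upS 1 (dualSubst d ρ))) u)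
      (.pair (.num y) (.lam .lin (.app ((Tm.esub (dualPat d) V W).wk 0 1) (.var .lin 0)))) := by
  -- Here `t₁` is the body after eta-expansion of the pair, `v` is the value copied into it, and `τ`
  -- describes the result before `y` becomes a numeral.
  let v : Tm S := .pair (.var (.exp .R) 0) (.lam .lin (.app (.var (.exp (.dual d)) 2) (.var .lin 0)))
  let τ : Ann → ℕ → Tm S := fun _ i =>
    if i = 0 then v else .pair (.num (ρ (i - 1))) (.lam .lin (.app (.var (.exp (.dual d)) (i + 2)) (.var .lin 0)))
  let t₁ : Tm S := (t.subst (upS 1 (dualSubst d ρ))).wk 1 2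
  have e1 : t₁.inst v = t.subst τ := by
    simp only [t₁, Tm.inst, Tm.wk, rename_subst, subst_subst]
    congr 1; funext a i
    rcases i with _ | i
    · simp [upS, Tm.subst, τ]
    · simp [upS, Tm.subst, τ, dualSubst, Tm.wk, Tm.rename, up]
  have e2 : (t.subst τ).inst (.num x) = t.subst (dualSubst d (rcons x ρ)) := by
    simp only [Tm.inst, subst_subst]
    congr 1; funext a i
    rcases i with _ | i
    · simp [τ, v, Tm.subst, upS, dualSubst, rcons, Tm.wk, Tm.rename]
    · simp [τ, Tm.subst, upS, dualSubst, rcons, Tm.wk, Tm.rename]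
  have e3 : ∀ w : Ann → ℕ → ℕ, (∀ a i, 1 ≤ i → w a i = 0) → t₁.occ w = t.occ (fun a i => if i = 0 then w a 0 else 0) := by
    intro w hw
    simp only [t₁, Tm.wk, occ_rename, occ_subst]
    congr 1; funext a i
    rcases i with _ | i
    · simp [upS, Tm.occ]
    · simp [upS, Tm.occ, dualSubst, Tm.wk, Tm.rename, up, hw]
  have e4 : ∀ w : Ann → ℕ → ℕ, (∀ a i, 1 ≤ i → w a i = 0) →
      (t.subst τ).occ w = t.occ (fun _ i => if i = 0 then w (.exp .R) 0 else 0) := by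
    intro w hw
    simp only [occ_subst]
    congr 1; funext a i
    rcases i with _ | i
    · simp [τ, v, Tm.occ, hw]
    · simp [τ, Tm.occ, hw]
  have h1 : Run (0 + 1 + (t₁.occ (blockWeight 1 0) + 1)) (.esub (.one (.exp (Ty.rev d .R))) t₁ (.pair (.var (.exp .R) 0) (.var (.exp (.dual d)) 1)))
      (t.subst τ) := by
    rw [← e1]
    exact (((Run.refl _).pair (Run.etaDual (DTy.var d 1))).esubR _ _).trans
      (Run.inst (Ty.rev d .R) t₁ (.pair (.var _ _) (.lam _ _)) (by
        rw [e3 _ fun a i hi => by simp [badWeight]; omega]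
        exact occ_eq_zero_mono hb fun a i hi => by
          by_cases h0 : i = 0
          · subst h0; simpa using hi
          · simp [h0]))
  have h2 := Run.inst .R (t.subst τ) (.num x) (by
    rw [e4 _ fun a i hi => by simp [badWeight]; omega]
    simp [badWeight, occ_zero])
  have h3 := ((Run.etaPair .R (.dual d) (t.subst (upS 1 (dualSubst d ρ))) (.num x) W).trans (h1.esubL _ _)).trans
    ((Run.split _ _ _ _ _).trans (h2.esubL _ _))
  rw [e2] at h3
  have h4 := ((hu.esubR (.one (.exp (Ty.rev d .R))) (t.subst (upS 1 (dualSubst d ρ)))).trans h3).trans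
    ((ht.esubL _ _).trans_neq (NEq.opR .pair (dualPat d) (.num y) V W))
  refine (h4.trans ((Run.refl _).pair (Run.etaDual (hV.esub hW)))).mono ?_
  have e5 : ∀ w : Ann → ℕ → ℕ, (∀ a i, w a i = blockWeight 1 0 a i) → t.occ w = t.occ (blockWeight 1 0) := by
    intro w hw; congr 1; funext a i; exact hw a i
  rw [e3 _ fun a i hi => by simp [blockWeight]; omega, e4 _ fun a i hi => by simp [blockWeight]; omega,
    e5 (fun a i => if i = 0 then blockWeight 1 0 a 0 else 0) fun a i => by
      simp only [blockWeight]; split_ifs <;> omega,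
    e5 (fun _ i => if i = 0 then blockWeight 1 0 (.exp .R) 0 else 0) fun a i => by
      simp only [blockWeight]; split_ifs <;> omega]
  omega

/-- The combination of the body is normalized first, so that the bound tangent variable occurs at
most once and `W` is called at most once. The normalization is paid for by the drop in length, which
is why the length is counted twice on both sides of the bound. -/
theorem Bp.let_dual {d B : ℕ} {L : List (Tm S)} (hL : Leaves d B L) {t u W V : Tm S} {ρ : ℕ → ℝ} {x y : ℝ}
    {n m n' m' : ℕ} {l l' : List (Lbl S × ℝ)} (hu : Bp d L n m u x W l)
    (ht : Bp d L n' m' (t.subst (dualSubst d (rcons x ρ))) y V l')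
    (hb : t.occ (badWeight (Ty.rev d .R) 1 0) = 0) :
    ∃ (Z : Tm S) (l'' : List (Lbl S × ℝ)) (N M : ℕ),
      Bp d L N M (.esub (.one (.exp (Ty.rev d .R))) (t.subst (upS 1 (dualSubst d ρ))) u) y Z l'' ∧
      N + M + 2 * l''.length ≤ (n + m + 2 * l.length) + (n' + m' + 2 * l'.length) +
        2 * t.occ (blockWeight 1 0) + 12 ∧
      (∀ i, .inl i ∈ l''.map Prod.fst → .inl i ∈ l.map Prod.fst ∨ .inl (i + 1) ∈ l'.map Prod.fst) ∧
      ∀ {E : Type} [AddCommGroup E] [Module ℝ E] (w w' : ℕ → E), w' 0 = lsem w l → (∀ i, w' (i + 1) = w i) →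
        lsem w l'' = lsem w' l' := by
  have hV := ht.dTy
  have hE : DTy d (.esub (dualPat d) V W) (.dual d) := hV.esub hu.dTy
  have heval := Run.let_dual hu.eval hu.dTy ht.eval hV hb
  obtain ⟨l₁, k, i1, i2, i3, i4, i5⟩ := comb_normalize hL l' ht.tok
  have ht1 : TokIn L l₁ := tokIn_iff.2 fun W hW => tokIn_iff.1 ht.tok W (i3 _ hW)
  have hback : ∀ c, Run (2 + m' + k) (.app (.lam .lin (.app ((Tm.esub (dualPat d) V W).wk 0 1) (.var .lin 0)))
      (.num c)) (.esub (dualPat d) (comb d (scale c l₁)) W) := by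
    intro c
    have h1 := (Run.etaApp (.esub (dualPat d) V W) (.num c)).trans_neq
      (NEq.opL .app (dualPat d) V (.num c) W).symm
    exact (h1.trans (((ht.back c).trans (i5 c)).esubL _ _)).mono (by omega)
  have hlow : ∀ (l : List (Lbl S × ℝ)) (i : ℕ), .inl 0 ∉ l.map Prod.fst →
      (.inl i : Lbl S) ∈ (lower l).map Prod.fst → .inl (i + 1) ∈ l.map Prod.fst := by
    intro l i h0 hi
    simp only [lower, List.map_map, List.mem_map] at hi
    obtain ⟨⟨z, a⟩, hz, hi⟩ := hi
    match z, hi with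
    | .inl 0, _ => exact absurd (List.mem_map.2 ⟨_, hz, rfl⟩) h0
    | .inl (j + 1), hi =>
      cases hi
      exact List.mem_map.2 ⟨_, hz, rfl⟩
  -- Either the bound tangent variable has one coefficient `a`, and the combination of `u` enters
  -- scaled by `a`, or it is absent and its substitution is erased.
  by_cases h0 : .inl 0 ∈ l₁.map Prod.fst
  · obtain ⟨⟨_, a⟩, hq, rfl⟩ := List.mem_map.1 h0
    obtain ⟨s₁, s₂, rfl⟩ := List.append_of_mem hq
    have hp : (s₁ ++ (.inl 0, a) :: s₂).Perm ((.inl 0, a) :: (s₁ ++ s₂)) := List.perm_middle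
    have hk := (hp.map Prod.fst).nodup_iff.1 i1
    set l₂ := s₁ ++ s₂
    have h02 : .inl 0 ∉ l₂.map Prod.fst := (List.nodup_cons.1 hk).1
    have ht2 : TokIn L ((.inl 0, a) :: l₂) := fun q hq => ht1 q (hp.mem_iff.2 hq)
    have ht3 : TokIn L l₂ := fun q hq => ht2 q (by simp [hq])
    have hlen := hp.length_eq
    rw [hlen, List.length_cons] at i2
    refine ⟨_, scale a l ++ lower l₂, _, 2 + m' + k + (2 + m), ⟨.lam _ _, hE.etaExpand, heval, fun c => ?_, ?_⟩, ?_, ?_, ?_⟩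
    · refine (hback c).trans ?_
      have e1 := (comb_perm hL (l' := scale c ((.inl 0, a) :: l₂)) (hp.map _) (ht1.scale c)).trans
        (comb_cons hL (p := (.inl 0, c * a)) (l := scale c l₂) (ht2.scale c))
      have h02' : .inl 0 ∉ (scale c l₂).map Prod.fst := by rwa [scale_keys]
      rw [← comb_lower hL (ht3.scale c) h02'] at e1
      refine ((e1.esubL _ _).trans (NEq.opL .add (dualPat d) _ _ _)).trans_run ?_
      have h2 : Run (2 + m) (.esub (dualPat d) (atom d (.inl 0) (c * a)) W) (comb d (scale (c * a) l)) :=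
        (Run.tok hu.value _).trans (hu.back _)
      refine ((h2.add (Run.refl _)).mono (by omega)).trans_neq ?_
      rw [scale_append c (scale a l), scale_scale, scale_lower]
      exact comb_append hL (hu.tok.scale _) (ht3.scale c).lower
    · intro p hp
      rcases List.mem_append.1 hp with hp | hp
      · exact hu.tok.scale _ p hp
      · exact ht3.lower p hp
    · have : (lower l₂).length = l₂.length := by simp [lower]
      simp only [List.length_append, scale_length, this]; omega
    · intro i hi
      rw [List.map_append, List.mem_append, scale_keys] at hi
      refine hi.imp id fun hi => i3 _ ((hp.map Prod.fst).mem_iff.2 ?_)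
      exact List.mem_cons_of_mem _ (hlow _ _ h02 hi)
    · intro E _ _ w w' hw0 hw
      rw [lsem_append, lsem_scale, lsem_lower w w' hw h02, ← i4 w', lsem_perm w' hp, lsem_cons]
      simp [hw0]
  · refine ⟨_, lower l₁, _, 2 + m' + k + 1, ⟨.lam _ _, hE.etaExpand, heval, fun c => ?_, ht1.lower⟩, ?_, ?_, ?_⟩
    · refine (hback c).trans ?_
      have h02' : .inl 0 ∉ (scale c l₁).map Prod.fst := by rwa [scale_keys]
      rw [← comb_lower hL (ht1.scale c) h02', scale_lower]
      exact Run.gc _ _ hu.value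
    · have : (lower l₁).length = l₁.length := by simp [lower]
      rw [this]; omega
    · exact fun i hi => .inr (i3 _ (hlow _ _ h0 hi))
    · intro E _ _ w w' _ hw
      rw [lsem_lower w w' hw h0, i4 w']

/-- The transform keeps every variable occurrence, and all that it adds is closed or refers to its
own bound variables. Counts in the transform can therefore be charged to the source term. -/
theorem Rv.occ {d : ℕ} {L : List (Tm S)} (hL : ∀ W ∈ L, HasTy [] none W (.dual d)) {t x : Tm S} (h : Rv d L t x)
    (hs : Src t) (w : Ann → ℕ → ℕ) : x.occ w = t.occ (fun a i => w (a.rev d) i) := by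
  induction t generalizing x w with
  | var a i => subst h; rfl
  | num r => obtain ⟨W, h1, rfl⟩ := h; simp [Tm.occ, (hL W h1).occ_closed]
  | lam a t ih => obtain ⟨t', h1, rfl⟩ := h; exact ih h1 hs _
  | app t u ih ih' => obtain ⟨t', u', h1, h2, rfl⟩ := h; simp only [Tm.occ, ih h1 hs.1, ih' h2 hs.2]
  | pair t u ih ih' => obtain ⟨t', u', h1, h2, rfl⟩ := h; simp only [Tm.occ, ih h1 hs.1, ih' h2 hs.2]
  | esub p t u ih ih' => obtain ⟨t', u', h1, h2, rfl⟩ := h; simp only [Tm.occ, ih h1 hs.1, ih' h2 hs.2, rev_ar]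
  | add t u ih ih' =>
    obtain ⟨t', u', h1, h2, rfl⟩ := h
    simp [occ_letMany, addBody_occ, Tm.occ, ih h1 hs.1, ih' h2 hs.2, Pat.ar]
  | fn f ts ih =>
    obtain ⟨ts', h1, rfl⟩ := h
    rw [occ_letMany, List.map_ofFn, List.sum_ofFn, List.length_ofFn, fnBody_occ]
    simp only [Function.comp_apply, Tm.occ, ih _ (h1 _) (hs.2 _)]
    rw [Nat.add_eq_right, Nat.add_eq_zero_iff]
    constructor
    · refine Finset.sum_eq_zero fun j _ => if_pos ?_
      have := j.2; simp only [Pat.ar]; omega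
    · refine Finset.sum_eq_zero fun i _ => ?_
      rw [Nat.add_eq_zero_iff]
      constructor
      · refine if_pos ?_
        have := i.2; simp only [Pat.ar]; omega
      · refine Finset.sum_eq_zero fun j _ => if_pos ?_
        have := j.2; have := S.ar_pd f hs.1 i; simp only [Pat.ar]; omega

theorem Ground.src {G : Tm S} (hG : Ground G) : Src G := by
  induction hG with
  | var i => trivial
  | num r => trivial
  | esub _ _ ih ih' => exact ⟨ih, ih'⟩
  | fn hf _ ih => exact ⟨hf, ih⟩
  | add _ _ ih ih' => exact ⟨ih, ih'⟩

theorem Ground.occ_eq_zero {G : Tm S} (hG : Ground G) {w : Ann → ℕ → ℕ} (hw : ∀ i, w (.exp .R) i = 0) :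
    G.occ w = 0 := by
  induction hG generalizing w with
  | var i => exact hw i
  | num r => rfl
  | esub _ _ ih ih' =>
    rw [Tm.occ, ih' hw, ih]
    intro i; simp [hw]
  | fn hf _ ih => exact Finset.sum_eq_zero fun i _ => ih i hw
  | add _ _ ih ih' => rw [Tm.occ, ih hw, ih' hw]

end LSC
end

/-! ### Correctness and amortized cost of backpropagation. -/

noncomputable section

namespace LSC

variable {S : Sig}

/-- The factor by which the cost of backpropagation exceeds the size of the ground term. -/
def bpCost (B : ℕ) : ℕ := nodeCost B + 3 * B + 16

/-- Backpropagation in the ground term `G`, whose transformation is `x`, at the point `ρ`. -/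
def BpGround (d B : ℕ) (L : List (Tm S)) (G x : Tm S) (ρ : ℕ → ℝ) : Prop :=
  ∃ (n m : ℕ) (W : Tm S) (l : List (Lbl S × ℝ)), Bp d L n m (x.subst (dualSubst d ρ)) (gval G ρ) W l ∧
    (∀ N, G.occ (geWeight N) = 0 → ∀ i, .inl i ∈ l.map Prod.fst → i < N) ∧
    (∀ {E : Type} [NormedAddCommGroup E] [NormedSpace ℝ E] (p : E) (γ : ℕ → E → ℝ) (w : ℕ → E →L[ℝ] ℝ),
      (∀ i, γ i p = ρ i) → (∀ i, HasFDerivAt (γ i) (w i) p) →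
        HasFDerivAt (fun q => gval G fun i => γ i q) (lsem w l) p) ∧
    n + m + 2 * l.length + 2 * G.occ (fun _ _ => 1) ≤ bpCost B * G.size

theorem keys_flatMap_scale {k : ℕ} {c : Fin k → ℝ} {l : Fin k → List (Lbl S × ℝ)} {z : Lbl S}
    (h : z ∈ ((List.finRange k).flatMap fun i => scale (c i) (l i)).map Prod.fst) :
    ∃ i, z ∈ (l i).map Prod.fst := by
  rw [List.map_flatMap, List.mem_flatMap] at h
  obtain ⟨i, _, h⟩ := h
  rw [scale_keys] at h
  exact ⟨i, h⟩

theorem lsem_flatMap_scale {E : Type*} [AddCommGroup E] [Module ℝ E] (w : ℕ → E) {k : ℕ} (c : Fin k → ℝ)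
    (l : Fin k → List (Lbl S × ℝ)) :
    lsem w ((List.finRange k).flatMap fun i => scale (c i) (l i)) = ∑ i, c i • lsem w (l i) := by
  rw [lsem_flatMap, ← List.ofFn_eq_map, List.sum_ofFn]
  simp only [lsem_scale]

theorem length_flatMap_scale {k : ℕ} (c : Fin k → ℝ) (l : Fin k → List (Lbl S × ℝ)) :
    ((List.finRange k).flatMap fun i => scale (c i) (l i)).length = ∑ i, (l i).length := by
  rw [List.length_flatMap, ← List.ofFn_eq_map, List.sum_ofFn]
  simp only [scale_length]

/-- Copying a pair to the occurrences of the bound variable costs two steps for each. These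
occurrences cease to be free, so the summand `2 * G.occ (fun _ _ => 1)` of the invariant drops by
exactly that amount. -/
theorem BpGround.esub {d B : ℕ} {L : List (Tm S)} (hL : Leaves d B L) {F G x y : Tm S} {ρ : ℕ → ℝ}
    (hF : Ground F) (hx : Rv d L F x) (ih : BpGround d B L F x (rcons (gval G ρ) ρ))
    (ih' : BpGround d B L G y ρ) :
    BpGround d B L (.esub (.one (.exp .R)) F G) (.esub (.one (.exp (Ty.rev d .R))) x y) ρ := by
  obtain ⟨n', m', V, l', h1, h2, h3, h4⟩ := ih
  obtain ⟨n, m, W, l, i1, i2, i3, i4⟩ := ih'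
  have hocc := hx.occ (fun W hW => (hL.leaf hW).2) hF.src
  have hb : x.occ (badWeight (Ty.rev d .R) 1 0) = 0 := by
    rw [hocc]
    exact hF.occ_eq_zero fun i => by simp [badWeight, Ann.rev]
  obtain ⟨Z, l'', N, M, j1, j2, j3, j4⟩ := Bp.let_dual hL i1 h1 hb
  refine ⟨N, M, Z, l'', j1, ?_, ?_, ?_⟩
  · intro K hK i hi
    obtain ⟨hK1, hK2⟩ := Nat.add_eq_zero_iff.1 (show F.occ (fun a i => if i < 1 then 0 else geWeight K a (i - 1)) +
      G.occ (geWeight K) = 0 from hK)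
    rw [geWeight_up] at hK1
    rcases j3 i hi with hi | hi
    · exact i2 K hK2 i hi
    · have := h2 (K + 1) hK1 _ hi; omega
  · intro E _ _ p γ w hγ hw
    -- The differential of the bound variable is that of the term substituted for it.
    let w' : ℕ → E →L[ℝ] ℝ := fun i => Nat.casesOn i (lsem w l) w
    rw [j4 w w' rfl fun _ => rfl]
    have := h3 p (fun i q => rcons (gval G fun j => γ j q) (fun j => γ j q) i) w'
      (fun i => by
        rcases i with _ | i
        · simp only [rcons, hγ]
        · simp only [rcons, hγ])
      (fun i => by
        rcases i with _ | i
        · exact i3 p γ w hγ hw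
        · exact hw i)
    exact this
  · rw [hocc] at j2
    have e1 : F.occ (fun a i => blockWeight 1 0 (a.rev d) i) = F.occ (blockWeight 1 0) := rfl
    have e2 : F.occ (fun _ _ => 1) = F.occ (fun _ i => if i < 1 then 0 else 1) + F.occ (blockWeight 1 0) := by
      rw [← occ_add]
      congr 1; funext a i
      simp only [blockWeight]; split_ifs <;> omega
    show N + M + 2 * l''.length + 2 * (F.occ (fun _ i => if i < 1 then 0 else 1) + G.occ fun _ _ => 1) ≤
      bpCost B * (F.size + G.size + 1)
    have e3 : bpCost B * (F.size + G.size + 1) = bpCost B * F.size + bpCost B * G.size + bpCost B := by ring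
    rw [e1] at j2
    have : 12 ≤ bpCost B := by unfold bpCost; omega
    omega

/-- The new cost is at most `nodeCost B` for the value, and `4 + k` plus two per argument for the
backpropagator. This is covered by `bpCost B`, charged to the root symbol; lengths and occurrences
merely add up. -/
theorem BpGround.op {d B : ℕ} {L : List (Tm S)} (hL : Leaves d B L) {k : ℕ} (hk : k ≤ B) {G x : Fin k → Tm S} {ρ : ℕ → ℝ}
    (ih : ∀ i, BpGround d B L (G i) (x i) ρ) {b T : Tm S} (hb : ∀ σ, b.subst (upS (2 * k) σ) = b) {arg : Fin k → Tm S}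
    {c : Fin k → ℝ} (ha : ∀ i, IsArg (c i) (arg i))
    (hr : ∀ W : Fin k → Tm S, (∀ i, Value (W i)) → (∀ i, DTy d (W i) (.dual d)) →
      Run (nodeCost B) (letMany (revPat d) (List.ofFn fun i => .pair (.num (gval (G i) ρ)) (W i)) b)
      (.pair (.num (gval T ρ)) (node d W arg)))
    (hocc : ∀ w, T.occ w = ∑ i, (G i).occ w) (hsize : T.size = ∑ i, (G i).size + 1)
    (hder : ∀ {E : Type} [NormedAddCommGroup E] [NormedSpace ℝ E] (p : E) (γ : ℕ → E → ℝ) (D : Fin k → E →L[ℝ] ℝ),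
      (∀ i, γ i p = ρ i) → (∀ i, HasFDerivAt (fun q => gval (G i) fun i => γ i q) (D i) p) →
        HasFDerivAt (fun q => gval T fun i => γ i q) (∑ i, c i • D i) p) :
    BpGround d B L T (letMany (revPat d) (List.ofFn x) b) ρ := by
  choose n m W l h1 h2 h3 h4 using ih
  have h := Bp.op hL h1 ha (hr W (fun i => (h1 i).value) (fun i => (h1 i).dTy))
  have e : (letMany (revPat d) (List.ofFn x) b).subst (dualSubst d ρ) =
      letMany (revPat d) (List.ofFn fun i => (x i).subst (dualSubst d ρ)) b := by
    rw [letMany_subst, ofFn_fold, List.length_ofFn, show (revPat d).ar = 2 from rfl, hb]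
  rw [← e] at h
  refine ⟨_, _, _, _, h, ?_, ?_, ?_⟩
  · intro N hN i hi
    obtain ⟨j, hj⟩ := keys_flatMap_scale hi
    rw [hocc] at hN
    exact h2 j N ((Finset.sum_eq_zero_iff.1 hN) j (Finset.mem_univ j)) i hj
  · intro E _ _ p γ w hγ hw
    rw [lsem_flatMap_scale]
    exact hder p γ _ hγ fun i => h3 i p γ w hγ hw
  · rw [length_flatMap_scale, hocc, hsize, Nat.mul_succ]
    have h5 := Finset.sum_le_sum (s := Finset.univ) fun i _ => h4 i
    simp only [Finset.sum_add_distrib, ← Finset.mul_sum] at h5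
    simp only [Finset.sum_add_distrib, Finset.sum_const, Finset.card_univ, Fintype.card_fin, smul_eq_mul]
    have : bpCost B = nodeCost B + 3 * B + 16 := rfl
    omega

theorem body_subst {b : Tm S} {k : ℕ} (h : b.occ (geWeight k) = 0) (σ : Ann → ℕ → Tm S) :
    b.subst (upS k σ) = b := by
  conv_rhs => rw [← subst_var b]
  refine subst_congr h fun a i hi => ?_
  simp only [geWeight] at hi
  by_cases h : i < k
  · simp [upS, h]
  · simp [h] at hi

theorem Ground.backprop {d B : ℕ} (hB : ∀ f ∈ S.F, S.ar f ≤ B) {L : List (Tm S)} (hL : Leaves d B L) {G : Tm S}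
    (hG : Ground G) {x : Tm S} (hx : Rv d L G x) (ρ : ℕ → ℝ) : BpGround d B L G x ρ := by
  induction hG generalizing x ρ with
  | var i =>
    subst hx
    refine ⟨0, 2, _, [(.inl i, 1)], ⟨.lam _ _, ?_, .refl _, fun c => ?_, by simp [TokIn]⟩, ?_, ?_, ?_⟩
    · exact (DTy.var d i).etaExpand
    · have := Run.etaApp (.var (.exp (.dual d)) i : Tm S) (.num c)
      simpa [scale, comb, Tm.sum, atom, Tm.wk, Tm.rename] using this
    · intro N hN j hj
      simp at hj; subst hj
      simpa [Tm.occ, geWeight] using hN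
    · intro E _ _ p γ w _ hw
      simpa [lsem, gval] using hw i
    · simp [Tm.occ, Tm.size, bpCost]
  | num r =>
    obtain ⟨W, hW, rfl⟩ := hx
    obtain ⟨l, h1, h2, h3, h4⟩ := hL.app hW
    have hT := (hL.leaf hW).2
    refine ⟨0, 4 + B, W, l, ⟨hL.value W hW, hL.dTy W hW, ?_, h4, h2⟩, fun N _ i hi => absurd hi (h3 i), ?_, ?_⟩
    · simp only [Tm.subst, hT.subst_eq]; exact .refl _
    · intro E _ _ p γ w _ hw
      -- The combination of a numeral consists of closed backpropagators only, which count as zero,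
      -- in accordance with the derivative of a constant.
      have : lsem w l = 0 := by
        refine List.sum_eq_zero fun y hy => ?_
        obtain ⟨⟨z, a⟩, hz, rfl⟩ := List.mem_map.1 hy
        match z with
        | .inl i => exact absurd (List.mem_map.2 ⟨_, hz, rfl⟩) (h3 i)
        | .inr _ => simp
      rw [this]
      exact hasFDerivAt_const _ _
    · simp [Tm.occ, Tm.size, bpCost]; omega
  | esub hF hG ih ih' =>
    obtain ⟨x, y, h1, h2, rfl⟩ := hx
    exact BpGround.esub hL hF h1 (ih h1 _) (ih' h2 ρ)
  | @fn f Gs hf hGs ih =>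
    obtain ⟨xs, h1, rfl⟩ := hx
    refine BpGround.op hL (hB f hf) (fun i => ih i (h1 i) ρ) (T := .fn f Gs) (body_subst ?_)
      (c := fun i => fderiv ℝ (S.sem f) (fun i => gval (Gs i) ρ) (Pi.single i 1)) (fun i => .inr rfl)
      (fun W h h' => (Run.fn_node hf _ h h').mono (nodeCost_mono (hB f hf))) (fun _ => rfl) rfl ?_
    · have h1 : ∀ j < S.ar f, ∀ a, geWeight (2 * S.ar f) a (2 * j) = 0 := fun j hj a => if_pos (by omega)
      have h2 : ∀ j < S.ar f, ∀ a, geWeight (2 * S.ar f) a (2 * j + 1) = 0 := fun j hj a => if_pos (by omega)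
      rw [fnBody_occ, Nat.add_eq_zero_iff]
      refine ⟨Finset.sum_eq_zero fun j _ => h1 j.1 j.2 _, Finset.sum_eq_zero fun i _ => ?_⟩
      rw [h2 i.1 i.2, Finset.sum_eq_zero fun (j : Fin _) _ => h1 j.1 (by rw [← S.ar_pd f hf i]; exact j.2) _]
      rfl
    · intro E _ _ p γ D hγ hD
      have h2 := (S.differentiable f hf fun i => gval (Gs i) ρ).hasFDerivAt
      have e : (fun i => gval (Gs i) ρ) = (fun i => gval (Gs i) fun j => γ j p) := by simp only [hγ]
      rw [e] at h2 ⊢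
      have h3 := h2.comp p (hasFDerivAt_pi.2 hD)
      -- The combination of the partial derivatives with the differentials of the arguments is the
      -- composite given by the chain rule, by expansion in the standard basis.
      have e3 : ∑ i, fderiv ℝ (S.sem f) (fun i => gval (Gs i) fun j => γ j p) (Pi.single i 1) • D i =
          (fderiv ℝ (S.sem f) (fun i => gval (Gs i) fun j => γ j p)).comp (ContinuousLinearMap.pi D) := by
        ext v
        have h4 := (fderiv ℝ (S.sem f) (fun i => gval (Gs i) fun j => γ j p)).toLinearMap.pi_apply_eq_sum_univ
          fun i => D i v
        refine Eq.trans ?_ h4.symm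
        rw [sum_apply]
        refine Finset.sum_congr rfl fun i _ => ?_
        rw [smul_apply, smul_eq_mul, smul_eq_mul, mul_comm]
        refine congrArg (_ * ·) (congrArg (fderiv ℝ (S.sem f) fun i => gval (Gs i) fun j => γ j p) ?_)
        funext j; simp [Pi.single_apply, eq_comm]
      rw [e3]
      exact h3
  | @add F G hF hG ih ih' =>
    obtain ⟨x, y, h1, h2, rfl⟩ := hx
    have h0 : 2 ≤ B := by rw [← S.ar_mul]; exact hB _ S.mul_mem
    have := BpGround.op hL (k := 2) h0 (G := ![F, G]) (x := ![x, y]) (ρ := ρ)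
      (fun i => by fin_cases i; exacts [ih h1 ρ, ih' h2 ρ]) (T := .add F G) (b := addBody d)
      (body_subst (by simp [addBody_occ, geWeight])) (c := fun _ => 1) (fun i => .inl ⟨rfl, rfl⟩)
      (fun W h h' => (Run.add_node _ h h').mono (by unfold nodeCost; omega))
      (fun w => by simp [Tm.occ]) (by simp [Tm.size]) ?_
    · simpa [List.ofFn_succ] using this
    · intro E _ _ p γ D _ hD
      have := (hD 0).add (hD 1)
      simp only [Fin.sum_univ_two, one_smul]
      exact this

end LSC
end

noncomputable section

namespace LSC

variable {S : Sig}

/-! # Substitution of the arguments -/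

/-- The pattern of a real variable. -/
abbrev realPat : Pat := .one (.exp .R)

/-- The pattern of a variable of the transformed type of reals. -/
abbrev argPat (d : ℕ) : Pat := .one (.exp (Ty.rev d .R))

/-- The dual number with tangent variable `xᵢ*`, below the binders of `n` real variables. -/
def argTerm (d n i : ℕ) : Tm S :=
  .pair (.var (.exp .R) i) (.lam .lin (.app (.var (.exp (.dual d)) (n + i + 1)) (.var .lin 0)))

/-- The substitution of numerals. -/
abbrev realLet {n : ℕ} (r : Fin n → ℝ) (t : Tm S) : Tm S := letMany realPat (List.ofFn fun i => .num (r i)) t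

/-- The substitution of dual numbers. -/
abbrev argLet (d n : ℕ) (t : Tm S) : Tm S := letMany (argPat d) (List.ofFn fun i : Fin n => argTerm d n i.val) t

/-- The term `z* 1` uses none of the arguments, so their numerals can move next to the dual numbers.
-/
theorem gradTerm_equiv (d n : ℕ) (t : Tm S) (r : Fin n → ℝ) :
    NEq (gradTerm d n t r)
      (.esub (revPat d) (.app (.var (.exp (.dual d)) 1) (.num 1)) (realLet r (argLet d n (t.rev d)))) := by
  have := NEq.letMany_esub (revPat d) realPat (List.ofFn fun i => .num (r i))
    (.app (.var (.exp (.dual d)) 1) (.num 1)) (argLet d n (t.rev d))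
  simp [Tm.wk, Tm.rename, Pat.ar] at this
  exact this

theorem Red.letMany (p : Pat) (us : List (Tm S)) {t t' : Tm S} (h : Red t t') :
    Red (LSC.letMany p us t) (LSC.letMany p us t') := by
  induction us generalizing t t' with
  | nil => exact h
  | cons u us ih => exact ih (Cl.esubL p _ h)

theorem Red.letMany_lookup {A : Ty} {n : ℕ} {us : Fin n → Tm S} (i : Fin n) (hv : Value (us i)) {t t' : Tm S}
    (h : Replace A i.val ((us i).wk 0 n) t t') :
    Red (LSC.letMany (.one (.exp A)) (List.ofFn us) t) (LSC.letMany (.one (.exp A)) (List.ofFn us) t') := by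
  induction n generalizing t t' with
  | zero => exact i.elim0
  | succ n ih =>
    simp only [List.ofFn_succ, LSC.letMany, List.length_ofFn, Pat.ar, one_mul]
    induction i using Fin.cases with
    | zero => exact (Red.lookup (hv.rename _) (by rw [← Tm.wk, wk_wk_zero]; exact h)).letMany _ _
    | succ i =>
      refine ih (us := fun i => us i.succ) i hv (.esubL _ _ ?_)
      rw [wk_wk_zero]; exact h

/-- Two lookups per occurrence: one inserts the dual number, the other replaces the real variable
that it contains by its numeral. Afterwards the term uses none of the `n + n` bound variables, as
the weakening records. -/
theorem Runs.lookups {d n : ℕ} (r : Fin n → ℝ) {ρ : ℕ → ℝ} (hρ : ∀ i : Fin n, ρ i = r i) {x : Tm S}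
    (h1 : x.occ (geWeight n) = 0) (h2 : x.occ (badWeight (Ty.rev d .R) n 0) = 0) :
    Runs (x.occ (blockWeight n 0) + x.occ (blockWeight n 0)) (realLet r (argLet d n x))
      (realLet r (argLet d n ((x.subst (dualSubst d ρ)).wk 0 (n + n)))) := by
  have e1 : x.subst (blockSubst n 0 fun i => (argTerm d n i).wk 0 n) =
      (x.subst fun _ i => argTerm d n i).wk 0 n := by
    rw [Tm.wk, subst_rename]
    refine subst_congr h1 fun a i hi => ?_
    have : i < n := by simp only [geWeight] at hi; by_contra h; simp [h] at hi
    simp [blockSubst, this, Tm.wk, rename_id]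
  have e2 : ((x.subst fun _ i => argTerm d n i).wk 0 n).subst (blockSubst n n fun i => .num (ρ i)) =
      (x.subst (dualSubst d ρ)).wk 0 (n + n) := by
    simp only [Tm.wk, subst_rename, subst_subst]
    refine subst_congr h1 fun a i hi => ?_
    have : i < n := by simp only [geWeight] at hi; by_contra h; simp [h] at hi
    have h3 : ¬ (n + i + n < n + n) := by omega
    simp [argTerm, Tm.rename, Tm.subst, upS, up, blockSubst, dualSubst, this, h3, Tm.wk]
    omega
  have c1 := (replace_block (Ty.rev d .R) n 0 (fun i => (argTerm d n i).wk 0 n) x h2).runs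
    (c := fun t => realLet r (argLet d n t)) fun t t' ⟨i, hi, h⟩ => by
      refine (Red.letMany_lookup (us := fun i : Fin n => argTerm d n i.val) ⟨i, hi⟩ (.pair (.var _ _) (.lam _ _))
        ?_).letMany _ _
      simpa [wk_zero] using h
  have o1 : ∀ w : Ann → ℕ → ℕ, (∀ a i, n + n ≤ i → w a i = 0) →
      ((x.subst fun _ i => argTerm d n i).wk 0 n).occ w = x.occ (fun _ i => w (.exp .R) (i + n)) := by
    intro w hw
    simp only [Tm.wk, occ_rename, occ_subst]
    congr 1; funext a i
    simp only [argTerm, Tm.occ]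
    simp
    exact hw _ _ (by omega)
  have c2 := (replace_block .R n n (fun i => .num (ρ i)) ((x.subst fun _ i => argTerm d n i).wk 0 n) (by
    rw [o1 _ fun a i hi => by simp [badWeight]; omega]
    simp [badWeight, occ_zero])).runs
    (c := fun t => realLet r (argLet d n t)) fun t t' ⟨i, hi, h⟩ => by
      refine Red.letMany_lookup (us := fun i : Fin n => .num (r i)) ⟨i, hi⟩ (.num _)
        (Replace.letMany_body _ _ ?_)
      simp only [List.length_ofFn, Pat.ar, one_mul]
      rw [Nat.add_comm, ← hρ ⟨i, hi⟩]
      exact h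
  rw [e1] at c1
  rw [e2, o1 _ fun a i hi => by simp [blockWeight]; omega] at c2
  refine (c1.trans c2).mono (Nat.add_le_add_left (occ_mono x fun a i => ?_) _)
  simp only [blockWeight]; split_ifs <;> omega

theorem wk_wk_succ (t : Tm S) (a k : ℕ) : (t.wk 0 (a + 1)).wk 1 k = t.wk 0 (a + 1 + k) := by
  simp only [Tm.wk, rename_rename]
  exact rename_ext _ fun i => by simp; omega

/-- Substitutions that are not used can be erased in a constant number of steps. -/
theorem Runs.garbage (d n : ℕ) (r : Fin n → ℝ) (T : Tm S) :
    Runs 3 (realLet r (argLet d n (T.wk 0 (n + n)))) T := by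
  match n, r with
  | 0, r =>
    simp only [realLet, argLet, List.ofFn_zero, LSC.letMany, Nat.add_zero, wk_zero]
    exact (Runs.refl T).mono (by omega)
  | k + 1, r =>
    let lam0 : Tm S := .lam .lin (.app (.var (.exp (.dual d)) (k + 1 + 1)) (.var .lin 0))
    let Ys : List (Tm S) := List.ofFn fun i : Fin k => argTerm d (k + 1) i.succ.val
    -- All other dual numbers move into the argument of the substitution for the first variable, and
    -- there to the second component, since the first one is a variable bound outside them.
    let Q : Tm S := LSC.letMany (argPat d) Ys (lam0.wk 0 k)
    have hlen : Ys.length = k := by simp [Ys]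
    have e1 : NEq (argLet d (k + 1) (T.wk 0 (k + 1 + (k + 1))))
        (.esub (argPat d) (T.wk 0 (k + 1 + 1)) (.pair (.var (.exp .R) 0) Q)) := by
      have h1 := NEq.letMany_esub (argPat d) (argPat d) Ys (T.wk 0 (k + 1 + 1)) ((argTerm d (k + 1) 0).wk 0 k)
      have h2 := NEq.letMany_opR .pair (argPat d) Ys (.var (.exp .R) 0) (lam0.wk 0 k)
      simp only [Pat.ar, one_mul, hlen] at h1 h2
      rw [wk_wk_succ] at h1
      have e0 : argLet d (k + 1) (T.wk 0 (k + 1 + (k + 1))) =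
          LSC.letMany (argPat d) Ys (.esub (argPat d) (T.wk 0 (k + 1 + 1 + k)) ((argTerm d (k + 1) 0).wk 0 k)) := by
        simp only [argLet, List.ofFn_succ, LSC.letMany, List.length_ofFn, Pat.ar, one_mul, Fin.val_zero]
        rw [show k + 1 + (k + 1) = k + 1 + 1 + k by omega]
      rw [e0]
      exact h1.trans (h2.esubR _ _)
    have e2 : NEq (realLet r (argLet d (k + 1) (T.wk 0 (k + 1 + (k + 1)))))
        (.esub (argPat d) (T.wk 0 1) (realLet r (.pair (.var (.exp .R) 0) Q))) := by
      have h1 := NEq.letMany_esub (argPat d) realPat (List.ofFn fun i => .num (r i)) (T.wk 0 1)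
        (.pair (.var (.exp .R) 0) Q)
      simp only [Pat.ar, one_mul, List.length_ofFn] at h1
      rw [wk_wk_succ T 0, show 0 + 1 + (k + 1) = k + 1 + 1 by omega] at h1
      exact (e1.letMany _ _).trans h1
    -- The numerals still bind the first component. Looking it up once frees it of them, so that
    -- they too can move to the second component.
    have h3 : Red (realLet r (.pair (.var (.exp .R) 0) Q)) (realLet r (.pair (.num (r 0)) Q)) :=
      Red.letMany_lookup (us := fun i => .num (r i)) 0 (.num _) (.pairL _ (.here _ _))
    have h4 : NEq (realLet r (.pair (.num (r 0)) Q)) (.pair (.num (r 0)) (realLet r Q)) :=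
      NEq.letMany_opR .pair realPat _ (.num (r 0)) Q
    have hT : DTy d (realLet r Q) (.dual d) := by
      refine ⟨k + 1, HasTy.letMany (by simp only [List.mem_ofFn]; rintro _ ⟨i, rfl⟩; exact .num) ?_⟩
      rw [List.length_ofFn]
      have hdual : ∀ j < k + 1, (List.replicate (k + 1) (Ann.exp .R) ++ dualCtx d (k + 1))[k + 1 + j]? =
          some (.exp (.dual d)) := fun j hj => by
        rw [List.getElem?_append_right (by simp)]
        simp [hj]
      have hlam : ∀ j < k + 1, HasTy (List.replicate (k + 1) (Ann.exp .R) ++ dualCtx d (k + 1)) none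
          (.lam .lin (.app (.var (.exp (.dual d)) (k + 1 + j + 1)) (.var .lin 0)) : Tm S) (.dual d) := fun j hj =>
        .llam (.lapp (.var (by rw [List.getElem?_cons_succ]; exact hdual j hj)) (.lvar rfl))
      refine HasTy.letMany ?_ ?_
      · simp only [Ys, List.mem_ofFn]
        rintro _ ⟨i, rfl⟩
        refine .pair (fun h => absurd rfl h) (.var ?_) (hlam _ i.succ.2)
        rw [List.getElem?_append_left (by simp)]
        simp
      · rw [hlen]
        have := (hlam 0 (by omega)).rename (Δ := List.replicate k (Ann.exp (Ty.rev d .R)) ++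
          (List.replicate (k + 1) (Ann.exp .R) ++ dualCtx d (k + 1))) (f := fun i => i + k) fun i a hi => by
            rw [List.getElem?_append_right (by simp)]; simpa using hi
        simpa [lam0, Tm.wk] using this
    -- The eta-expansion makes the second component an abstraction, whatever it contains. The
    -- argument is then a value, and a single erasing step removes all the substitutions.
    have h5 : Runs 1 (Tm.pair (.num (r 0)) (realLet r Q)) _ :=
      (((Run.refl (.num (r 0))).pair (Run.etaDual hT)).mono (by omega)).runs
    have h6 := (((NEq.run h4).runs.trans h5))
    have h7 := ((Runs.of_red h3).trans h6).ctx (isCtx_esubR (argPat d) (T.wk 0 1))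
    exact (((NEq.run e2).runs.trans h7).trans (Run.gc _ T (.pair (.num _) (.lam _ _))).runs).mono (by omega)

end LSC
end

/-! ### From linear combinations of backpropagators to the gradient. -/

noncomputable section

namespace LSC

variable {S : Sig}

/-! # Elimination of the backpropagators of numerals -/

/-- After merging, `V` is called at most once. The call costs at most `2 + (4 + B)` steps and adds
at most `B` entries, each counted twice; this is the constant `6 + 3 * B`. Since `lV` refers to `L`
only, `V` does not come back. -/
theorem Leaves.eliminate_head {d B : ℕ} {V : Tm S} {L : List (Tm S)} (hL : Leaves d B (V :: L))
    {lV : List (Lbl S × ℝ)} (hlen : lV.length ≤ B) (hT : TokIn L lV) (hkeys : ∀ i, .inl i ∉ lV.map Prod.fst)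
    (hrun : ∀ c, Run (4 + B) (.app V (.num c)) (comb d (scale c lV))) (l : List (Lbl S × ℝ)) (h : TokIn (V :: L) l) :
    ∃ (l' : List (Lbl S × ℝ)) (n : ℕ), TokIn L l' ∧ n + 2 * l'.length ≤ 2 * l.length + (6 + 3 * B) ∧
      (∀ i, .inl i ∈ l'.map Prod.fst → .inl i ∈ l.map Prod.fst) ∧
      (∀ {E : Type} [AddCommGroup E] [Module ℝ E] (w : ℕ → E), lsem w l' = lsem w l) ∧
      Run n (comb d l) (comb d l') := by
  obtain ⟨l₁, k, i1, i2, i3, i4, i5⟩ := comb_normalize hL l h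
  have i5 := i5 1
  rw [scale_one, scale_one] at i5
  have ht1 : TokIn (V :: L) l₁ := tokIn_iff.2 fun W hW => tokIn_iff.1 h W (i3 _ hW)
  have drop : ∀ l : List (Lbl S × ℝ), TokIn (V :: L) l → .inr V ∉ l.map Prod.fst → TokIn L l := by
    intro l hl hV
    rw [tokIn_iff] at hl ⊢
    intro W hW
    rcases List.mem_cons.1 (hl W hW) with rfl | h
    · exact absurd hW hV
    · exact h
  by_cases h0 : .inr V ∈ l₁.map Prod.fst
  · obtain ⟨⟨_, a⟩, hq, rfl⟩ := List.mem_map.1 h0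
    obtain ⟨s₁, s₂, rfl⟩ := List.append_of_mem hq
    have hp : (s₁ ++ (.inr V, a) :: s₂).Perm ((.inr V, a) :: (s₁ ++ s₂)) := List.perm_middle
    have hk := (hp.map Prod.fst).nodup_iff.1 i1
    set l₂ := s₁ ++ s₂
    have ht2 : TokIn (V :: L) ((.inr V, a) :: l₂) := fun q hq => ht1 q (hp.mem_iff.2 hq)
    have ht3 : TokIn L l₂ := drop l₂ (fun q hq => ht2 q (by simp [hq])) (List.nodup_cons.1 hk).1
    have hsub : ∀ l : List (Lbl S × ℝ), TokIn L l → TokIn (V :: L) l :=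
      fun l hl p hp W hW => List.mem_cons_of_mem _ (hl p hp W hW)
    rw [hp.length_eq, List.length_cons] at i2
    refine ⟨scale a lV ++ l₂, k + (2 + (4 + B)), ?_, ?_, ?_, ?_, ?_⟩
    · intro p hp
      rcases List.mem_append.1 hp with hp | hp
      · exact hT.scale a p hp
      · exact ht3 p hp
    · simp only [List.length_append, scale_length]; omega
    · intro i hi
      rw [List.map_append, List.mem_append, scale_keys] at hi
      rcases hi with hi | hi
      · exact absurd hi (hkeys i)
      · exact i3 _ ((hp.map Prod.fst).mem_iff.2 (List.mem_cons_of_mem _ hi))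
    · intro E _ _ w
      have : lsem w lV = 0 := by
        refine List.sum_eq_zero fun y hy => ?_
        obtain ⟨⟨z, b⟩, hz, rfl⟩ := List.mem_map.1 hy
        match z with
        | .inl i => exact absurd (List.mem_map.2 ⟨_, hz, rfl⟩) (hkeys i)
        | .inr _ => simp
      rw [lsem_append, lsem_scale, this, ← i4 w, lsem_perm w hp, lsem_cons]
      simp
    · refine i5.trans ?_
      refine ((comb_perm hL hp ht1).trans (comb_cons hL ht2)).trans_run ?_
      have h1 := (Run.tok (d := d) (hL.value V (by simp)) a).trans (hrun a)
      exact ((h1.add (Run.refl _)).mono (by omega)).trans_neq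
        (comb_append hL (hsub _ (hT.scale a)) (hsub _ ht3))
  · exact ⟨l₁, k, drop l₁ ht1 h0, by omega, fun i hi => i3 _ hi, i4, i5⟩

/-- Following the list order is a topological traversal of the graph of backpropagators: all calls
of a node are known before it is expanded. The cost is linear in the number of nodes, irrespective
of the number of paths. -/
theorem Leaves.eliminate {d B : ℕ} {L : List (Tm S)} (hL : Leaves d B L) (l : List (Lbl S × ℝ)) (h : TokIn L l) :
    ∃ (l' : List (Lbl S × ℝ)) (n : ℕ), TokIn [] l' ∧ n + 2 * l'.length ≤ 2 * l.length + (6 + 3 * B) * L.length ∧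
      (∀ i, .inl i ∈ l'.map Prod.fst → .inl i ∈ l.map Prod.fst) ∧
      (∀ {E : Type} [AddCommGroup E] [Module ℝ E] (w : ℕ → E), lsem w l' = lsem w l) ∧
      Run n (comb d l) (comb d l') := by
  induction hL generalizing l with
  | base =>
    obtain ⟨l', n, h1, h2, h3⟩ := Leaves.base.eliminate_head (d := d) (B := B) (lV := []) (by simp) (by simp [TokIn])
      (by simp) (fun c => by
        have := Run.linBeta (.zero d : Tm S) (.num c)
        rw [Tm.inst, zero_subst] at this
        exact this.mono (by omega)) l h
    exact ⟨l', n, h1, by simpa using h2, h3⟩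
  | @node L k W arg c hL hk hW ha ih =>
    obtain ⟨l₁, n, h1, h2, h3, h4, h5⟩ := (hL.node hk hW ha).eliminate_head
      (lV := List.ofFn fun i => (.inr (W i), c i)) (by simpa using hk)
      (by
        intro p hp V hV
        obtain ⟨i, rfl⟩ := List.mem_ofFn.1 hp
        cases hV
        exact hW i)
      (by simp [List.mem_ofFn])
      (fun x => by
        have := Run.node_app ha (fun i => hL.dTy _ (hW i)) x
        rw [scale, comb, ofFn_fold, ofFn_fold]
        exact this.mono (by omega)) l h
    obtain ⟨l₂, n', i1, i2, i3, i4, i5⟩ := ih l₁ h1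
    refine ⟨l₂, n + n', i1, ?_, fun i hi => h3 i (i3 i hi), fun w => (i4 w).trans (h4 w), h5.trans i5⟩
    rw [List.length_cons, Nat.mul_succ]; omega

/-! # The gradient -/

theorem lsem_map {E F : Type*} [AddCommGroup E] [Module ℝ E] [AddCommGroup F] [Module ℝ F] (φ : E →ₗ[ℝ] F)
    (w : ℕ → E) (l : List (Lbl S × ℝ)) : φ (lsem w l) = lsem (fun i => φ (w i)) l := by
  induction l with
  | nil => simp [lsem]
  | cons p l ih =>
    rw [lsem_cons, lsem_cons, map_add, map_smul, ih]
    rcases p with ⟨z | z, c⟩ <;> simp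

theorem lsem_single_of_notMem (j : ℕ) {l : List (Lbl S × ℝ)} (h : .inl j ∉ l.map Prod.fst) :
    lsem (fun i => if i = j then (1 : ℝ) else 0) l = 0 := by
  refine List.sum_eq_zero fun y hy => ?_
  obtain ⟨⟨z, a⟩, hz, rfl⟩ := List.mem_map.1 hy
  match z with
  | .inl i =>
    have : i ≠ j := by rintro rfl; exact h (List.mem_map.2 ⟨_, hz, rfl⟩)
    simp [this]
  | .inr _ => simp

theorem lsem_single_of_mem {j : ℕ} {c : ℝ} {l : List (Lbl S × ℝ)} (hl : (l.map Prod.fst).Nodup)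
    (h : (.inl j, c) ∈ l) : lsem (fun i => if i = j then (1 : ℝ) else 0) l = c := by
  obtain ⟨s₁, s₂, rfl⟩ := List.append_of_mem h
  have hp : (s₁ ++ (.inl j, c) :: s₂).Perm ((.inl j, c) :: (s₁ ++ s₂)) := List.perm_middle
  have hk := (hp.map Prod.fst).nodup_iff.1 hl
  rw [lsem_perm _ hp, lsem_cons, lsem_single_of_notMem j (List.nodup_cons.1 hk).1]
  simp

/-- Without closed backpropagators and with every variable at most once, a combination is a sum over
a set of variables up to order. The set `J` consists of the variables that occur; a coefficient may
still vanish there. -/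
theorem comb_taggedSum {d B n : ℕ} {L : List (Tm S)} (hL : Leaves d B L) {l : List (Lbl S × ℝ)}
    (hl : (l.map Prod.fst).Nodup) (ht : TokIn [] l) (hn : ∀ i, .inl i ∈ l.map Prod.fst → i < n) (g : Fin n → ℝ)
    (hg : ∀ j : Fin n, g j = lsem (fun i => if i = j.val then (1 : ℝ) else 0) l) :
    ∃ J : Finset (Fin n), (∀ j, j ∉ J → g j = 0) ∧ NEq (comb d l) (taggedSum d J g) := by
  classical
  let J : Finset (Fin n) := Finset.univ.filter fun j => .inl j.val ∈ l.map Prod.fst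
  refine ⟨J, fun j hj => ?_, ?_⟩
  · rw [hg]
    exact lsem_single_of_notMem _ (by simpa [J] using hj)
  let l' : List (Lbl S × ℝ) := ((List.finRange n).filter fun j => decide (j ∈ J)).map fun j => (.inl j.val, g j)
  have hp : l.Perm l' := by
    refine (List.perm_ext_iff_of_nodup hl.of_map ?_).2 ?_
    · refine ((List.nodup_finRange n).filter _).map fun i j hij => ?_
      simp only [Prod.mk.injEq, Sum.inl.injEq] at hij
      exact Fin.ext hij.1
    · rintro ⟨z, c⟩
      simp only [l', List.mem_map, List.mem_filter, List.mem_finRange, true_and, decide_eq_true_eq]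
      constructor
      · intro h
        match z with
        | .inl i =>
          have hi : (.inl i : Lbl S) ∈ l.map Prod.fst := List.mem_map.2 ⟨_, h, rfl⟩
          refine ⟨⟨i, hn i hi⟩, by simpa [J] using hi, ?_⟩
          rw [hg, lsem_single_of_mem hl h]
        | .inr W => exact absurd (ht _ h W rfl) (by simp)
      · rintro ⟨j, hj, h⟩
        obtain ⟨rfl, rfl⟩ := Prod.mk.inj h
        obtain ⟨⟨z, c⟩, hz, hzj⟩ := List.mem_map.1 (Finset.mem_filter.1 hj).2
        obtain rfl : z = .inl j.val := hzj
        rw [hg, lsem_single_of_mem hl hz]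
        exact hz
  have h1 := comb_perm hL hp (fun p hp W hW => absurd (ht p hp W hW) (by simp))
  have e : comb d l' = taggedSum d J g := by
    simp only [comb, l', taggedSum, List.map_map]
    rfl
  rwa [e] at h1

theorem occ_le_size (t : Tm S) {w : Ann → ℕ → ℕ} (hw : ∀ a i, w a i ≤ 1) : t.occ w ≤ t.size := by
  have shift : ∀ (k : ℕ) (w : Ann → ℕ → ℕ), (∀ a i, w a i ≤ 1) → ∀ a i, (if i < k then 0 else w a (i - k)) ≤ 1 := by
    intro k w hw a i
    split_ifs
    · exact Nat.zero_le _
    · exact hw _ _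
  induction t generalizing w with
  | var a i => exact hw a i
  | num r => exact Nat.zero_le _
  | lam a t ih => exact (ih (shift 1 w hw)).trans (Nat.le_succ _)
  | app t u ih ih' => have := ih hw; have := ih' hw; simp only [Tm.occ, Tm.size]; omega
  | pair t u ih ih' => have := ih hw; have := ih' hw; simp only [Tm.occ, Tm.size]; omega
  | esub p t u ih ih' => have := ih (shift p.ar w hw); have := ih' hw; simp only [Tm.occ, Tm.size]; omega
  | add t u ih ih' => have := ih hw; have := ih' hw; simp only [Tm.occ, Tm.size]; omega
  | fn f ts ih =>
    exact (Finset.sum_le_sum fun i _ => ih i hw).trans (Nat.le_succ _)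

theorem size_pos (t : Tm S) : 1 ≤ t.size := by cases t <;> simp [Tm.size]

/-- The coordinates of a point, extended by zeros. -/
def coord {n : ℕ} (i : ℕ) (r : Fin n → ℝ) : ℝ := if h : i < n then r ⟨i, h⟩ else 0

/-- The invariant `Ev` is carried along the evaluation at every point, so `G` computes the same
function as `t` and its derivative can be taken instead. -/
theorem realFun_eq_gval {n : ℕ} {t G : Tm S} (D : Deriv (realCtx n) t .R) (hG : Ground G) {m : ℕ}
    (hs : Steps Beta m t G) : D.realFun = fun q => gval G fun i => coord i q := by
  funext q
  have h0 := D.ev (realEnv n q)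
  have h : Ev G (envOf (realCtx n) (realEnv n q)) ⟨.R, D.den (realEnv n q)⟩ := by
    clear hG
    induction hs with
    | refl => exact h0
    | step _ q ih => exact (ih D h0).beta q
  have := h.gval hG (ρ := fun i => coord i q) fun i x hx => by
    by_cases hi : i < n
    · have e := envOf_realEnv_lt q ⟨i, hi⟩
      rw [hx] at e
      simp only [coord, dif_pos hi]
      exact (eq_of_heq (Sigma.mk.inj e).2).symm
    -- Indices out of range hold a function by the choice made in `envOf`, so they never hold a
    -- real.
    · rw [envOf_realEnv_ge q i (by omega)] at hx
      exact absurd (congrArg Sigma.fst hx) (by simp)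
  exact eq_of_heq (Sigma.mk.inj this).2

theorem ground_occ {n : ℕ} {t G : Tm S} (D : Deriv (realCtx n) t .R) (hG : Ground G) {m : ℕ}
    (hs : Steps Beta m t G) : G.occ (geWeight n) = 0 := by
  have h0 := D.ev (realEnv n 0)
  have h : Ev G (envOf (realCtx n) (realEnv n 0)) ⟨.R, D.den (realEnv n 0)⟩ := by
    clear hG
    induction hs with
    | refl => exact h0
    | step _ q ih => exact (ih D h0).beta q
  refine h.occ_ground hG fun i hi => ?_
  by_cases hn : i < n
  · simp [geWeight, hn]
  · rw [envOf_realEnv_ge 0 i (by omega)] at hi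
    exact absurd hi (by simp)

/-- The gradient term computes the linear combination of its variables given by backpropagation. -/
theorem gradTerm_runs {d B n : ℕ} (hB : ∀ f ∈ S.F, S.ar f ≤ B) {t G : Tm S} (D : Deriv (realCtx n) t .R)
    (hG : Ground G) {m : ℕ} (hs : Steps Beta m t G) (r : Fin n → ℝ) :
    ∃ (L : List (Tm S)) (l : List (Lbl S × ℝ)) (k : ℕ), Leaves d B L ∧ L.length ≤ m + 1 ∧ TokIn L l ∧
      (∀ i, .inl i ∈ l.map Prod.fst → i < n) ∧
      (∀ {E : Type} [NormedAddCommGroup E] [NormedSpace ℝ E] (p : E) (γ : ℕ → E → ℝ) (w : ℕ → E →L[ℝ] ℝ),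
        (∀ i, γ i p = coord i r) → (∀ i, HasFDerivAt (γ i) (w i) p) →
          HasFDerivAt (fun q => gval G fun i => γ i q) (lsem w l) p) ∧
      k + 2 * l.length ≤ m * nodeCost B + bpCost B * G.size + 2 * G.size + 7 ∧
      Runs k (gradTerm d n t r) (comb d l) := by
  obtain ⟨-, L, x, hL, hlen, hx, hrun⟩ := Rv.sim_steps (d := d) hB (D.ev (realEnv n r)) hs
  obtain ⟨n₁, n₂, W, l, h1, h2, h3, h4⟩ := hG.backprop hB hL hx fun i => coord i r
  have hocc := hx.occ (fun W hW => (hL.leaf hW).2) hG.src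
  have hge := ground_occ D hG hs
  have k1 : x.occ (geWeight n) = 0 := by rw [hocc]; exact hge
  have k2 : x.occ (badWeight (Ty.rev d .R) n 0) = 0 := by
    rw [hocc]
    exact hG.occ_eq_zero fun i => by simp [badWeight, Ann.rev]
  have k3 : x.occ (blockWeight n 0) ≤ G.size := by
    rw [hocc]
    exact occ_le_size _ fun a i => by simp only [blockWeight]; split_ifs <;> omega
  have r1 : Runs _ (realLet r (argLet d n (t.rev d))) (x.subst (dualSubst d fun i => coord i r)) :=
    (((hrun.letMany _ _).letMany _ _).runs.trans
      (Runs.lookups r (fun i => by simp [coord]) k1 k2)).trans (Runs.garbage d n r _)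
  have r2 := (r1.trans h1.eval.runs).ctx
    (isCtx_esubR (revPat d) (.app (.var (.exp (.dual d)) 1) (.num 1)))
  have e1 : (Tm.app (.var (.exp (.dual d)) 1) (.num 1) : Tm S) =
      (Tm.app (.var (.exp (.dual d)) 0) (.num 1) : Tm S).wk 0 1 := rfl
  -- The pair is split and its numeral erased, as `z* 1` uses the backpropagator only.
  have r3 : Run 2 (.esub (revPat d) (.app (.var (.exp (.dual d)) 1) (.num 1))
      (.pair (.num (gval G fun i => coord i r)) W)) (LSC.tok d W 1) := by
    rw [e1]
    exact (Run.split _ _ _ _ _).trans ((Run.gc .R _ (v := (Tm.num _).wk 0 1) (.num _)).esubL _ _)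
  have r4 := (r3.trans (Run.tok h1.value 1)).trans (h1.back 1)
  rw [scale_one] at r4
  refine ⟨L, l, _, hL, hlen, h1.tok, h2 n hge, h3, ?_, ((NEq.run (gradTerm_equiv d n t r)).runs.trans r2).trans r4.runs⟩
  omega

theorem hasFDerivAt_coord {n : ℕ} (i : ℕ) (r : Fin n → ℝ) : HasFDerivAt (coord i : (Fin n → ℝ) → ℝ)
    (if h : i < n then ContinuousLinearMap.proj ⟨i, h⟩ else 0 : (Fin n → ℝ) →L[ℝ] ℝ) r := by
  by_cases h : i < n
  · have e : (coord i : (Fin n → ℝ) → ℝ) = fun q => q ⟨i, h⟩ := by funext q; simp [coord, h]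
    rw [dif_pos h, e]
    exact hasFDerivAt_apply _ _
  · have e : (coord i : (Fin n → ℝ) → ℝ) = fun q => 0 := by funext q; simp [coord, h]
    rw [dif_neg h, e]
    exact hasFDerivAt_const _ _

end LSC
end

theorem mainTheorem2 (S : LSC.Sig) :
    ∃ C : ℕ, ∀ (d n : ℕ) (t G : LSC.Tm S) (D : LSC.Deriv (LSC.realCtx n) t LSC.Ty.R) (m : ℕ),
      LSC.Ground G → LSC.Steps LSC.Beta m t G →
      ∀ r : Fin n → ℝ,
        DifferentiableAt ℝ D.realFun r ∧
        ∃ J : Finset (Fin n),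
          (∀ i, i ∉ J → LSC.partialDeriv D.realFun i r = 0) ∧
          ∃ k : ℕ, k ≤ C * (m + G.size) ∧
            LSC.StepsMod LSC.Red LSC.Equiv k (LSC.gradTerm d n t r)
              (LSC.taggedSum d J (fun j => LSC.partialDeriv D.realFun j r)) := by
  obtain ⟨B, hB⟩ : ∃ B, ∀ f ∈ S.F, S.ar f ≤ B := by
    obtain ⟨B, hB⟩ := (S.finite_F.image S.ar).bddAbove
    exact ⟨B, fun f hf => hB ⟨f, hf, rfl⟩⟩
  -- The summands of the constant pay in turn for simulation, backpropagation, the `2 * G.size + 7`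
  -- steps of lookups, erasure and the initial call, and elimination together with its potential.
  refine ⟨LSC.nodeCost B + LSC.bpCost B + 9 + (6 + 3 * B), fun d n t G D m hG hs r => ?_⟩
  obtain ⟨L, l, k, hL, hlen, hT, hn, hder, hk, hruns⟩ := LSC.gradTerm_runs (d := d) hB D hG hs r
  -- The combination found by backpropagation is evaluated with the coordinate projections as
  -- differentials of the variables.
  have hD := hder r (fun i => LSC.coord i) _ (fun _ => rfl) fun i => LSC.hasFDerivAt_coord i r
  rw [← LSC.realFun_eq_gval D hG hs] at hD
  obtain ⟨l₁, k₁, i1, i2, i3, i4, i5⟩ := hL.eliminate l hT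
  have hT1 : LSC.TokIn L l₁ := fun p hp W hW => absurd (i1 p hp W hW) (by simp)
  obtain ⟨l₂, k₂, j1, j2, j3, j4, j5⟩ := LSC.comb_normalize hL l₁ hT1
  have j5 := j5 1
  rw [LSC.scale_one, LSC.scale_one] at j5
  have hT2 : LSC.TokIn [] l₂ := LSC.tokIn_iff.2 fun W hW => LSC.tokIn_iff.1 i1 W (j3 _ hW)
  have hg : ∀ j : Fin n, LSC.partialDeriv D.realFun j r =
      LSC.lsem (fun i => if i = j.val then (1 : ℝ) else 0) l₂ := by
    intro j
    rw [LSC.partialDeriv, hD.fderiv, j4, i4]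
    -- Evaluating the differential at the `j`-th basis vector extracts the coefficient of `xⱼ*`.
    have := LSC.lsem_map (ContinuousLinearMap.apply ℝ ℝ (Pi.single j (1 : ℝ) : Fin n → ℝ)).toLinearMap
      (fun i => if h : i < n then (ContinuousLinearMap.proj ⟨i, h⟩ : (Fin n → ℝ) →L[ℝ] ℝ) else 0) l
    refine Eq.trans this (congrArg (fun w => LSC.lsem w l) (funext fun i => ?_))
    by_cases h : i < n
    · by_cases hij : i = j.val
      · subst hij; simp
      · have : (⟨i, h⟩ : Fin n) ≠ j := fun e => hij (congrArg Fin.val e)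
        simp [h, hij, this]
    · have : i ≠ j.val := fun e => h (e ▸ j.2)
      simp [h, this]
  obtain ⟨J, hJ, hsum⟩ := LSC.comb_taggedSum (d := d) hL j1 hT2 (fun i hi => hn i (i3 i (j3 _ hi))) _ hg
  obtain ⟨K, hK, hsteps⟩ := ((hruns.trans i5.runs).trans j5.runs).trans (LSC.NEq.run hsum).runs
  refine ⟨hD.differentiableAt, J, hJ, K, hK.trans ?_, hsteps⟩
  -- As `G` has size at least one, additive constants are absorbed into multiples of `G.size`, also
  -- when `m = 0`.
  have hsize := LSC.size_pos G
  have h1 : (6 + 3 * B) * L.length ≤ (6 + 3 * B) * (m + 1) := Nat.mul_le_mul_left _ hlen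
  have h2 : k + k₁ + k₂ + 0 ≤ m * LSC.nodeCost B + LSC.bpCost B * G.size + 2 * G.size + 7 +
      (6 + 3 * B) * (m + 1) := by omega
  nlinarith [Nat.zero_le (LSC.nodeCost B * G.size), Nat.zero_le (LSC.bpCost B * m),
    Nat.mul_le_mul_left (6 + 3 * B) hsize]
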